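/- Let $\Delta$ be a (reduced, crystallographic) root system of rank $l$ with simple roots $\Pi=\{\alpha_1,\dots,\alpha_l\}\subset\mathfrak h^*$, Cartan matrix $C$, Weyl group $W$ with simple reflections $s_i=s_{\alpha_i}$ and length function $\ell$, acting on the real Cartan subalgebra $\mathfrak h$. Let $x_0\in\mathfrak h$ lie in the open dominant chamber, let $\Gamma\subset\mathfrak h$ be the convex hull of $Wx_0$, let $\overline C_e$ be the part of $\Gamma$ in the closed dominant chamber, and put $\overline C_w=w\,\overline C_e$. The internal wall of $\overline C_w$ of type $i$ is $C_w^{i,IN}=w\{x\in\overline C_e:\alpha_i(x)=0\}$; the external wall of type $i$ is $C_w^{i,OUT}=w\{x\in\overline C_e: x-x_0\in\operatorname{span}\{\alpha_j^\vee: j\neq i\}\}$, the part in $\overline C_w$ of the facet of $\Gamma$ that meets every internal wall $C_w^{j,IN}$ with $j\ne i$ and does not meet $C_w^{i,IN}$. A marked Dynkin diagram $\delta$ is the Dynkin diagram of $\Delta$ with signs $s_{ij},s_{ji}\in\{\pm1\}$ for every edge $\{\alpha_i,\alpha_j\}$, such that $s_{ij}=s_{ji}$ for a single edge and $(s_{ij},s_{ji})\ne(-1,-1)$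 for a double edge (no condition for a triple edge); put $s_{ij}=1$ if $\alpha_i,\alpha_j$ are not joined by an edge. On the set of signs $\mathcal E=\{\pm1\}^l$ let $s_i$ map $\epsilon$ to $s_i\epsilon$, where $(s_i\epsilon)_j=\epsilon_j$ if $\epsilon_i=1$ and $(s_i\epsilon)_j=s_{ij}\epsilon_j$ if $\epsilon_i=-1$. Assume that $\delta$ gives rise to a twisted sign action, i.e. that these maps extend to an action of $W$ on $\mathcal E$. Let $M(\delta)$ be the twisted Tomei manifold: the quotient space of the disjoint union $\bigsqcup_{\epsilon\in\mathcal E,\,w\in W}\{\epsilon\}\times\{w\}\times\overline C_w$ by the identifications $$(\epsilon,w,x)\sim(s_i\epsilon,\,ws_i,\,x)\ \text{ for } x\in C_w^{i,IN},\qquad (\epsilon,w,x)\sim(\epsilon^{(i)},w,x)\ \text{ for } x\in C_w^{i,OUT},$$ where $\epsilon^{(i)}$ is $\epsilon$ with the $i$-th sign changed. Then for every $k=0,1,\dots,l$ the homology group $H_k(M(\delta);\mathbb Z/2\mathbb Z)$ has rank $e(k)$ over $\mathbb Z/2\mathbb Z$, where $e(k)$ is the number of $w\in W$ such that exactly $k$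 of the simple roots $\alpha_i$ satisfy $\ell(s_iw)>\ell(w)$. -/

import Mathlib

universe u

noncomputable section

namespace TwistedTomei

section RootData

variable {ι V H : Type u} [AddCommGroup V] [Module ℝ V] [AddCommGroup H] [Module ℝ H]

/-- The linear action of the Weyl group on the Cartan subalgebra `H` (the space of coweights),
normalised to be a left action: `⟨α, w x⟩ = ⟨w⁻¹ α, x⟩`. -/
def weylAct (P : RootPairing ι ℝ V H) (w : P.weylGroup) (x : H) : H :=
  MulOpposite.op ((w⁻¹ : P.weylGroup) : P.Aut) • x

variable {P : RootPairing ι ℝ V H} (b : P.Base)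

/-- The simple reflection attached to a simple root. -/
def simpleReflection (i : b.support) : P.weylGroup :=
  RootPairing.weylGroup.ofIdx P i

/-- The length of an element of the Weyl group: the least number of factors in an expression as
a product of simple reflections. -/
def length (w : P.weylGroup) : ℕ :=
  sInf {n | ∃ c : List b.support, c.length = n ∧ (c.map (simpleReflection b)).prod = w}

/-- The set `Π^u(w)` of the simple roots `α` with `ℓ(s_α w) > ℓ(w)`. -/
def unstableRoots (w : P.weylGroup) : Set b.support :=
  {i | length b w < length b (simpleReflection b i * w)}

/-- The number `e(k)` of Weyl group elements of index `k`, the index of `w` being `|Π^u(w)|`. -/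
def numIndex (k : ℕ) : ℕ :=
  Nat.card {w : P.weylGroup // (unstableRoots b w).ncard = k}

/-- A point of the open dominant Weyl chamber. -/
def StrictlyDominant (x₀ : H) : Prop :=
  ∀ i : b.support, 0 < P.toLinearMap (P.root i) x₀

/-- The polytope `Γ`, the convex hull of the Weyl group orbit of `x₀`. -/
def polytope (P : RootPairing ι ℝ V H) (x₀ : H) : Set H :=
  convexHull ℝ (Set.range fun w : P.weylGroup => weylAct P w x₀)

/-- The part of the polytope in the closed dominant Weyl chamber. -/
def dominantCell (x₀ : H) : Set H :=
  {x | x ∈ polytope P x₀ ∧ ∀ i : b.support, 0 ≤ P.toLinearMap (P.root i) x}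

/-- The part of the polytope in the closed Weyl chamber of `w`. -/
def chamberCell (x₀ : H) (w : P.weylGroup) : Set H :=
  weylAct P w '' dominantCell b x₀

/-- The internal wall of the chamber of `w` of type `α_i`. -/
def innerWall (x₀ : H) (w : P.weylGroup) (i : b.support) : Set H :=
  weylAct P w '' {x | x ∈ dominantCell b x₀ ∧ P.toLinearMap (P.root i) x = 0}

/-- The external wall of the chamber of `w` of type `α_i`. For `w = 1` it is the intersection of
the dominant cell with the facet of the polytope that passes through `x₀` in the directions
`x₀ - s_j x₀` (multiples of the simple coroots), `j ≠ i`; it meets the internal wall of type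
`α_j` if and only if `j ≠ i`. -/
def outerWall (x₀ : H) (w : P.weylGroup) (i : b.support) : Set H :=
  weylAct P w '' {x | x ∈ dominantCell b x₀ ∧
    x - x₀ ∈ Submodule.span ℝ {y | ∃ j : b.support, j ≠ i ∧ y = P.coroot j}}

/-- The group of signs `{±1}^l`, the coordinates being indexed by the simple roots. -/
abbrev Signs : Type u := b.support → ℤˣ

/-- Change the `i`-th sign. -/
def flipSign (i : b.support) (ε : Signs b) : Signs b := by
  classical exact Function.update ε i (-ε i)

variable [P.IsCrystallographic]

/-- A marked Dynkin diagram: every edge `{i, j}` of the Dynkin diagram carries the signs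
`sign i j`, `sign j i`, which are equal on a single edge, not both `-1` on a double edge, and
arbitrary on a triple edge. The number of lines joining `i ≠ j` is `C i j * C j i`, with `C` the
Cartan matrix. Pairs that are not edges carry no mark; they are given the value `1`. -/
structure MarkedDynkinDiagram where
  sign : b.support → b.support → ℤˣ
  sign_self : ∀ i, sign i i = 1
  sign_not_joined : ∀ i j, b.cartanMatrix i j * b.cartanMatrix j i = 0 → sign i j = 1
  single_edge : ∀ i j, b.cartanMatrix i j * b.cartanMatrix j i = 1 → sign i j = sign j i
  double_edge : ∀ i j, b.cartanMatrix i j * b.cartanMatrix j i = 2 →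
    ¬ (sign i j = -1 ∧ sign j i = -1)

namespace MarkedDynkinDiagram

variable {b}
variable (δ : MarkedDynkinDiagram b)

/-- The map on signs attached to `s_{α_i}`: `ε_j ↦ ε_j ε_i ^ a_{j,i}` where
`(-1) ^ a_{j,i}` is the mark `sign i j`. -/
def reflectSigns (i : b.support) (ε : Signs b) : Signs b :=
  fun j => if ε i = -1 then ε j * δ.sign i j else ε j

/-- The marked Dynkin diagram gives rise to a twisted sign action: the maps attached to the simple
reflections extend to an action of the Weyl group on the set of signs. -/
def GivesTwistedSignAction : Prop :=
  ∃ ρ : P.weylGroup →* Equiv.Perm (Signs b),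
    ∀ (i : b.support) (ε : Signs b), ρ (simpleReflection b i) ε = δ.reflectSigns i ε

end MarkedDynkinDiagram

/-- The disjoint union of the chambers of the polytope with all possible signs. -/
abbrev SignedChambers (x₀ : H) : Type u :=
  Σ p : Signs b × P.weylGroup, chamberCell b x₀ p.2

variable {b}

/-- The identifications along the internal and the external walls:
`(ε, w, x) ∼ (s_{α_i} ε, w s_{α_i}, x)` for `x` in the internal wall of type `α_i`, and
`(ε, w, x) ∼ (ε^{(i)}, w, x)` for `x` in the external wall of type `α_i`. -/
inductive Glue (δ : MarkedDynkinDiagram b) (x₀ : H) :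
    SignedChambers b x₀ → SignedChambers b x₀ → Prop
  | inner (i : b.support) (ε : Signs b) (w : P.weylGroup) (x : H)
      (hx : x ∈ chamberCell b x₀ w) (hx' : x ∈ chamberCell b x₀ (w * simpleReflection b i))
      (h : x ∈ innerWall b x₀ w i) :
      Glue δ x₀ ⟨(ε, w), ⟨x, hx⟩⟩
        ⟨(δ.reflectSigns i ε, w * simpleReflection b i), ⟨x, hx'⟩⟩
  | outer (i : b.support) (ε : Signs b) (w : P.weylGroup) (x : H)
      (hx : x ∈ chamberCell b x₀ w) (h : x ∈ outerWall b x₀ w i) :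
      Glue δ x₀ ⟨(ε, w), ⟨x, hx⟩⟩ ⟨(flipSign b i ε, w), ⟨x, hx⟩⟩

/-- The twisted Tomei manifold `M(δ)`: the quotient space of the disjoint union of the signed
chambers by the equivalence relation generated by the gluing of the walls. -/
abbrev TwistedTomeiManifold (δ : MarkedDynkinDiagram b) (x₀ : H) : Type u :=
  Quot (Glue δ x₀)

end RootData

/-- Singular homology of a topological space with coefficients in `ℤ/2ℤ`. -/
abbrev HomologyModTwo (k : ℕ) (X : Type u) [TopologicalSpace X] : ModuleCat.{u} (ZMod 2) :=
  ((AlgebraicTopology.singularHomologyFunctor (ModuleCat.{u} (ZMod 2)) k).obj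
    (ModuleCat.of (ZMod 2) (ULift.{u} (ZMod 2)))).obj (TopCat.of X)

end TwistedTomei

end

/-! Passing from `(ε, w, x)` to `(ρ w ε, x)` makes the internal gluings trivial, since `ρ (w s_i)
(s_i ε) = ρ w ε`. So the space is glued from copies of the whole polytope, one for each sign vector
`η`, along its facets only. The facets are the pairs of a type `i` and a coset `w W_i`, where `W_i`
is generated by the `s_j` with `j ≠ i`. The copies along such a facet are interchanged by `η ↦ ρ w
(flip_i (ρ w⁻¹ η))`. This depends only on the coset, because `flip_i` commutes with `s_j` for `j ≠
i`. In the coordinates `ρ w⁻¹ η` the involutions at the vertex `w x₀` are the `l` sign changes.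
Hence a face cut out by a set `S` of facets, together with an orbit of the involutions of `S`, is
dual to a cube of dimension `|S|`, and these cubes form a cell complex (`coloring`, `realization`).

The homology of the cube complex comes from a linear height function. Each face has a unique highest
vertex. The cells over a fixed vertex `w`, modulo those over higher vertices, again form a cube
complex; it contributes one class, in the degree given by the number of ascending edges at `w`. The
two opposite faces of a cube in one direction are dual to the same face of the polytope. Thus,
modulo two, counting the cells dual to a given face vanishes on all boundaries
(`toVertices_differential`), no classes cancel, and each vertex gives a basis element
(`exists_vertex_cycles`). The edge at `w` in direction `i` ascends exactly if `w α_i` is positive,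
that is, if `s_i` lengthens `w⁻¹` from the left (`mem_unstableRoots_iff`); inversion on the Weyl
group then gives the count.

The cube complex is compared with singular homology by acyclic carriers. The open stars of the cells
are contractible (`contractibleSpace_star`) and the cubes are acyclic (`acyclicOn_relStar`). So
there is a chain map from cells to singular chains carried by the stars, and its mapping cone is
acyclic by a Mayer–Vietoris induction over upper sets of cells (`acyclicOn_coneOn`). The input for
this is the theorem on small chains (`exists_add_boundary_mem_sup`), proved by barycentric
subdivision. Complexes are augmented by an empty simplex and kept as single vector spaces; degrees
are recovered by projections and count vertices, one more than the dimension. -/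

open Finsupp

noncomputable section

/-! ### Augmented singular chains modulo two -/

namespace SingularModTwo

/-- The standard simplex with `n` vertices; it is empty for `n = 0`. -/
abbrev Simplex (n : ℕ) : Type := stdSimplex ℝ (Fin n)

instance : IsEmpty (Simplex 0) :=
  ⟨fun x => by have := x.2.2; simp at this⟩

/-- The inclusion of the `i`-th face. -/
def face {n : ℕ} (i : Fin (n + 1)) : C(Simplex n, Simplex (n + 1)) :=
  ⟨stdSimplex.map i.succAbove, stdSimplex.continuous_map _⟩

/-- The singular simplices of `X`, the empty one included. -/
abbrev Simp (X : Type*) [TopologicalSpace X] : Type _ := Σ n : ℕ, C(Simplex n, X)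

/-- Augmented singular chains modulo two. -/
abbrev Chain (X : Type*) [TopologicalSpace X] : Type _ := Simp X →₀ ZMod 2

variable {X Y Z : Type*} [TopologicalSpace X] [TopologicalSpace Y] [TopologicalSpace Z]

/-- The chain of a single singular simplex. -/
def of {n : ℕ} (σ : C(Simplex n, X)) : Chain X := single ⟨n, σ⟩ 1

/-- The boundary of a singular simplex. -/
def simpBoundary : Simp X → Chain X
  | ⟨0, _⟩ => 0
  | ⟨_ + 1, σ⟩ => ∑ i, of (σ.comp (face i))

/-- The boundary operator. -/
def boundary : Chain X →ₗ[ZMod 2] Chain X := linearCombination (ZMod 2) simpBoundary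

/-- The chain map induced by a continuous map. -/
def map (f : C(X, Y)) : Chain X →ₗ[ZMod 2] Chain Y :=
  lmapDomain (ZMod 2) (ZMod 2) fun s => ⟨s.1, f.comp s.2⟩

lemma hom_ext {M : Type*} [AddCommGroup M] [Module (ZMod 2) M] {f g : Chain X →ₗ[ZMod 2] M}
    (h : ∀ n (σ : C(Simplex n, X)), f (of σ) = g (of σ)) : f = g := by
  apply Finsupp.lhom_ext'
  rintro ⟨n, σ⟩
  apply LinearMap.ext_ring
  exact h n σ

lemma boundary_of {n : ℕ} (σ : C(Simplex n, X)) : boundary (of σ) = simpBoundary ⟨n, σ⟩ := by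
  simp [boundary, of]

@[simp]
lemma boundary_of_zero (σ : C(Simplex 0, X)) : boundary (of σ) = 0 := by
  rw [boundary_of]; rfl

lemma boundary_of_succ {n : ℕ} (σ : C(Simplex (n + 1), X)) :
    boundary (of σ) = ∑ i, of (σ.comp (face i)) := by
  rw [boundary_of]; rfl

@[simp]
lemma map_of (f : C(X, Y)) {n : ℕ} (σ : C(Simplex n, X)) : map f (of σ) = of (f.comp σ) := by
  simp [map, of]

lemma map_comp (f : C(X, Y)) (g : C(Y, Z)) (c : Chain X) : map g (map f c) = map (g.comp f) c := by
  have : map g ∘ₗ map f = map (g.comp f) := hom_ext fun n σ => by simp [ContinuousMap.comp_assoc]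
  exact LinearMap.congr_fun this c

lemma map_boundary (f : C(X, Y)) (c : Chain X) : map f (boundary c) = boundary (map f c) := by
  have : map f ∘ₗ boundary = boundary ∘ₗ map f := hom_ext fun n σ => by
    cases n with
    | zero => simp
    | succ n => simp [boundary_of_succ, ContinuousMap.comp_assoc]
  exact LinearMap.congr_fun this c

/-- The simplicial identity, written so that one formula covers both orders of the indices: the pair
on the left is the image of `(i, j)` under the involution that exchanges the order in which two
vertices are omitted. -/
lemma face_face {n : ℕ} (i : Fin (n + 2)) (j : Fin (n + 1)) :
    (face (i.succAbove j)).comp (face (j.predAbove i)) = (face i).comp (face j) := by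
  ext1 x
  simp only [face, ContinuousMap.comp_apply, ContinuousMap.coe_mk, stdSimplex.map_comp_apply]
  congr 1
  funext k
  exact Fin.succAbove_succAbove_succAbove_predAbove i j k

lemma boundary_boundary (c : Chain X) : boundary (boundary c) = 0 := by
  have : (boundary ∘ₗ boundary : Chain X →ₗ[ZMod 2] Chain X) = 0 := hom_ext fun n σ => by
    match n, σ with
    | 0, σ => simp
    | 1, σ => simp [boundary_of_succ]
    | n + 2, σ =>
      simp only [LinearMap.comp_apply, boundary_of_succ, map_sum, LinearMap.zero_apply]
      rw [← Finset.sum_product']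
      -- Each face of codimension two is reached by omitting its two vertices in either order; the
      -- two occurrences cancel modulo two.
      refine Finset.sum_involution (fun p _ => (p.1.succAbove p.2, p.2.predAbove p.1)) ?_ ?_ ?_ ?_
      · rintro ⟨i, j⟩ -
        simp only [ContinuousMap.comp_assoc, face_face]
        exact ZModModule.add_self _
      · rintro ⟨i, j⟩ - - h
        exact Fin.succAbove_ne i j (congrArg Prod.fst h)
      · simp
      · rintro ⟨i, j⟩ -
        ext1
        · exact Fin.succAbove_succAbove_predAbove i j
        · exact Fin.predAbove_predAbove_succAbove i j
  exact LinearMap.congr_fun this c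

lemma map_injective {f : C(X, Y)} (hf : Function.Injective f) : Function.Injective (map f) := by
  apply Finsupp.mapDomain_injective
  rintro ⟨n, σ⟩ ⟨m, τ⟩ h
  obtain rfl : n = m := congrArg Sigma.fst h
  simp only [Sigma.mk.injEq, heq_eq_eq, true_and] at h ⊢
  ext1 x
  exact hf (DFunLike.congr_fun h x)

/-- The chains whose simplices lie in `A`. -/
def chainsIn (A : Set X) : Submodule (ZMod 2) (Chain X) :=
  supported (ZMod 2) (ZMod 2) {s | ∀ x, s.2 x ∈ A}

lemma of_mem_chainsIn {A : Set X} {n : ℕ} {σ : C(Simplex n, X)} (h : ∀ x, σ x ∈ A) :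
    of σ ∈ chainsIn A :=
  single_mem_supported _ _ h

/-- The only scalars are `0` and `1`, so no case for scalar multiples is needed. -/
lemma chainsIn_induction {A : Set X} {p : Chain X → Prop} {c : Chain X} (hc : c ∈ chainsIn A)
    (zero : p 0) (add : ∀ a b, p a → p b → p (a + b))
    (simp : ∀ n (σ : C(Simplex n, X)), (∀ x, σ x ∈ A) → p (of σ)) : p c := by
  rw [chainsIn, supported_eq_span_single] at hc
  induction hc using Submodule.span_induction with
  | mem x h => obtain ⟨⟨n, σ⟩, h, rfl⟩ := h; exact simp n σ h
  | zero => exact zero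
  | add x y _ _ hx hy => exact add _ _ hx hy
  | smul a x _ hx =>
    obtain rfl | rfl : a = 0 ∨ a = 1 := by revert a; decide
    · rwa [zero_smul]
    · rwa [one_smul]

lemma chainsIn_mono {A B : Set X} (h : A ⊆ B) : chainsIn A ≤ chainsIn B :=
  supported_mono fun _ hs x => h (hs x)

/-- This is the intersection term of Mayer–Vietoris. The analogue for unions fails, since a simplex
in `A ∪ B` may lie in neither set; repairing it is the purpose of subdivision. -/
lemma chainsIn_inter (A B : Set X) : chainsIn A ⊓ chainsIn B = chainsIn (A ∩ B) := by
  rw [chainsIn, chainsIn, ← supported_inter]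
  congr 1
  ext s
  simp [forall_and]

lemma chainsIn_univ : chainsIn (Set.univ : Set X) = ⊤ := by
  simp [chainsIn, supported_univ]

lemma linearMap_mem_of_chainsIn {A : Set X} {M : Type*} [AddCommGroup M] [Module (ZMod 2) M]
    (f : Chain X →ₗ[ZMod 2] M) {N : Submodule (ZMod 2) M}
    (h : ∀ n (σ : C(Simplex n, X)), (∀ x, σ x ∈ A) → f (of σ) ∈ N) {c : Chain X}
    (hc : c ∈ chainsIn A) : f c ∈ N := by
  refine chainsIn_induction (p := fun c => f c ∈ N) hc (by simp) (fun a b ha hb => ?_) h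
  rw [map_add]
  exact add_mem ha hb

lemma boundary_mem_chainsIn {A : Set X} {c : Chain X} (hc : c ∈ chainsIn A) :
    boundary c ∈ chainsIn A := by
  refine linearMap_mem_of_chainsIn _ (fun n σ hσ => ?_) hc
  cases n with
  | zero => simp
  | succ n =>
    rw [boundary_of_succ]
    exact sum_mem fun i _ => of_mem_chainsIn fun x => hσ _

lemma map_mem_chainsIn {A : Set Y} {f : C(X, Y)} (h : ∀ x, f x ∈ A) (c : Chain X) :
    map f c ∈ chainsIn A := by
  refine linearMap_mem_of_chainsIn (A := Set.univ) _ (fun n σ _ => ?_) (by simp [chainsIn_univ])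
  rw [map_of]
  exact of_mem_chainsIn fun x => h _

lemma exists_map_of_mem_chainsIn {A : Set X} {c : Chain X} (hc : c ∈ chainsIn A) :
    ∃ c' : Chain A, map ⟨Subtype.val, continuous_subtype_val⟩ c' = c := by
  refine chainsIn_induction
    (p := fun c => ∃ c' : Chain A, map ⟨Subtype.val, continuous_subtype_val⟩ c' = c)
    hc ⟨0, map_zero _⟩ ?_ fun n σ hσ => ?_
  · rintro _ _ ⟨a', rfl⟩ ⟨b', rfl⟩
    exact ⟨a' + b', map_add _ _ _⟩
  · refine ⟨of ⟨fun x => ⟨σ x, hσ x⟩, by fun_prop⟩, ?_⟩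
    rw [map_of]
    rfl

/-! ### The degree -/

/-- The part of a chain in a given degree, the degree being the number of vertices. -/
def degreePart (n : ℕ) : Chain X →ₗ[ZMod 2] Chain X :=
  (supported (ZMod 2) (ZMod 2) {s : Simp X | s.1 = n}).subtype ∘ₗ
    restrictDom (ZMod 2) (ZMod 2) {s : Simp X | s.1 = n}

lemma degreePart_of (m : ℕ) {n : ℕ} (σ : C(Simplex n, X)) :
    degreePart m (of σ) = if n = m then of σ else 0 := by
  classical
  simp only [degreePart, of, LinearMap.comp_apply, Submodule.subtype_apply, restrictDom_apply]
  split_ifs with h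
  · exact Finsupp.filter_single_of_pos _ h
  · exact Finsupp.filter_single_of_neg _ h

lemma degreePart_boundary (n : ℕ) (c : Chain X) :
    degreePart n (boundary c) = boundary (degreePart (n + 1) c) := by
  have : (degreePart n ∘ₗ boundary : Chain X →ₗ[ZMod 2] _) = boundary ∘ₗ degreePart (n + 1) :=
    hom_ext fun m σ => by
      cases m with
      | zero => simp [degreePart_of]
      | succ m =>
        simp only [LinearMap.comp_apply, boundary_of_succ, map_sum, degreePart_of,
          Nat.add_right_cancel_iff]
        split_ifs <;> simp [boundary_of_succ]
  exact LinearMap.congr_fun this c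

lemma degreePart_mem_chainsIn {A : Set X} {c : Chain X} (hc : c ∈ chainsIn A) (n : ℕ) :
    degreePart n c ∈ chainsIn A := by
  refine linearMap_mem_of_chainsIn _ (fun m σ hσ => ?_) hc
  rw [degreePart_of]
  split_ifs
  · exact of_mem_chainsIn hσ
  · exact zero_mem _

lemma degreePart_degreePart (m n : ℕ) (c : Chain X) :
    degreePart m (degreePart n c) = if n = m then degreePart n c else 0 := by
  have : (degreePart m ∘ₗ degreePart n : Chain X →ₗ[ZMod 2] _) =
      if n = m then degreePart n else 0 := hom_ext fun k σ => by
    simp only [LinearMap.comp_apply, degreePart_of]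
    split_ifs <;> simp_all [degreePart_of]
  rw [← LinearMap.comp_apply, this]
  split_ifs <;> rfl

/-! ### Cones -/

/-- The point of the join of the vertex `0` with the opposite face. -/
def join {n : ℕ} (s : unitInterval) (u : Simplex n) : Simplex (n + 1) :=
  ⟨Fin.cons (s : ℝ) fun i => (1 - s) * u i, by
    refine ⟨fun i => ?_, ?_⟩
    · refine Fin.cases ?_ (fun i => ?_) i
      · exact s.2.1
      · exact mul_nonneg (sub_nonneg.2 s.2.2) (u.2.1 i)
    · rw [Fin.sum_univ_succ]
      simp only [Fin.cons_zero, Fin.cons_succ, ← Finset.mul_sum]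
      rw [stdSimplex.sum_eq_one]
      ring⟩

@[simp]
lemma join_zero_apply {n : ℕ} (s : unitInterval) (u : Simplex n) : join s u 0 = s := rfl

@[simp]
lemma join_succ_apply {n : ℕ} (s : unitInterval) (u : Simplex n) (i : Fin n) :
    join s u i.succ = (1 - s) * u i := rfl

lemma continuous_join {n : ℕ} :
    Continuous fun p : unitInterval × Simplex n => join p.1 p.2 := by
  refine Continuous.subtype_mk (continuous_pi fun i => ?_) _
  refine Fin.cases ?_ (fun i => ?_) i
  · simp only [Fin.cons_zero]; fun_prop
  · simp only [Fin.cons_succ]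
    have : Continuous fun p : unitInterval × Simplex n => p.2 i :=
      (continuous_apply i).comp (continuous_subtype_val.comp continuous_snd)
    fun_prop

lemma simplex_ext_succ {n : ℕ} {x y : Simplex (n + 1)} (h0 : x 0 = y 0)
    (h : ∀ i : Fin n, x i.succ = y i.succ) : x = y := by
  ext i
  exact Fin.cases h0 h i

lemma eq_vertex_of_zero_apply {n : ℕ} {x : Simplex (n + 1)} (h : x 0 = 1) :
    x = stdSimplex.vertex 0 := by
  refine simplex_ext_succ (by simp [h]) fun i => ?_
  have h1 := stdSimplex.sum_eq_one x
  rw [Fin.sum_univ_succ, h, add_eq_left,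
    Finset.sum_eq_zero_iff_of_nonneg fun i _ => stdSimplex.zero_le x _] at h1
  simp [h1 i (Finset.mem_univ _)]

lemma join_one {n : ℕ} (u : Simplex n) : join 1 u = stdSimplex.vertex 0 :=
  eq_vertex_of_zero_apply (by simp)

lemma exists_eq_join {n : ℕ} {x : Simplex (n + 1)} (h : x 0 ≠ 1) : ∃ s u, x = join s u := by
  have h0 : 0 < 1 - x 0 := sub_pos.2 (lt_of_le_of_ne (stdSimplex.le_one x 0) h)
  refine ⟨⟨x 0, stdSimplex.zero_le x 0, stdSimplex.le_one x 0⟩,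
    ⟨fun i => x i.succ / (1 - x 0), fun i => div_nonneg (stdSimplex.zero_le x _) h0.le, ?_⟩, ?_⟩
  · rw [← Finset.sum_div, div_eq_one_iff_eq h0.ne']
    have h1 := stdSimplex.sum_eq_one x
    rw [Fin.sum_univ_succ] at h1
    linarith
  · refine simplex_ext_succ rfl fun i => ?_
    rw [join_succ_apply]
    exact (mul_div_cancel₀ _ h0.ne').symm

lemma join_injective {n : ℕ} {s s' : unitInterval} {u u' : Simplex n} (h : join s u = join s' u')
    (hs : (s : ℝ) ≠ 1) : s = s' ∧ u = u' := by
  have h0 : s = s' := Subtype.ext (by simpa using congrArg (fun x : Simplex (n + 1) => x 0) h)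
  subst h0
  refine ⟨rfl, ?_⟩
  ext i
  have := congrArg (fun x : Simplex (n + 1) => x i.succ) h
  simp only [join_succ_apply] at this
  exact mul_left_cancel₀ (sub_ne_zero.2 hs.symm) this

lemma face_apply_self {n : ℕ} (i : Fin (n + 1)) (x : Simplex n) : face i x i = 0 := by
  simp only [face, ContinuousMap.coe_mk, stdSimplex.map_coe, FunOnFinite.linearMap_apply_apply]
  refine Finset.sum_eq_zero fun j hj => ?_
  exact absurd (Finset.mem_filter.1 hj).2 (Fin.succAbove_ne i j)

lemma face_apply_succAbove {n : ℕ} (i : Fin (n + 1)) (x : Simplex n) (j : Fin n) :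
    face i x (i.succAbove j) = x j := by
  simp only [face, ContinuousMap.coe_mk, stdSimplex.map_coe, FunOnFinite.linearMap_apply_apply]
  rw [Finset.sum_eq_single_of_mem j (by simp)]
  intro k hk hkj
  exact absurd (Fin.succAbove_right_injective (Finset.mem_filter.1 hk).2) hkj

lemma face_zero {n : ℕ} (x : Simplex n) : face 0 x = join 0 x := by
  refine simplex_ext_succ (by simp [face_apply_self]) fun i => ?_
  rw [join_succ_apply, ← Fin.zero_succAbove, face_apply_succAbove]
  simp

lemma face_succ_join {n : ℕ} (i : Fin (n + 1)) (s : unitInterval) (u : Simplex n) :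
    face i.succ (join s u) = join s (face i u) := by
  ext j
  refine Fin.succAboveCases i.succ ?_ (fun j => ?_) j
  · rw [face_apply_self, join_succ_apply, face_apply_self, mul_zero]
  · rw [face_apply_succAbove]
    refine Fin.cases ?_ (fun j => ?_) j
    · rw [Fin.succ_succAbove_zero]; rfl
    · rw [Fin.succ_succAbove_succ, join_succ_apply, join_succ_apply, face_apply_succAbove]

lemma face_succ_vertex {n : ℕ} (i : Fin (n + 1)) :
    face i.succ (stdSimplex.vertex (0 : Fin (n + 1))) = stdSimplex.vertex 0 := by
  simp only [face, ContinuousMap.coe_mk, stdSimplex.map_vertex, Fin.succ_succAbove_zero]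

section Cone

variable {y₀ : Y} (h : ContinuousMap.Homotopy (ContinuousMap.id Y) (ContinuousMap.const Y y₀))

/-- The underlying function of the cone of a singular simplex along a contraction. -/
def coneFun {n : ℕ} (σ : C(Simplex n, Y)) (x : Simplex (n + 1)) : Y :=
  open Classical in
  if hx : x 0 = 1 then y₀ else
    h ((exists_eq_join hx).choose, σ (exists_eq_join hx).choose_spec.choose)

lemma coneFun_vertex {n : ℕ} (σ : C(Simplex n, Y)) :
    coneFun h σ (stdSimplex.vertex 0) = y₀ := by
  rw [coneFun, dif_pos (by simp)]

lemma coneFun_join {n : ℕ} (σ : C(Simplex n, Y)) (s : unitInterval) (u : Simplex n) :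
    coneFun h σ (join s u) = h (s, σ u) := by
  by_cases hs : (s : ℝ) = 1
  · obtain rfl : s = 1 := Subtype.ext hs
    rw [join_one, coneFun_vertex, h.apply_one]
    rfl
  · have hx : (join s u) 0 ≠ 1 := by simpa using hs
    rw [coneFun, dif_neg hx]
    obtain ⟨h1, h2⟩ := join_injective (exists_eq_join hx).choose_spec.choose_spec hs
    exact congrArg h (Prod.ext h1.symm (congrArg σ h2.symm))

/-- For a nonempty base the join map from a compact space is a closed surjection, hence a quotient
map, and continuity may be checked before collapsing the cone point. The empty base is separate: its
join map has empty domain and misses the vertex. -/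
lemma continuous_coneFun {n : ℕ} (σ : C(Simplex n, Y)) : Continuous (coneFun h σ) := by
  cases n with
  | zero => exact continuous_of_const fun x y => by rw [Subsingleton.elim x y]
  | succ n =>
    have hq : Topology.IsQuotientMap fun p : unitInterval × Simplex (n + 1) => join p.1 p.2 := by
      refine continuous_join.isClosedMap.isQuotientMap continuous_join fun x => ?_
      by_cases hx : x 0 = 1
      · exact ⟨(1, stdSimplex.vertex 0), by rw [eq_vertex_of_zero_apply hx]; exact join_one _⟩
      · obtain ⟨s, u, rfl⟩ := exists_eq_join hx
        exact ⟨(s, u), rfl⟩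
    rw [hq.continuous_iff]
    have : coneFun h σ ∘ (fun p : unitInterval × Simplex (n + 1) => join p.1 p.2) =
        fun p => h (p.1, σ p.2) := funext fun p => coneFun_join h σ p.1 p.2
    rw [this]
    fun_prop

/-- The cone of a singular simplex along a contraction. -/
def coneSimplex {n : ℕ} (σ : C(Simplex n, Y)) : C(Simplex (n + 1), Y) :=
  ⟨coneFun h σ, continuous_coneFun h σ⟩

lemma coneSimplex_ext {n : ℕ} {σ : C(Simplex n, Y)} {τ : C(Simplex (n + 1), Y)}
    (h0 : τ (stdSimplex.vertex 0) = y₀) (h1 : ∀ s u, τ (join s u) = h (s, σ u)) :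
    coneSimplex h σ = τ := by
  ext1 x
  by_cases hx : x 0 = 1
  · rw [eq_vertex_of_zero_apply hx, h0]
    exact coneFun_vertex h σ
  · obtain ⟨s, u, rfl⟩ := exists_eq_join hx
    rw [h1]
    exact coneFun_join h σ s u

/-- The cone operator of a contraction. -/
def cone : Chain Y →ₗ[ZMod 2] Chain Y :=
  lmapDomain (ZMod 2) (ZMod 2) fun s => ⟨s.1 + 1, coneSimplex h s.2⟩

@[simp]
lemma cone_of {n : ℕ} (σ : C(Simplex n, Y)) : cone h (of σ) = of (coneSimplex h σ) := by
  simp [cone, of]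

/-- The face opposite the cone point is the original simplex, and the other faces are cones over its
faces. With the empty simplex included, the identity needs no correction in the lowest degree: the
cone over it is a point, with boundary the empty simplex. -/
lemma boundary_cone (c : Chain Y) : boundary (cone h c) = c + cone h (boundary c) := by
  have : boundary ∘ₗ cone h = LinearMap.id + cone h ∘ₗ boundary := hom_ext fun n σ => by
    simp only [LinearMap.comp_apply, cone_of, LinearMap.add_apply, LinearMap.id_apply,
      boundary_of_succ, Fin.sum_univ_succ]
    congr 1
    · congr 1
      ext1 x
      rw [ContinuousMap.comp_apply, face_zero]
      exact (coneFun_join h σ 0 x).trans (h.apply_zero _)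
    · cases n with
      | zero => simp
      | succ n =>
        rw [boundary_of_succ, map_sum]
        refine Finset.sum_congr rfl fun i _ => ?_
        rw [cone_of, ← coneSimplex_ext h (τ := (coneSimplex h σ).comp (face i.succ))]
        · rw [ContinuousMap.comp_apply, face_succ_vertex]
          exact coneFun_vertex h σ
        · intro s u
          rw [ContinuousMap.comp_apply, face_succ_join]
          exact coneFun_join h σ s _
  exact LinearMap.congr_fun this c

end Cone

/-- The chains in a contractible subset have no homology. -/
lemma exists_boundary_eq_of_contractible {A : Set X} [ContractibleSpace A] {c : Chain X}
    (hc : c ∈ chainsIn A) (h : boundary c = 0) : ∃ e ∈ chainsIn A, boundary e = c := by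
  obtain ⟨y₀, ⟨H⟩⟩ := id_nullhomotopic A
  obtain ⟨c', rfl⟩ := exists_map_of_mem_chainsIn hc
  have h' : boundary c' = 0 := by
    apply map_injective (f := ⟨Subtype.val, continuous_subtype_val⟩) Subtype.val_injective
    rw [map_boundary, h, map_zero]
  -- A cycle is the boundary of its cone along a contraction.
  refine ⟨map ⟨Subtype.val, continuous_subtype_val⟩ (cone H c'),
    map_mem_chainsIn (fun x => x.2) _, ?_⟩
  rw [← map_boundary, boundary_cone, h', map_zero, add_zero]

end SingularModTwo

end

open Finsupp

noncomputable section

namespace SingularModTwo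

variable {X Y Z : Type*} [TopologicalSpace X] [TopologicalSpace Y] [TopologicalSpace Z]

/-! ### Affine simplices -/

/-- The straight-line contraction of a standard simplex to one of its points. -/
def contract {m : ℕ} (b : Simplex m) :
    ContinuousMap.Homotopy (ContinuousMap.id (Simplex m)) (ContinuousMap.const _ b) where
  toFun p := ⟨fun i => (1 - (p.1 : ℝ)) * p.2 i + p.1 * b i, by
    refine ⟨fun i => add_nonneg (mul_nonneg (sub_nonneg.2 p.1.2.2) (stdSimplex.zero_le _ _))
      (mul_nonneg p.1.2.1 (stdSimplex.zero_le _ _)), ?_⟩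
    rw [Finset.sum_add_distrib, ← Finset.mul_sum, ← Finset.mul_sum, stdSimplex.sum_eq_one,
      stdSimplex.sum_eq_one]
    ring⟩
  continuous_toFun := by
    refine Continuous.subtype_mk (continuous_pi fun i => ?_) _
    have : Continuous fun p : unitInterval × Simplex m => p.2 i :=
      (continuous_apply i).comp (continuous_subtype_val.comp continuous_snd)
    fun_prop
  map_zero_left x := by
    ext i
    change (1 - ((0 : unitInterval) : ℝ)) * x i + ((0 : unitInterval) : ℝ) * b i = x i
    simp
  map_one_left x := by
    ext i
    change (1 - ((1 : unitInterval) : ℝ)) * x i + ((1 : unitInterval) : ℝ) * b i = b i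
    simp

lemma contract_apply {m : ℕ} (b : Simplex m) (s : unitInterval) (x : Simplex m) (i : Fin m) :
    contract b (s, x) i = (1 - (s : ℝ)) * x i + s * b i := rfl

/-- The affine simplex with given vertices. -/
def lin {n m : ℕ} (v : Fin n → Simplex m) : C(Simplex n, Simplex m) where
  toFun t := ⟨fun j => ∑ i, t i * v i j, by
    refine ⟨fun j => Finset.sum_nonneg fun i _ =>
      mul_nonneg (stdSimplex.zero_le _ _) (stdSimplex.zero_le _ _), ?_⟩
    rw [Finset.sum_comm]
    simp_rw [← Finset.mul_sum, stdSimplex.sum_eq_one, mul_one]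
    exact stdSimplex.sum_eq_one t⟩
  continuous_toFun := by
    refine Continuous.subtype_mk (continuous_pi fun j => continuous_finsetSum _ fun i _ => ?_) _
    have : Continuous fun t : Simplex n => t i :=
      (continuous_apply i).comp continuous_subtype_val
    exact this.mul continuous_const

lemma lin_apply {n m : ℕ} (v : Fin n → Simplex m) (t : Simplex n) (j : Fin m) :
    lin v t j = ∑ i, t i * v i j := rfl

lemma lin_vertex {n m : ℕ} (v : Fin n → Simplex m) (i : Fin n) :
    lin v (stdSimplex.vertex i) = v i := by
  ext j
  rw [lin_apply, Finset.sum_eq_single_of_mem i (Finset.mem_univ i)]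
  · simp
  · intro k _ hk
    simp [hk]

lemma lin_join {n m : ℕ} (b : Simplex m) (v : Fin n → Simplex m) (s : unitInterval)
    (u : Simplex n) : lin (Fin.cons b v : Fin (n + 1) → Simplex m) (join s u) =
      contract b (s, lin v u) := by
  ext j
  rw [lin_apply, Fin.sum_univ_succ, contract_apply, lin_apply, Finset.mul_sum, add_comm]
  simp [mul_assoc]

lemma lin_comp_face {n m : ℕ} (v : Fin (n + 1) → Simplex m) (i : Fin (n + 1)) :
    (lin v).comp (face i) = lin (v ∘ i.succAbove) := by
  ext t j
  rw [ContinuousMap.comp_apply, lin_apply, Fin.sum_univ_succAbove _ i, face_apply_self, zero_mul,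
    zero_add, lin_apply]
  simp [face_apply_succAbove]

lemma lin_contract {n m : ℕ} (v : Fin n → Simplex m) (b : Simplex n) (s : unitInterval)
    (u : Simplex n) : lin v (contract b (s, u)) = contract (lin v b) (s, lin v u) := by
  ext j
  simp only [lin_apply, contract_apply, Finset.mul_sum, ← Finset.sum_add_distrib]
  exact Finset.sum_congr rfl fun i _ => by ring

lemma cone_lin {n m : ℕ} (b : Simplex m) (v : Fin n → Simplex m) :
    cone (contract b) (of (lin v)) = of (lin (Fin.cons b v : Fin (n + 1) → Simplex m)) := by
  rw [cone_of, coneSimplex_ext]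
  · rw [lin_vertex]; rfl
  · exact lin_join b v

/-- Affine maps take straight-line contractions to straight-line contractions, hence cones to cones.
-/
lemma map_lin_cone {n m : ℕ} (v : Fin n → Simplex m) (b : Simplex n) (c : Chain (Simplex n)) :
    map (lin v) (cone (contract b) c) = cone (contract (lin v b)) (map (lin v) c) := by
  have : map (lin v) ∘ₗ cone (contract b) = cone (contract (lin v b)) ∘ₗ map (lin v) :=
    hom_ext fun k σ => by
      simp only [LinearMap.comp_apply, cone_of, map_of]
      refine congrArg of (coneSimplex_ext _ ?_ ?_).symm
      · rw [ContinuousMap.comp_apply]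
        exact congrArg (lin v) (coneFun_vertex (contract b) σ)
      · intro s u
        rw [ContinuousMap.comp_apply, ContinuousMap.comp_apply, ← lin_contract]
        exact congrArg (lin v) (coneFun_join (contract b) σ s u)
  exact LinearMap.congr_fun this c

/-! ### Barycentric subdivision -/

/-- The universal homotopy between the identity and barycentric subdivision. -/
def homotopyModel : ∀ n : ℕ, Chain (Simplex n)
  | 0 => 0
  | n + 1 => cone (contract stdSimplex.barycenter)
      (of (ContinuousMap.id _) + ∑ i, map (face i) (homotopyModel n))

/-- The natural homotopy between the identity and barycentric subdivision. -/
def sdHomotopy : Chain X →ₗ[ZMod 2] Chain X :=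
  linearCombination (ZMod 2) fun s : Simp X => map s.2 (homotopyModel s.1)

@[simp]
lemma sdHomotopy_of {n : ℕ} (σ : C(Simplex n, X)) :
    sdHomotopy (of σ) = map σ (homotopyModel n) := by
  simp [sdHomotopy, of]

lemma map_sdHomotopy (f : C(X, Y)) (c : Chain X) :
    map f (sdHomotopy c) = sdHomotopy (map f c) := by
  have : map f ∘ₗ sdHomotopy = sdHomotopy ∘ₗ map f := hom_ext fun n σ => by simp [map_comp]
  exact LinearMap.congr_fun this c

lemma sdHomotopy_mem_chainsIn {A : Set X} {c : Chain X} (hc : c ∈ chainsIn A) :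
    sdHomotopy c ∈ chainsIn A := by
  refine linearMap_mem_of_chainsIn _ (fun n σ hσ => ?_) hc
  rw [sdHomotopy_of]
  exact map_mem_chainsIn hσ _

/-- Barycentric subdivision. -/
def sd : Chain X →ₗ[ZMod 2] Chain X :=
  LinearMap.id + boundary ∘ₗ sdHomotopy + sdHomotopy ∘ₗ boundary

lemma sd_apply (c : Chain X) :
    sd c = c + boundary (sdHomotopy c) + sdHomotopy (boundary c) := rfl

lemma map_sd (f : C(X, Y)) (c : Chain X) : map f (sd c) = sd (map f c) := by
  simp only [sd_apply, map_add, map_boundary, map_sdHomotopy]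

lemma boundary_sd (c : Chain X) : boundary (sd c) = sd (boundary c) := by
  simp [sd_apply, boundary_boundary]

lemma sd_mem_chainsIn {A : Set X} {c : Chain X} (hc : c ∈ chainsIn A) : sd c ∈ chainsIn A :=
  add_mem (add_mem hc (boundary_mem_chainsIn (sdHomotopy_mem_chainsIn hc)))
    (sdHomotopy_mem_chainsIn (boundary_mem_chainsIn hc))

lemma sd_of_zero (σ : C(Simplex 0, X)) : sd (of σ) = of σ := by
  simp [sd_apply, homotopyModel]

/-- Since `sd` is defined by the homotopy formula, it is automatically chain homotopic to the
identity. What has to be recovered is its geometric meaning: subdivide the boundary and cone off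
from the barycentre. -/
lemma sd_id (n : ℕ) :
    sd (of (ContinuousMap.id (Simplex (n + 1)))) =
      cone (contract stdSimplex.barycenter) (sd (boundary (of (ContinuousMap.id _)))) := by
  have hT : sdHomotopy (of (ContinuousMap.id (Simplex (n + 1)))) =
      cone (contract stdSimplex.barycenter) (of (ContinuousMap.id _) +
        sdHomotopy (boundary (of (ContinuousMap.id _)))) := by
    have h1 : ∀ c : Chain (Simplex (n + 1)), map (ContinuousMap.id _) c = c := fun c => by
      have : map (ContinuousMap.id (Simplex (n + 1))) = LinearMap.id :=
        hom_ext fun k σ => by simp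
      exact LinearMap.congr_fun this c
    rw [sdHomotopy_of, h1, homotopyModel, boundary_of_succ, map_sum]
    simp
  rw [sd_apply, hT, boundary_cone, sd_apply, boundary_boundary, map_zero, add_zero, map_add,
    map_add]
  generalize of (ContinuousMap.id (Simplex (n + 1))) = a
  generalize sdHomotopy (boundary a) = t
  generalize cone (contract stdSimplex.barycenter) (boundary a) +
    cone (contract stdSimplex.barycenter) (boundary t) = p
  rw [show a + (a + t + p) + t = (a + a) + (t + t) + p by abel, ZModModule.add_self,
    ZModModule.add_self, zero_add, zero_add]

lemma sd_lin {n m : ℕ} (v : Fin (n + 1) → Simplex m) :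
    sd (of (lin v)) = cone (contract (lin v stdSimplex.barycenter))
      (∑ i : Fin (n + 1), sd (of (lin (v ∘ i.succAbove)))) := by
  have : of (lin v) = map (lin v) (of (ContinuousMap.id _)) := by simp
  rw [this, ← map_sd, sd_id, map_lin_cone, map_sd, map_boundary, map_of, boundary_of_succ, map_sum]
  simp [lin_comp_face]

/-- The span of the affine simplices in `K` whose vertices have distances at most `d`. -/
def affineChains (n : ℕ) {m : ℕ} (d : ℝ) (K : Set (Fin m → ℝ)) :
    Submodule (ZMod 2) (Chain (Simplex m)) :=
  Submodule.span (ZMod 2) {c | ∃ v : Fin n → Simplex m,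
    (∀ i j, dist (v i) (v j) ≤ d) ∧ (∀ i, (v i).1 ∈ K) ∧ c = of (lin v)}

lemma lin_mem_of_convex {n m : ℕ} {K : Set (Fin m → ℝ)} (hK : Convex ℝ K) {v : Fin n → Simplex m}
    (hv : ∀ i, (v i).1 ∈ K) (t : Simplex n) : (lin v t).1 ∈ K := by
  have : (lin v t).1 = ∑ i, t i • (v i).1 := by
    ext j
    rw [Finset.sum_apply]
    rfl
  rw [this]
  exact hK.sum_mem (fun i _ => stdSimplex.zero_le t i) (stdSimplex.sum_eq_one t) fun i _ => hv i

lemma dist_lin_barycenter_le {n m : ℕ} {v : Fin (n + 1) → Simplex m} {d : ℝ}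
    (hd : ∀ i j, dist (v i) (v j) ≤ d) (i : Fin (n + 1)) :
    dist (v i) (lin v stdSimplex.barycenter) ≤ n / (n + 1) * d := by
  have hd0 : 0 ≤ d := dist_nonneg.trans (hd 0 0)
  rw [Subtype.dist_eq, dist_pi_le_iff (by positivity)]
  intro k
  -- The barycentre averages `n + 1` vertices, and the difference of `v i` with itself vanishes. So
  -- `n` differences remain, each bounded by `d`, which gives the factor `n / (n + 1)`.
  have h1 : (v i).1 k - (lin v stdSimplex.barycenter).1 k =
      ((n : ℝ) + 1)⁻¹ * ∑ j : Fin n, ((v i) k - v (i.succAbove j) k) := by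
    have : (lin v stdSimplex.barycenter).1 k = ∑ j, ((n : ℝ) + 1)⁻¹ * v j k := by
      have : ∀ j : Fin (n + 1), (stdSimplex.barycenter : Simplex (n + 1)) j = ((n : ℝ) + 1)⁻¹ :=
        fun j => by
          change ((Fintype.card (Fin (n + 1)) : ℕ) : ℝ)⁻¹ = _
          simp
      change lin v stdSimplex.barycenter k = _
      rw [lin_apply]
      simp [this]
    rw [this, ← Finset.mul_sum, Fin.sum_univ_succAbove _ i, Finset.sum_sub_distrib]
    change v i k - _ = _
    simp only [Finset.sum_const, Finset.card_univ, Fintype.card_fin, nsmul_eq_mul]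
    field_simp
    ring
  rw [Real.dist_eq, h1, abs_mul, abs_of_nonneg (by positivity), div_mul_eq_mul_div, div_eq_inv_mul]
  refine mul_le_mul_of_nonneg_left ?_ (by positivity)
  refine (Finset.abs_sum_le_sum_abs _ _).trans ?_
  refine (Finset.sum_le_card_nsmul _ _ d fun j _ => ?_).trans (by simp)
  rw [← Real.dist_eq]
  exact (dist_le_pi_dist (v i).1 (v (i.succAbove j)).1 k).trans (hd i _)

/-- The convex set `K` makes the induction work. The faces are subdivided inside the intersection of
`K` with a ball around the barycentre, which is again convex; this bounds the distance from the new
cone point to all vertices of the subdivided faces. The bound `N` is fixed so that faces of all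
dimensions share one contraction factor. -/
lemma sd_lin_mem_affineChains {N n m : ℕ} (hn : n ≤ N) (v : Fin n → Simplex m) {d : ℝ}
    (hd : ∀ i j, dist (v i) (v j) ≤ d) {K : Set (Fin m → ℝ)} (hK : Convex ℝ K)
    (hv : ∀ i, (v i).1 ∈ K) :
    sd (of (lin v)) ∈ affineChains n ((N - 1) / N * d) K := by
  induction n generalizing K with
  | zero =>
    rw [sd_of_zero]
    exact Submodule.subset_span ⟨v, fun i => i.elim0, fun i => i.elim0, rfl⟩
  | succ n ih =>
    have hd0 : 0 ≤ d := dist_nonneg.trans (hd 0 0)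
    have hN : (0 : ℝ) < N := by exact_mod_cast (Nat.succ_pos n).trans_le hn
    have hr : (n : ℝ) / (n + 1) * d ≤ (N - 1) / N * d := by
      refine mul_le_mul_of_nonneg_right ?_ hd0
      rw [div_le_div_iff₀ (by positivity) hN]
      have : ((n + 1 : ℕ) : ℝ) ≤ N := by exact_mod_cast hn
      push_cast at this
      nlinarith
    set b := lin v stdSimplex.barycenter with hb
    have hbK : b.1 ∈ K := lin_mem_of_convex hK hv _
    have hface : ∑ i : Fin (n + 1), sd (of (lin (v ∘ i.succAbove))) ∈
        affineChains n ((N - 1) / N * d) (K ∩ Metric.closedBall b.1 ((N - 1) / N * d)) :=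
      sum_mem fun i _ => ih (by omega) _ (fun j k => hd _ _)
        (hK.inter (convex_closedBall _ _))
        fun j => ⟨hv _, (dist_lin_barycenter_le hd _).trans hr⟩
    rw [sd_lin]
    generalize ∑ i : Fin (n + 1), sd (of (lin (v ∘ i.succAbove))) = c at hface
    induction hface using Submodule.span_induction with
    | zero => simp
    | add x y _ _ hx hy => rw [map_add]; exact add_mem hx hy
    | smul a x _ hx => rw [map_smul]; exact Submodule.smul_mem _ _ hx
    | mem x h =>
      obtain ⟨w, hw, hwK, rfl⟩ := h
      rw [cone_lin]
      refine Submodule.subset_span ⟨_, fun i j => ?_, fun i => ?_, rfl⟩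
      · have h0 : 0 ≤ ((N : ℝ) - 1) / N * d := le_trans (by positivity) hr
        refine Fin.cases ?_ (fun i => ?_) i <;> refine Fin.cases ?_ (fun j => ?_) j
        · simpa using h0
        · simp only [Fin.cons_zero, Fin.cons_succ]
          rw [dist_comm]
          exact (hwK j).2
        · simp only [Fin.cons_zero, Fin.cons_succ]
          exact (hwK i).2
        · simpa using hw i j
      · refine Fin.cases ?_ (fun i => ?_) i
        · simpa using hbK
        · simpa using (hwK i).1

lemma iterate_sd_id_mem (m k : ℕ) :
    sd^[k] (of (ContinuousMap.id (Simplex m))) ∈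
      affineChains m ((((m : ℝ) - 1) / m) ^ k) Set.univ := by
  induction k with
  | zero =>
    -- The identity is the affine simplex on the standard vertices, whose mutual distances are at
    -- most `1`.
    refine Submodule.subset_span ⟨stdSimplex.vertex, fun i j => ?_, fun _ => trivial, ?_⟩
    · rw [pow_zero]
      exact (Metric.dist_le_diam_of_mem (bounded_stdSimplex (Fin m)) (Subtype.prop _)
        (Subtype.prop _)).trans diam_stdSimplex_le
    · change of _ = _
      congr 1
      ext t j
      rw [lin_apply]
      simp [Pi.single_apply]
  | succ k ih =>
    rw [Function.iterate_succ_apply', pow_succ']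
    generalize sd^[k] (of (ContinuousMap.id (Simplex m))) = c at ih
    induction ih using Submodule.span_induction with
    | zero => simp
    | add x y _ _ hx hy => rw [map_add]; exact add_mem hx hy
    | smul a x _ hx => rw [map_smul]; exact Submodule.smul_mem _ _ hx
    | mem x h =>
      obtain ⟨w, hw, hwK, rfl⟩ := h
      exact sd_lin_mem_affineChains le_rfl w hw convex_univ hwK

/-! ### Small chains -/

lemma map_iterate_sd (f : C(X, Y)) (c : Chain X) (k : ℕ) : map f (sd^[k] c) = sd^[k] (map f c) :=
  (Function.Semiconj.iterate_right (fun c => map_sd f c) k) c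

lemma iterate_sd_add (c c' : Chain X) (k : ℕ) : sd^[k] (c + c') = sd^[k] c + sd^[k] c' :=
  iterate_map_add sd k c c'

lemma sd_mem_sup {A B : Set X} {c : Chain X} (hc : c ∈ chainsIn A ⊔ chainsIn B) :
    sd c ∈ chainsIn A ⊔ chainsIn B := by
  obtain ⟨a, ha, b, hb, rfl⟩ := Submodule.mem_sup.1 hc
  rw [map_add]
  exact Submodule.add_mem_sup (sd_mem_chainsIn ha) (sd_mem_chainsIn hb)

lemma iterate_sd_mem_sup {A B : Set X} {c : Chain X} (hc : c ∈ chainsIn A ⊔ chainsIn B) (k : ℕ) :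
    sd^[k] c ∈ chainsIn A ⊔ chainsIn B := by
  induction k with
  | zero => exact hc
  | succ k ih => rw [Function.iterate_succ_apply']; exact sd_mem_sup ih

lemma exists_iterate_sd_of_mem {A B : Set X} (hA : IsOpen A) (hB : IsOpen B) {m : ℕ}
    (σ : C(Simplex m, X)) (hσ : ∀ x, σ x ∈ A ∪ B) :
    ∃ k, sd^[k] (of σ) ∈ chainsIn A ⊔ chainsIn B := by
  -- With a Lebesgue number of the cover pulled back to the simplex, an affine simplex with vertices
  -- less than `δ` from its first vertex stays in one member, because balls are convex.
  obtain ⟨δ, hδ, hball⟩ := lebesgue_number_lemma_of_metric (s := (Set.univ : Set (Simplex m)))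
    (c := fun i : Bool => σ ⁻¹' (if i then A else B)) isCompact_univ
    (fun i => by cases i <;> simpa using IsOpen.preimage σ.continuous ‹_›)
    (fun x _ => by
      rcases hσ x with h | h
      · exact Set.mem_iUnion.2 ⟨true, by simpa using h⟩
      · exact Set.mem_iUnion.2 ⟨false, by simpa using h⟩)
  have hr0 : 0 ≤ ((m : ℝ) - 1) / m := by
    rcases Nat.eq_zero_or_pos m with rfl | hm
    · simp
    · have : (1 : ℝ) ≤ m := by exact_mod_cast hm
      exact div_nonneg (by linarith) (by linarith)
  have hr1 : ((m : ℝ) - 1) / m < 1 := by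
    rcases Nat.eq_zero_or_pos m with rfl | hm
    · simp
    · have : (0 : ℝ) < m := by exact_mod_cast hm
      rw [div_lt_one this]
      linarith
  obtain ⟨k, hk⟩ := exists_pow_lt_of_lt_one hδ hr1
  refine ⟨k, ?_⟩
  have h1 : of σ = map σ (of (ContinuousMap.id _)) := by simp
  rw [h1, ← map_iterate_sd]
  have h2 := iterate_sd_id_mem m k
  generalize sd^[k] (of (ContinuousMap.id (Simplex m))) = c at h2
  induction h2 using Submodule.span_induction with
  | zero => simp
  | add x y _ _ hx hy => rw [map_add]; exact add_mem hx hy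
  | smul a x _ hx => rw [map_smul]; exact Submodule.smul_mem _ _ hx
  | mem x h =>
    obtain ⟨w, hw, -, rfl⟩ := h
    rw [map_of]
    cases m with
    | zero => exact Submodule.mem_sup_left (of_mem_chainsIn fun x => isEmptyElim x)
    | succ m =>
      obtain ⟨i, hi⟩ := hball (w 0) trivial
      have hsub : ∀ x, lin w x ∈ Metric.ball (w 0) δ := fun x =>
        lin_mem_of_convex (K := Metric.ball (w 0).1 δ) (convex_ball _ _)
          (fun i => (hw i 0).trans_lt hk) x
      cases i with
      | true => exact Submodule.mem_sup_left (of_mem_chainsIn fun x => by simpa using hi (hsub x))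
      | false =>
        exact Submodule.mem_sup_right (of_mem_chainsIn fun x => by simpa using hi (hsub x))

/-- Up to a boundary, a chain in `A ∪ B` whose boundary is a sum of a chain in `A` and a chain in
`B` is itself such a sum. -/
theorem exists_add_boundary_mem_sup {A B : Set X} (hA : IsOpen A) (hB : IsOpen B) {c : Chain X}
    (hc : c ∈ chainsIn (A ∪ B)) (hb : boundary c ∈ chainsIn A ⊔ chainsIn B) :
    ∃ e ∈ chainsIn (A ∪ B), c + boundary e ∈ chainsIn A ⊔ chainsIn B := by
  obtain ⟨k, hk⟩ : ∃ k, sd^[k] c ∈ chainsIn A ⊔ chainsIn B := by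
    refine chainsIn_induction (p := fun c => ∃ k, sd^[k] c ∈ chainsIn A ⊔ chainsIn B) hc
      ⟨0, zero_mem _⟩ ?_ fun n σ hσ => exists_iterate_sd_of_mem hA hB σ hσ
    rintro a b ⟨k, hk⟩ ⟨l, hl⟩
    -- Further subdivision keeps a chain small, so a common exponent serves both summands.
    refine ⟨k + l, ?_⟩
    rw [iterate_sd_add]
    refine add_mem ?_ ?_
    · rw [add_comm, Function.iterate_add_apply]
      exact iterate_sd_mem_sup hk l
    · rw [Function.iterate_add_apply]
      exact iterate_sd_mem_sup hl k
  induction k generalizing c with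
  | zero => exact ⟨0, zero_mem _, by simpa using hk⟩
  | succ k ih =>
    obtain ⟨e, he, h⟩ := ih (sd_mem_chainsIn hc) (by rw [boundary_sd]; exact sd_mem_sup hb)
      (by rwa [Function.iterate_succ_apply] at hk)
    -- By definition `sd c` is `c + boundary (sdHomotopy c) + sdHomotopy (boundary c)`. The last
    -- term is already small because `boundary c` is, so `c` may be replaced by `sd c` at the cost
    -- of the boundary of `sdHomotopy c`.
    refine ⟨sdHomotopy c + e, add_mem (sdHomotopy_mem_chainsIn hc) he, ?_⟩
    have hT : sdHomotopy (boundary c) ∈ chainsIn A ⊔ chainsIn B := by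
      obtain ⟨a, ha, b, hb, h⟩ := Submodule.mem_sup.1 hb
      rw [← h, map_add]
      exact Submodule.add_mem_sup (sdHomotopy_mem_chainsIn ha) (sdHomotopy_mem_chainsIn hb)
    convert sub_mem h hT using 1
    rw [sd_apply, map_add]
    abel

end SingularModTwo

end

open Finsupp

noncomputable section

/-! ### Acyclic subcomplexes -/

/-- A submodule without homology with respect to a differential. -/
def AcyclicOn {M : Type*} [AddCommGroup M] [Module (ZMod 2) M] (d : M →ₗ[ZMod 2] M)
    (N : Submodule (ZMod 2) M) : Prop :=
  ∀ x ∈ N, d x = 0 → ∃ y ∈ N, d y = x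

namespace AcyclicOn

variable {M : Type*} [AddCommGroup M] [Module (ZMod 2) M] {d : M →ₗ[ZMod 2] M}
  {A B : Submodule (ZMod 2) M}

lemma eq_of_add_eq_zero {x y : M} (h : x + y = 0) : x = y := by
  rw [← sub_eq_zero, ZModModule.sub_eq_add, h]

/-- Mayer–Vietoris by hand: for a cycle `a + b` the common boundary `d a = d b` lies in the
intersection and bounds some `g` there. Then `a + g` and `b + g` are cycles with sum `a + b`. -/
lemma sup (hd : ∀ x, d (d x) = 0) (hdA : ∀ x ∈ A, d x ∈ A) (hdB : ∀ x ∈ B, d x ∈ B)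
    (hA : AcyclicOn d A) (hB : AcyclicOn d B) (hAB : AcyclicOn d (A ⊓ B)) :
    AcyclicOn d (A ⊔ B) := by
  intro x hx h
  obtain ⟨a, ha, b, hb, rfl⟩ := Submodule.mem_sup.1 hx
  have hab : d a = d b := eq_of_add_eq_zero (by rwa [← map_add])
  obtain ⟨g, hg, hdg⟩ := hAB (d a) ⟨hdA a ha, hab ▸ hdB b hb⟩ (hd a)
  obtain ⟨a', ha', hda'⟩ := hA (a + g) (add_mem ha hg.1)
    (by rw [map_add, hdg, ZModModule.add_self])
  obtain ⟨b', hb', hdb'⟩ := hB (b + g) (add_mem hb hg.2)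
    (by rw [map_add, hdg, hab, ZModModule.add_self])
  refine ⟨a' + b', Submodule.add_mem_sup ha' hb', ?_⟩
  rw [map_add, hda', hdb', show a + g + (b + g) = a + b + (g + g) by abel, ZModModule.add_self,
    add_zero]

/-- Acyclicity passes to a larger subcomplex with acyclic quotient. -/
lemma of_relative (hd : ∀ x, d (d x) = 0) (hA : AcyclicOn d A) (hAB : A ≤ B)
    (h : ∀ x ∈ B, d x = 0 → ∃ y ∈ B, x + d y ∈ A) : AcyclicOn d B := by
  intro x hx hdx
  obtain ⟨y, hy, hxy⟩ := h x hx hdx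
  obtain ⟨z, hz, hdz⟩ := hA _ hxy (by rw [map_add, hdx, hd, add_zero])
  refine ⟨y + z, add_mem hy (hAB hz), ?_⟩
  rw [map_add, hdz, show d y + (x + d y) = x + (d y + d y) by abel, ZModModule.add_self, add_zero]

end AcyclicOn

/-! ### Acyclic carriers: comparing a complex of cells with singular chains -/

namespace SingularModTwo

/-- The empty singular simplex. -/
def emptySimplex (X : Type*) [TopologicalSpace X] : C(Simplex 0, X) :=
  ⟨isEmptyElim, continuous_of_discreteTopology⟩

variable {X : Type*} [TopologicalSpace X]

lemma eq_smul_of_mem_chainsIn_empty {c : Chain X} (hc : c ∈ chainsIn (∅ : Set X)) :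
    ∃ a : ZMod 2, c = a • of (emptySimplex X) := by
  refine chainsIn_induction (p := fun c => ∃ a : ZMod 2, c = a • of (emptySimplex X)) hc
    ⟨0, by simp⟩ ?_ fun n σ hσ => ?_
  · rintro _ _ ⟨a, rfl⟩ ⟨b, rfl⟩
    exact ⟨a + b, by rw [add_smul]⟩
  · cases n with
    | zero =>
      refine ⟨1, ?_⟩
      rw [one_smul]
      congr 1
      ext1 x
      exact isEmptyElim x
    | succ n => exact (hσ (stdSimplex.vertex 0)).elim

lemma of_ne_zero {n : ℕ} (σ : C(Simplex n, X)) : of σ ≠ 0 := by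
  simp [of]

section Carrier

variable {Q : Type*}

lemma linearCombination_mem {f : Q → Chain X} {U : Set Q} {N : Submodule (ZMod 2) (Chain X)}
    (hf : ∀ q ∈ U, f q ∈ N) {x : Q →₀ ZMod 2} (hx : x ∈ supported (ZMod 2) (ZMod 2) U) :
    linearCombination (ZMod 2) f x ∈ N := by
  rw [linearCombination_apply]
  exact Submodule.sum_mem _ fun q hq => Submodule.smul_mem _ _ (hf q (hx hq))

lemma linearMap_eqOn_supported {M : Type*} [AddCommGroup M] [Module (ZMod 2) M]
    {f g : (Q →₀ ZMod 2) →ₗ[ZMod 2] M} {U : Set Q}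
    (h : ∀ q ∈ U, f (single q 1) = g (single q 1)) {x : Q →₀ ZMod 2}
    (hx : x ∈ supported (ZMod 2) (ZMod 2) U) : f x = g x := by
  rw [supported_eq_span_single] at hx
  refine LinearMap.eqOn_span (f := f) (g := g) ?_ hx
  rintro _ ⟨q, hq, rfl⟩
  exact h q hq

variable [PartialOrder Q] [OrderTop Q] {κ : X → Q} {deg : Q → ℕ}
  {d : (Q →₀ ZMod 2) →ₗ[ZMod 2] (Q →₀ ZMod 2)}

variable (hdeg : ∀ q, deg q = 0 ↔ q = ⊤)
  (hd : ∀ q, d (single q 1) ∈ supported (ZMod 2) (ZMod 2) {t | q ≤ t ∧ deg t + 1 = deg q})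
  (hdd : ∀ x, d (d x) = 0)
  (hstar : ∀ q, q ≠ ⊤ → AcyclicOn boundary (chainsIn (κ ⁻¹' Set.Ici q)))

include hdeg hd in
lemma differential_top : d (single ⊤ 1) = 0 := by
  have h := hd ⊤
  rw [show {t | (⊤ : Q) ≤ t ∧ deg t + 1 = deg ⊤} = ∅ by
    ext t
    simp [(hdeg ⊤).2 rfl], supported_empty] at h
  exact h

include hdeg hd hdd hstar in
-- The acyclic carrier construction, by induction on the degree: the chain already attached to `d q`
-- is a cycle in the star of `q`, because the stars of the cells in `d q` are contained in it, and
-- it bounds there by acyclicity. Beyond degree `n` the values of `f` are arbitrary.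
lemma exists_carried_chains (n : ℕ) :
    ∃ f : Q → Chain X, f ⊤ = of (emptySimplex X) ∧ ∀ q, deg q ≤ n →
      f q ∈ chainsIn (κ ⁻¹' Set.Ici q) ∧ degreePart (deg q) (f q) = f q ∧
      boundary (f q) = linearCombination (ZMod 2) f (d (single q 1)) := by
  classical
  have hdtop := differential_top hdeg hd
  induction n with
  | zero =>
    refine ⟨fun _ => of (emptySimplex X), rfl, fun q hq => ?_⟩
    obtain rfl := (hdeg q).1 (Nat.le_zero.1 hq)
    refine ⟨of_mem_chainsIn fun x => isEmptyElim x, ?_, ?_⟩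
    · rw [degreePart_of, if_pos ((hdeg ⊤).2 rfl).symm]
    · rw [boundary_of_zero, hdtop, map_zero]
  | succ n ih =>
    obtain ⟨f, hftop, hf⟩ := ih
    have hchain : ∀ x ∈ supported (ZMod 2) (ZMod 2) {t | deg t ≤ n},
        boundary (linearCombination (ZMod 2) f x) = linearCombination (ZMod 2) f (d x) :=
      fun x hx => linearMap_eqOn_supported (f := boundary ∘ₗ linearCombination (ZMod 2) f)
        (g := linearCombination (ZMod 2) f ∘ₗ d)
        (fun q hq => by simpa using (hf q hq).2.2) hx
    have hex : ∀ q, deg q = n + 1 → ∃ e ∈ chainsIn (κ ⁻¹' Set.Ici q),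
        degreePart (n + 1) e = e ∧
        boundary e = linearCombination (ZMod 2) f (d (single q 1)) := by
      intro q hq
      have hq' : q ≠ ⊤ := fun h => by
        have := (hdeg q).2 h
        omega
      have h1 : linearCombination (ZMod 2) f (d (single q 1)) ∈ chainsIn (κ ⁻¹' Set.Ici q) := by
        refine linearCombination_mem (fun t ht => ?_) (hd q)
        exact chainsIn_mono (Set.preimage_mono (Set.Ici_subset_Ici.2 ht.1))
          (hf t (by have := ht.2; omega)).1
      have h2 : boundary (linearCombination (ZMod 2) f (d (single q 1))) = 0 := by
        rw [hchain, hdd, map_zero]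
        exact supported_mono (fun t ht => by have := ht.2; simp only [Set.mem_ofPred_eq]; omega)
          (hd q)
      obtain ⟨e, he, hbe⟩ := hstar q hq' _ h1 h2
      -- A bounding chain need not be homogeneous; its part in degree `n + 1` has the same boundary,
      -- since the prescribed boundary lies in degree `n`.
      refine ⟨degreePart (n + 1) e, degreePart_mem_chainsIn he _, ?_, ?_⟩
      · rw [degreePart_degreePart, if_pos rfl]
      · rw [← degreePart_boundary, hbe]
        exact linearMap_eqOn_supported (f := degreePart n ∘ₗ linearCombination (ZMod 2) f)
          (g := linearCombination (ZMod 2) f) (U := {t | q ≤ t ∧ deg t + 1 = deg q})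
          (fun t ht => by
            have h3 : deg t = n := by have := ht.2; omega
            have := (hf t h3.le).2.1
            simpa [h3] using this) (hd q)
    choose! e he1 he2 he3 using hex
    refine ⟨fun q => if deg q ≤ n then f q else e q, by simp [hftop, (hdeg ⊤).2 rfl],
      fun q hq => ?_⟩
    have hlc : linearCombination (ZMod 2) (fun q => if deg q ≤ n then f q else e q)
        (d (single q 1)) = linearCombination (ZMod 2) f (d (single q 1)) :=
      linearMap_eqOn_supported (U := {t | q ≤ t ∧ deg t + 1 = deg q}) (fun t ht => by
        have : deg t ≤ n := by have := ht.2; omega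
        simp [this]) (hd q)
    rw [hlc]
    by_cases h : deg q ≤ n
    · simpa [h] using hf q h
    · have h' : deg q = n + 1 := by omega
      simpa [h'] using ⟨he1 q h', he2 q h', he3 q h'⟩

/-- The cone of a linear map between modules with differentials. -/
def coneDifferential (φ : (Q →₀ ZMod 2) →ₗ[ZMod 2] Chain X) :
    Chain X × (Q →₀ ZMod 2) →ₗ[ZMod 2] Chain X × (Q →₀ ZMod 2) :=
  (boundary ∘ₗ LinearMap.fst _ _ _ + φ ∘ₗ LinearMap.snd _ _ _).prod (d ∘ₗ LinearMap.snd _ _ _)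

omit [PartialOrder Q] [OrderTop Q] in
lemma coneDifferential_apply (φ : (Q →₀ ZMod 2) →ₗ[ZMod 2] Chain X)
    (c : Chain X) (z : Q →₀ ZMod 2) :
    coneDifferential (d := d) φ (c, z) = (boundary c + φ z, d z) := rfl

variable (κ) in
/-- The part of the cone carried by a set of cells. -/
def coneOn (U : Set Q) : Submodule (ZMod 2) (Chain X × (Q →₀ ZMod 2)) :=
  (chainsIn (κ ⁻¹' U)).prod (supported (ZMod 2) (ZMod 2) U)

omit [PartialOrder Q] [OrderTop Q] in
lemma coneOn_inter (U V : Set Q) : coneOn κ U ⊓ coneOn κ V = coneOn κ (U ∩ V) := by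
  rw [coneOn, coneOn, Submodule.prod_inf_prod, chainsIn_inter, ← supported_inter]
  rfl

variable (hκ : ∀ x, κ x ≠ ⊤) (hopen : ∀ q, IsOpen (κ ⁻¹' Set.Ici q))
  (hD : ∀ q, q ≠ ⊤ → AcyclicOn d (supported (ZMod 2) (ZMod 2) (Set.Ici q)))

include hopen in
omit [OrderTop Q] in
lemma isOpen_preimage_of_isUpperSet {U : Set Q} (hU : IsUpperSet U) : IsOpen (κ ⁻¹' U) := by
  have : κ ⁻¹' U = ⋃ q ∈ U, κ ⁻¹' Set.Ici q := by
    ext x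
    simp only [Set.mem_preimage, Set.mem_iUnion, Set.mem_Ici, exists_prop]
    exact ⟨fun h => ⟨_, h, le_rfl⟩, fun ⟨q, hq, h⟩ => hU h hq⟩
  rw [this]
  exact isOpen_biUnion fun q _ => hopen q

include hdeg hd hdd hstar hκ hopen hD in
-- Induction on the number of elements of the upper set `U`. With a minimal element `q` removed, `U`
-- is the union of a smaller upper set and the star of `q`, and Mayer–Vietoris applies. The
-- generator `⊤` must lie in `U`: it corresponds to the empty simplex, which belongs to the chains
-- of every subset, even the empty one.
lemma acyclicOn_coneOn [Finite Q] {φ : (Q →₀ ZMod 2) →ₗ[ZMod 2] Chain X}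
    (hφ : ∀ x, boundary (φ x) = φ (d x)) (hφtop : φ (single ⊤ 1) = of (emptySimplex X))
    (hφU : ∀ q, φ (single q 1) ∈ chainsIn (κ ⁻¹' Set.Ici q)) (U : Set Q) (hU : IsUpperSet U)
    (htop : ⊤ ∈ U) : AcyclicOn (coneDifferential (d := d) φ) (coneOn κ U) := by
  have hφmem : ∀ U : Set Q, IsUpperSet U → ∀ x ∈ supported (ZMod 2) (ZMod 2) U,
      φ x ∈ chainsIn (κ ⁻¹' U) := by
    intro U hU x hx
    have : φ x = linearCombination (ZMod 2) (fun q => φ (single q 1)) x :=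
      linearMap_eqOn_supported (U := U) (fun q _ => by simp) hx
    rw [this]
    exact linearCombination_mem (fun q hq => chainsIn_mono
      (Set.preimage_mono fun t ht => hU ht hq) (hφU q)) hx
  have hdmem : ∀ U : Set Q, IsUpperSet U → ∀ x ∈ supported (ZMod 2) (ZMod 2) U,
      d x ∈ supported (ZMod 2) (ZMod 2) U := by
    intro U hU x hx
    rw [supported_eq_span_single] at hx
    induction hx using Submodule.span_induction with
    | zero => simp
    | add x y _ _ hx hy => rw [map_add]; exact add_mem hx hy
    | smul a x _ hx => rw [map_smul]; exact Submodule.smul_mem _ _ hx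
    | mem x h =>
      obtain ⟨q, hq, rfl⟩ := h
      exact supported_mono (fun t ht => hU ht.1 hq) (hd q)
  have hcone : ∀ x, coneDifferential (d := d) φ (coneDifferential (d := d) φ x) = 0 := by
    rintro ⟨c, z⟩
    simp [coneDifferential_apply, boundary_boundary, hφ, hdd, ZModModule.add_self]
  have hstable : ∀ U : Set Q, IsUpperSet U → ∀ x ∈ coneOn κ U,
      coneDifferential (d := d) φ x ∈ coneOn κ U := by
    rintro U hU ⟨c, z⟩ ⟨hc, hz⟩
    exact ⟨add_mem (boundary_mem_chainsIn hc) (hφmem U hU z hz), hdmem U hU z hz⟩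
  have hbase : ∀ q, AcyclicOn (coneDifferential (d := d) φ) (coneOn κ (Set.Ici q)) := by
    rintro q ⟨c, z⟩ ⟨hc, hz⟩ h
    simp only [coneDifferential_apply, Prod.mk_eq_zero] at h hc hz
    -- Over `⊤` no point of the space is left; both complexes are one-dimensional and `φ` identifies
    -- their generators. Over any other `q` both complexes are acyclic, and so is the cone of `φ`.
    by_cases hq : q = ⊤
    · subst hq
      have hempty : κ ⁻¹' Set.Ici ⊤ = ∅ := by
        ext x
        simpa using hκ x
      rw [hempty] at hc
      obtain ⟨a, rfl⟩ := eq_smul_of_mem_chainsIn_empty hc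
      obtain ⟨b, rfl⟩ : ∃ b, z = single ⊤ b := by
        refine ⟨z ⊤, ?_⟩
        ext t
        by_cases ht : t = ⊤
        · simp [ht]
        · rw [single_eq_of_ne ht]
          exact (mem_supported' _ z).1 hz t (by simpa using ht)
      have hb : b = 0 := by
        have h1 := h.1
        rw [map_smul, boundary_of_zero, smul_zero, zero_add, ← mul_one b, ← smul_eq_mul,
          ← smul_single, map_smul, hφtop] at h1
        exact (smul_eq_zero.1 h1).resolve_right (of_ne_zero _)
      refine ⟨(0, single ⊤ a), ⟨zero_mem _, single_mem_supported _ _ (by simp)⟩, ?_⟩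
      have h1 : d (single ⊤ a) = 0 := by
        rw [← mul_one a, ← smul_eq_mul, ← smul_single, map_smul, differential_top hdeg hd,
          smul_zero]
      rw [coneDifferential_apply, h1, hb, single_zero, map_zero, zero_add, ← mul_one a,
        ← smul_eq_mul, ← smul_single, map_smul, hφtop, smul_eq_mul, mul_one]
    · obtain ⟨y, hy, rfl⟩ := hD q hq z hz h.2
      obtain ⟨e, he, hbe⟩ := hstar q hq (c + φ y)
        (add_mem hc (hφmem _ (isUpperSet_Ici q) y hy)) (by rw [map_add, hφ, h.1])
      refine ⟨(e, y), ⟨he, hy⟩, ?_⟩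
      rw [coneDifferential_apply, hbe, add_assoc, ZModModule.add_self, add_zero]
  generalize hn : U.ncard = n
  induction n using Nat.strong_induction_on generalizing U with
  | _ n ih =>
    obtain ⟨q, hqU, hmin⟩ := (Set.toFinite U).exists_minimal ⟨⊤, htop⟩
    by_cases hUq : U = Set.Ici q
    · rw [hUq]
      exact hbase q
    have hq : q ≠ ⊤ := by
      rintro rfl
      refine hUq (Set.Subset.antisymm (fun u hu => ?_) fun u hu => ?_)
      · exact hmin hu le_top
      · exact hU hu hqU
    have hIci : Set.Ici q ⊆ U := fun t ht => hU ht hqU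
    set V := U \ {q} with hVdef
    have hV : IsUpperSet V := by
      intro s t hst hs
      refine ⟨hU hst hs.1, fun h => hs.2 ?_⟩
      rw [Set.mem_singleton_iff] at h
      subst h
      exact le_antisymm hst (hmin hs.1 hst)
    have hUV : U = V ∪ Set.Ici q := by
      ext t
      constructor
      · intro ht
        by_cases h : t = q
        · exact Or.inr h.ge
        · exact Or.inl ⟨ht, h⟩
      · rintro (h | h)
        · exact h.1
        · exact hIci h
    have hVtop : ⊤ ∈ V := ⟨htop, hq.symm⟩
    have hVlt : V.ncard < n := hn ▸ Set.ncard_lt_ncard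
      ⟨Set.sdiff_subset, fun h => (h hqU).2 rfl⟩ (Set.toFinite U)
    have hVq : (V ∩ Set.Ici q).ncard < n :=
      (Set.ncard_le_ncard Set.inter_subset_left (Set.toFinite V)).trans_lt hVlt
    -- The intersection with the star of `q` is again an upper set containing `⊤`, with fewer
    -- elements than `U`, so the induction hypothesis covers it.
    have hsup := AcyclicOn.sup hcone (hstable V hV) (hstable _ (isUpperSet_Ici q))
      (ih _ hVlt V hV hVtop rfl) (hbase q)
      (by rw [coneOn_inter]; exact ih _ hVq _ (hV.inter (isUpperSet_Ici q)) ⟨hVtop, le_top⟩ rfl)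
    have hle : coneOn κ V ⊔ coneOn κ (Set.Ici q) ≤ coneOn κ U :=
      sup_le (Submodule.prod_mono (chainsIn_mono (Set.preimage_mono Set.sdiff_subset))
        (supported_mono Set.sdiff_subset))
        (Submodule.prod_mono (chainsIn_mono (Set.preimage_mono hIci)) (supported_mono hIci))
    refine AcyclicOn.of_relative hcone hsup hle ?_
    rintro ⟨c, z⟩ ⟨hc, hz⟩ h
    simp only [coneDifferential_apply, Prod.mk_eq_zero] at h hc hz
    rw [hUV, Set.preimage_union] at hc
    rw [hUV, supported_union] at hz
    have hbc : boundary c = φ z := AcyclicOn.eq_of_add_eq_zero h.1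
    -- The sum of the two cones may be smaller than the cone over `U`, but only in its singular
    -- component. A singular chain whose boundary is a sum becomes a sum itself after adding a
    -- boundary.
    obtain ⟨e, he, hce⟩ := exists_add_boundary_mem_sup (isOpen_preimage_of_isUpperSet hopen hV)
      (hopen q) hc (by
        obtain ⟨z1, hz1, z2, hz2, rfl⟩ := Submodule.mem_sup.1 hz
        rw [hbc, map_add]
        exact Submodule.add_mem_sup (hφmem V hV z1 hz1) (hφmem _ (isUpperSet_Ici q) z2 hz2))
    refine ⟨(e, 0), ⟨by rwa [hUV, Set.preimage_union], zero_mem _⟩, ?_⟩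
    rw [coneOn, coneOn, Submodule.prod_sup_prod, coneDifferential_apply, map_zero, map_zero,
      add_zero]
    exact ⟨hce, by simpa using hz⟩

include hdeg hd hdd hstar hκ hopen hD in
/-- A complex of cells carried by acyclic stars computes singular homology: there is a chain map
respecting degrees whose cone is acyclic. -/
theorem exists_carried_map [Finite Q] :
    ∃ φ : (Q →₀ ZMod 2) →ₗ[ZMod 2] Chain X,
      (∀ x, boundary (φ x) = φ (d x)) ∧ φ (single ⊤ 1) = of (emptySimplex X) ∧
      (∀ q, degreePart (deg q) (φ (single q 1)) = φ (single q 1)) ∧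
      ∀ c z, boundary c = φ z → d z = 0 → ∃ e y, c = boundary e + φ y ∧ z = d y := by
  obtain ⟨N, hN⟩ : ∃ N, ∀ q, deg q ≤ N := by
    obtain ⟨N, hN⟩ := (Set.finite_range deg).bddAbove
    exact ⟨N, fun q => hN ⟨q, rfl⟩⟩
  obtain ⟨f, hftop, hf⟩ := exists_carried_chains hdeg hd hdd hstar N
  have hφ : ∀ x, boundary (linearCombination (ZMod 2) f x) =
      linearCombination (ZMod 2) f (d x) := fun x =>
    linearMap_eqOn_supported (f := boundary ∘ₗ linearCombination (ZMod 2) f)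
      (g := linearCombination (ZMod 2) f ∘ₗ d) (U := Set.univ)
      (fun q _ => by simpa using (hf q (hN q)).2.2) (by simp)
  refine ⟨linearCombination (ZMod 2) f, hφ, by simpa using hftop,
    fun q => by simpa using (hf q (hN q)).2.1, fun c z h1 h2 => ?_⟩
  -- The hypotheses on `c` and `z` say that the pair is a cycle of the cone over the whole space.
  obtain ⟨⟨e, y⟩, -, h⟩ := acyclicOn_coneOn hdeg hd hdd hstar hκ hopen hD hφ (by simpa using hftop)
    (fun q => by simpa using (hf q (hN q)).1) Set.univ isUpperSet_univ trivial (c, z)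
    ⟨by simp [chainsIn_univ], by simp⟩
    (by rw [coneDifferential_apply, h1, h2, ZModModule.add_self]; rfl)
  rw [coneDifferential_apply, Prod.mk.injEq] at h
  exact ⟨e, y, h.1.symm, h.2.symm⟩

end Carrier

end SingularModTwo

end

open Finsupp

noncomputable section

/-! ### Colourings of the facets of a simple polytope by involutions -/

open scoped Classical in
/-- The combinatorics of a simple polytope with vertices `W` and facets `Φ` together with an
involution of a set `E` for every facet. At a vertex `w` the facets are indexed by `I`, and in
suitable coordinates the involutions change the signs of the coordinates. The edges at `w` are
divided into ascending and descending ones by a height function. -/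
structure FacetColoring (I W Φ E : Type*) where
  /-- The facets at a vertex. -/
  facet : W → I → Φ
  facet_injective : ∀ w, Function.Injective (facet w)
  /-- The coordinates on `E` at a vertex. -/
  coord : W → E ≃ (I → ℤˣ)
  /-- The involutions. -/
  flip : Φ → E → E
  coord_flip : ∀ w i η, coord w (flip (facet w i) η) =
    Function.update (coord w η) i (-coord w η i)
  /-- The directions at a vertex in which the height increases. -/
  ascending : W → Set I
  /-- The height of a vertex. -/
  height : W → ℝ
  eq_or_height_lt : ∀ w u, (∀ i ∈ ascending w, facet w i ∈ Set.range (facet u)) →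
    u = w ∨ height u < height w
  exists_height_lt : ∀ w, ∀ i ∈ ascending w, ∃ u, height w < height u ∧
    ∀ j, j ≠ i → facet w j ∈ Set.range (facet u)

namespace FacetColoring

variable {I W Φ E : Type*} (F : FacetColoring I W Φ E)

open scoped Classical

/-! ### Orbits of the facet involutions -/

section Orbits

/-- The equivalence relation generated by the involutions of a set of facets. -/
def orbitSetoid (S : Finset Φ) : Setoid E :=
  Relation.EqvGen.setoid fun η η' => ∃ a ∈ S, η' = F.flip a η

/-- Two elements are related by the involutions of a set of facets. -/
def Rel (S : Finset Φ) (η η' : E) : Prop := (F.orbitSetoid S).r η η'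

variable {F}

lemma Rel.refl (S : Finset Φ) (η : E) : F.Rel S η η := (F.orbitSetoid S).refl η

lemma Rel.symm {S : Finset Φ} {η η' : E} (h : F.Rel S η η') : F.Rel S η' η :=
  (F.orbitSetoid S).symm h

lemma Rel.trans {S : Finset Φ} {η η' η'' : E} (h : F.Rel S η η') (h' : F.Rel S η' η'') :
    F.Rel S η η'' :=
  (F.orbitSetoid S).trans h h'

lemma Rel.flip {S : Finset Φ} {a : Φ} (ha : a ∈ S) (η : E) : F.Rel S η (F.flip a η) :=
  Relation.EqvGen.rel _ _ ⟨a, ha, rfl⟩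

lemma Rel.mono {S T : Finset Φ} (h : S ⊆ T) {η η' : E} (hη : F.Rel S η η') : F.Rel T η η' :=
  Relation.EqvGen.mono (fun _ _ ⟨a, ha, e⟩ => ⟨a, h ha, e⟩) _ _ hη

/-- In the coordinates at a common vertex the involutions of `S` change exactly the signs indexed by
`S`. Orbits are therefore subcubes, and two points of one orbit are joined by correcting the
differing coordinates one at a time. -/
lemma rel_iff [Finite I] {S : Finset Φ} {w : W} (hS : ∀ a ∈ S, a ∈ Set.range (F.facet w))
    {η η' : E} : F.Rel S η η' ↔ ∀ i, F.facet w i ∉ S → F.coord w η i = F.coord w η' i := by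
  constructor
  · intro h
    induction h with
    | rel η η' h =>
      obtain ⟨a, ha, rfl⟩ := h
      obtain ⟨j, rfl⟩ := hS a ha
      intro i hi
      rw [F.coord_flip, Function.update_of_ne]
      rintro rfl
      exact hi ha
    | refl => intros; rfl
    | symm _ _ _ ih => exact fun i hi => (ih i hi).symm
    | trans _ _ _ _ _ ih ih' => exact fun i hi => (ih i hi).trans (ih' i hi)
  · intro h
    have := Fintype.ofFinite I
    generalize hn : (Finset.univ.filter fun i => F.coord w η i ≠ F.coord w η' i).card = n
    induction n generalizing η with
    | zero =>
      have : η = η' := by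
        apply (F.coord w).injective
        funext i
        by_contra hi
        exact Finset.notMem_empty i ((Finset.card_eq_zero.1 hn) ▸ by simpa using hi)
      rw [this]
      exact Rel.refl _ _
    | succ n ih =>
      obtain ⟨i, hi⟩ : ∃ i, F.coord w η i ≠ F.coord w η' i := by
        by_contra! hall
        simp [hall] at hn
      have hiS : F.facet w i ∈ S := by
        by_contra hc
        exact hi (h i hc)
      have hneg : -F.coord w η i = F.coord w η' i := by
        rcases Int.units_eq_one_or (F.coord w η i) with h1 | h1 <;>
          rcases Int.units_eq_one_or (F.coord w η' i) with h2 | h2 <;> simp_all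
      refine (Rel.flip hiS η).trans (ih (fun j hj => ?_) ?_)
      · rw [F.coord_flip, Function.update_of_ne]
        · exact h j hj
        · rintro rfl
          exact hj hiS
      · have : (Finset.univ.filter fun j => F.coord w (F.flip (F.facet w i) η) j ≠
            F.coord w η' j) = (Finset.univ.filter fun j => F.coord w η j ≠
            F.coord w η' j).erase i := by
          ext j
          simp only [Finset.mem_filter, Finset.mem_univ, true_and, Finset.mem_erase, F.coord_flip]
          by_cases hj : j = i
          · subst hj
            simp [hneg]
          · simp [hj]
        rw [this, Finset.card_erase_of_mem (by simpa using hi), hn]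
        rfl

end Orbits

/-- A set of facets with a common vertex. -/
def IsFace (S : Finset Φ) : Prop := ∃ w, ∀ a ∈ S, a ∈ Set.range (F.facet w)

variable {F}

lemma IsFace.mono {S T : Finset Φ} (hT : F.IsFace T) (h : S ⊆ T) : F.IsFace S := by
  obtain ⟨w, hw⟩ := hT
  exact ⟨w, fun a ha => hw a (h ha)⟩

lemma flip_comm {w : W} {a b : Φ} (ha : a ∈ Set.range (F.facet w))
    (hb : b ∈ Set.range (F.facet w)) (η : E) : F.flip a (F.flip b η) = F.flip b (F.flip a η) := by
  obtain ⟨i, rfl⟩ := ha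
  obtain ⟨j, rfl⟩ := hb
  by_cases hij : i = j
  · rw [hij]
  apply (F.coord w).injective
  simp only [F.coord_flip]
  rw [Function.update_comm hij, Function.update_of_ne hij, Function.update_of_ne (Ne.symm hij)]

lemma flip_flip {S : Finset Φ} (hS : F.IsFace S) {a : Φ} (ha : a ∈ S) (η : E) :
    F.flip a (F.flip a η) = η := by
  obtain ⟨w, hw⟩ := hS
  obtain ⟨i, rfl⟩ := hw a ha
  apply (F.coord w).injective
  simp [F.coord_flip]

variable [Finite I]

lemma Rel.flip_flip {S T : Finset Φ} (hT : F.IsFace T) (hST : S ⊆ T) {a : Φ} (ha : a ∈ T)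
    {η η' : E} (h : F.Rel S η η') : F.Rel S (F.flip a η) (F.flip a η') := by
  obtain ⟨w, hw⟩ := hT
  have hS : ∀ a ∈ S, a ∈ Set.range (F.facet w) := fun a ha => hw a (hST ha)
  obtain ⟨i, rfl⟩ := hw a ha
  rw [rel_iff hS] at h ⊢
  intro j hj
  simp only [F.coord_flip]
  by_cases hij : j = i
  · subst hij
    simp [h j hj]
  · simp [hij, h j hj]

lemma not_rel_flip {S : Finset Φ} (hS : F.IsFace S) {a : Φ} (ha : a ∈ S) (η : E) :
    ¬ F.Rel (S.erase a) η (F.flip a η) := by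
  obtain ⟨w, hw⟩ := hS
  obtain ⟨i, rfl⟩ := hw a ha
  rw [rel_iff (w := w) fun b hb => hw b (Finset.mem_of_mem_erase hb)]
  intro h
  have := h i (by simp)
  rw [F.coord_flip, Function.update_self] at this
  rcases Int.units_eq_one_or (F.coord w η i) with h1 | h1 <;> simp [h1] at this

/-- An orbit of `S` splits into two orbits of `S.erase a`, exchanged by the involution of `a`: the
two ends of a cube in the direction `a`. Disjointness of the ends is `not_rel_flip`. -/
lemma Rel.erase {S : Finset Φ} (hS : F.IsFace S) {a : Φ} (ha : a ∈ S) {η η' : E}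
    (h : F.Rel S η η') : F.Rel (S.erase a) η η' ∨ F.Rel (S.erase a) (F.flip a η) η' := by
  obtain ⟨w, hw⟩ := hS
  have hw' : ∀ b ∈ S.erase a, b ∈ Set.range (F.facet w) :=
    fun b hb => hw b (Finset.mem_of_mem_erase hb)
  obtain ⟨i, rfl⟩ := hw a ha
  rw [rel_iff hw] at h
  rw [rel_iff hw', rel_iff hw']
  have key : ∀ j, F.facet w j ∉ S.erase (F.facet w i) → j = i ∨ F.facet w j ∉ S := by
    intro j hj
    by_contra! hc
    exact hj (Finset.mem_erase.2 ⟨fun e => hc.1 (F.facet_injective w e), hc.2⟩)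
  by_cases hi : F.coord w η i = F.coord w η' i
  · left
    intro j hj
    rcases key j hj with rfl | h'
    · exact hi
    · exact h j h'
  · right
    intro j hj
    rw [F.coord_flip]
    rcases key j hj with rfl | h'
    · rw [Function.update_self]
      rcases Int.units_eq_one_or (F.coord w η j) with h1 | h1 <;>
        rcases Int.units_eq_one_or (F.coord w η' j) with h2 | h2 <;> simp_all
    · rw [Function.update_of_ne (by rintro rfl; exact h' ha)]
      exact h j h'

lemma not_rel_and_rel {S : Finset Φ} (hS : F.IsFace S) {a : Φ} (ha : a ∈ S) {η η' : E}
    (h : F.Rel (S.erase a) η η') : ¬ F.Rel (S.erase a) (F.flip a η) η' :=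
  fun h' => not_rel_flip hS ha η (h.trans h'.symm)

/-! ### Cells -/

variable (F) in
/-- The chosen representative of an orbit. -/
def rep (S : Finset Φ) (η : E) : E := (Quotient.mk (F.orbitSetoid S) η).out

omit [Finite I] in
lemma rel_rep (S : Finset Φ) (η : E) : F.Rel S (F.rep S η) η :=
  Quotient.exact (Quotient.out_eq (Quotient.mk (F.orbitSetoid S) η))

omit [Finite I] in
lemma rep_eq_iff {S : Finset Φ} {η η' : E} : F.rep S η = F.rep S η' ↔ F.Rel S η η' := by
  constructor
  · intro h
    exact (rel_rep S η).symm.trans (h ▸ rel_rep S η')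
  · intro h
    rw [rep, rep, Quotient.sound (s := F.orbitSetoid S) h]

variable (F) in
/-- The cells: a face of the polytope together with an orbit of its facet involutions. -/
def Cell : Type _ := {t : Finset Φ × E // F.IsFace t.1 ∧ F.rep t.1 t.2 = t.2}

instance [Finite Φ] [Finite E] : Finite F.Cell := by
  have := Fintype.ofFinite Φ
  exact Subtype.finite

namespace Cell

/-- The facets that contain the cell. -/
def facets (t : F.Cell) : Finset Φ := t.1.1

/-- A representative of the orbit of the cell. -/
def sign (t : F.Cell) : E := t.1.2

omit [Finite I] in
lemma isFace (t : F.Cell) : F.IsFace t.facets := t.2.1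

omit [Finite I] in
lemma rep_sign (t : F.Cell) : F.rep t.facets t.sign = t.sign := t.2.2

variable (F) in
/-- The cell of a face and an element of an orbit. -/
def mk (S : Finset Φ) (hS : F.IsFace S) (η : E) : F.Cell :=
  ⟨(S, F.rep S η), hS, rep_eq_iff.2 (rel_rep S η)⟩

omit [Finite I] in
@[simp]
lemma mk_facets (S : Finset Φ) (hS : F.IsFace S) (η : E) : (mk F S hS η).facets = S := rfl

omit [Finite I] in
lemma rel_mk_sign (S : Finset Φ) (hS : F.IsFace S) (η : E) : F.Rel S (mk F S hS η).sign η :=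
  rel_rep S η

omit [Finite I] in
lemma mk_self (t : F.Cell) : mk F t.facets t.isFace t.sign = t :=
  Subtype.ext (Prod.ext rfl t.rep_sign)

omit [Finite I] in
lemma ext_of_rel {t t' : F.Cell} (h : t.facets = t'.facets) (h' : F.Rel t.facets t.sign t'.sign) :
    t = t' := by
  refine Subtype.ext (Prod.ext h ?_)
  change t.sign = t'.sign
  rw [← t.rep_sign, ← t'.rep_sign, ← h]
  exact rep_eq_iff.2 h'

instance : PartialOrder F.Cell where
  le t t' := t'.facets ⊆ t.facets ∧ F.Rel t.facets t.sign t'.sign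
  le_refl t := ⟨subset_rfl, Rel.refl _ _⟩
  le_trans t t' t'' h h' := ⟨h'.1.trans h.1, h.2.trans (h'.2.mono h.1)⟩
  le_antisymm t t' h h' := ext_of_rel (h'.1.antisymm h.1) h.2

omit [Finite I] in
lemma le_iff {t t' : F.Cell} :
    t ≤ t' ↔ t'.facets ⊆ t.facets ∧ F.Rel t.facets t.sign t'.sign := Iff.rfl

end Cell

/-! ### The complex of dual cubes -/

variable (F) in
/-- The chains of cells, with an additional generator `⊤` for the augmentation. -/
abbrev CellChain : Type _ := WithTop F.Cell →₀ ZMod 2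

variable (F) in
/-- The generator of the augmentation. -/
def topChain : F.CellChain := single ⊤ 1

variable (F) in
/-- The chain of the cell of a face and an element of an orbit. -/
def cellChain (S : Finset Φ) (η : E) : F.CellChain :=
  if h : F.IsFace S then single ↑(Cell.mk F S h η) 1 else 0

omit [Finite I] in
lemma cellChain_eq {S : Finset Φ} (h : F.IsFace S) (η : E) :
    F.cellChain S η = single ↑(Cell.mk F S h η) 1 := dif_pos h

omit [Finite I] in
lemma cellChain_self (t : F.Cell) : F.cellChain t.facets t.sign = single ↑t 1 := by
  rw [cellChain_eq t.isFace, Cell.mk_self]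

omit [Finite I] in
lemma cellChain_congr {S : Finset Φ} {η η' : E} (h : F.Rel S η η') :
    F.cellChain S η = F.cellChain S η' := by
  by_cases hS : F.IsFace S
  · rw [cellChain_eq hS, cellChain_eq hS]
    congr 2
    exact Cell.ext_of_rel rfl ((Cell.rel_mk_sign S hS η).trans
      (h.trans (Cell.rel_mk_sign S hS η').symm))
  · rw [cellChain, cellChain, dif_neg hS, dif_neg hS]

omit [Finite I] in
lemma cellChain_mem_supported {S : Finset Φ} {η : E} {U : Set (WithTop F.Cell)}
    (h : ∀ t : F.Cell, t.facets = S → F.Rel S t.sign η → (t : WithTop F.Cell) ∈ U) :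
    F.cellChain S η ∈ supported (ZMod 2) (ZMod 2) U := by
  by_cases hS : F.IsFace S
  · rw [cellChain_eq hS]
    exact single_mem_supported _ _ (h _ rfl (Cell.rel_mk_sign S hS η))
  · rw [cellChain, dif_neg hS]
    exact zero_mem _

variable (F) in
/-- The differential of a cell, relative to a set of facets that is never removed. -/
def cellBoundary (R : Finset Φ) : WithTop F.Cell → F.CellChain
  | Option.none => 0
  | Option.some t => (if t.facets = R then F.topChain else 0) + ∑ a ∈ t.facets \ R,
      (F.cellChain (t.facets.erase a) t.sign + F.cellChain (t.facets.erase a) (F.flip a t.sign))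

variable (F) in
/-- The differential of the chains of cells, relative to a set of facets. -/
def differential (R : Finset Φ) : F.CellChain →ₗ[ZMod 2] F.CellChain :=
  linearCombination (ZMod 2) (F.cellBoundary R)

omit [Finite I] in
@[simp]
lemma differential_topChain (R : Finset Φ) : F.differential R F.topChain = 0 := by
  rw [differential, topChain, linearCombination_single, one_smul]
  rfl

omit [Finite I] in
lemma differential_coe (R : Finset Φ) (t : F.Cell) : F.differential R (single ↑t 1) =
    (if t.facets = R then F.topChain else 0) + ∑ a ∈ t.facets \ R,
      (F.cellChain (t.facets.erase a) t.sign +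
        F.cellChain (t.facets.erase a) (F.flip a t.sign)) := by
  rw [differential, linearCombination_single, one_smul]
  rfl

/-- The chosen representative does not matter: replacing it by another point of the orbit at most
exchanges the two ends in a given direction, and their sum is unchanged. -/
lemma differential_cellChain (R : Finset Φ) {S : Finset Φ} (hS : F.IsFace S) (η : E) :
    F.differential R (F.cellChain S η) =
      (if S = R then F.topChain else 0) + ∑ a ∈ S \ R,
      (F.cellChain (S.erase a) η + F.cellChain (S.erase a) (F.flip a η)) := by
  rw [cellChain_eq hS, differential_coe, Cell.mk_facets]
  congr 1
  refine Finset.sum_congr rfl fun a ha => ?_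
  have ha' : a ∈ S := (Finset.mem_sdiff.1 ha).1
  have hrel := Cell.rel_mk_sign S hS η
  generalize (Cell.mk F S hS η).sign = η₀ at hrel
  rcases hrel.erase hS ha' with h | h
  · rw [cellChain_congr h, cellChain_congr (h.flip_flip hS (Finset.erase_subset _ _) ha')]
  · have h' := h.flip_flip hS (Finset.erase_subset _ _) ha'
    rw [flip_flip hS ha'] at h'
    rw [cellChain_congr h, cellChain_congr h', add_comm]

lemma sum_sum_erase_eq_zero {α M : Type*} [AddCommGroup M] [Module (ZMod 2) M] (A : Finset α)
    (g : α → α → M) (hg : ∀ a ∈ A, ∀ b ∈ A, g a b = g b a) :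
    ∑ a ∈ A, ∑ b ∈ A.erase a, g a b = 0 := by
  rw [Finset.sum_sigma']
  refine Finset.sum_involution (fun p _ => ⟨p.2, p.1⟩) ?_ ?_ ?_ ?_
  · rintro ⟨a, b⟩ h
    simp only [Finset.mem_sigma, Finset.mem_erase] at h
    rw [hg a h.1 b h.2.2, ZModModule.add_self]
  · rintro ⟨a, b⟩ h - he
    simp only [Finset.mem_sigma, Finset.mem_erase] at h
    exact h.2.1 (congrArg Sigma.fst he)
  · rintro ⟨a, b⟩ h
    simp only [Finset.mem_sigma, Finset.mem_erase] at h ⊢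
    exact ⟨h.2.2, Ne.symm h.2.1, h.1⟩
  · rintro ⟨a, b⟩ _
    rfl

lemma differential_differential_cellChain {R S : Finset Φ} (hS : F.IsFace S)
    (η : E) : F.differential R (F.differential R (F.cellChain S η)) = 0 := by
  rw [differential_cellChain R hS, map_add, map_sum]
  have h1 : F.differential R (if S = R then F.topChain else 0) = 0 := by split_ifs <;> simp
  rw [h1, zero_add]
  have h2 : ∀ a ∈ S \ R, F.differential R (F.cellChain (S.erase a) η +
      F.cellChain (S.erase a) (F.flip a η)) = ∑ b ∈ (S \ R).erase a,
      (F.cellChain ((S.erase a).erase b) η + F.cellChain ((S.erase a).erase b) (F.flip b η) +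
        (F.cellChain ((S.erase a).erase b) (F.flip a η) +
          F.cellChain ((S.erase a).erase b) (F.flip b (F.flip a η)))) := by
    intro a ha
    have hSa : F.IsFace (S.erase a) := hS.mono (Finset.erase_subset _ _)
    rw [map_add, differential_cellChain R hSa, differential_cellChain R hSa,
      Finset.sum_add_distrib (s := (S \ R).erase a),
      show S.erase a \ R = (S \ R).erase a from Finset.erase_sdiff_comm S R a]
    -- The two ends in the direction `a` have the same facets, so their augmentation terms agree and
    -- cancel.
    rw [add_add_add_comm, ZModModule.add_self, zero_add]
  rw [Finset.sum_congr rfl h2]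
  apply sum_sum_erase_eq_zero
  intro a ha b hb
  obtain ⟨w, hw⟩ := hS
  rw [Finset.erase_right_comm, flip_comm (hw b (Finset.mem_sdiff.1 hb).1)
    (hw a (Finset.mem_sdiff.1 ha).1)]
  abel

omit [Finite I] in
lemma cellChain_induction {U : Set (WithTop F.Cell)} {p : F.CellChain → Prop} {x : F.CellChain}
    (hx : x ∈ supported (ZMod 2) (ZMod 2) U) (zero : p 0) (add : ∀ a b, p a → p b → p (a + b))
    (top : ⊤ ∈ U → p F.topChain) (cell : ∀ t : F.Cell, ↑t ∈ U → p (single ↑t 1)) : p x := by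
  rw [supported_eq_span_single] at hx
  induction hx using Submodule.span_induction with
  | mem x h =>
    obtain ⟨q, h, rfl⟩ := h
    induction q using WithTop.recTopCoe with
    | top => exact top h
    | coe t => exact cell t h
  | zero => exact zero
  | add x y _ _ hx hy => exact add _ _ hx hy
  | smul a x _ hx =>
    obtain rfl | rfl : a = 0 ∨ a = 1 := by revert a; decide
    · rwa [zero_smul]
    · rwa [one_smul]

variable (F) in
/-- The augmented star of a cell, relative to a set of facets. -/
def relStar (R S : Finset Φ) (η : E) : Set (WithTop F.Cell) :=
  {q | ∀ t : F.Cell, q = t → R ⊆ t.facets ∧ t.facets ⊆ S ∧ F.Rel S η t.sign}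

omit [Finite I] in
lemma top_mem_relStar (R S : Finset Φ) (η : E) : ⊤ ∈ F.relStar R S η :=
  fun _ h => absurd h.symm (WithTop.coe_ne_top)

omit [Finite I] in
lemma coe_mem_relStar {R S : Finset Φ} {η : E} {t : F.Cell} :
    (t : WithTop F.Cell) ∈ F.relStar R S η ↔ R ⊆ t.facets ∧ t.facets ⊆ S ∧ F.Rel S η t.sign :=
  ⟨fun h => h t rfl, fun h t' e => by rwa [← WithTop.coe_inj.1 e]⟩

omit [Finite I] in
lemma topChain_mem_relStar (R S : Finset Φ) (η : E) :
    F.topChain ∈ supported (ZMod 2) (ZMod 2) (F.relStar R S η) :=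
  single_mem_supported _ _ (top_mem_relStar R S η)

omit [Finite I] in
lemma cellChain_mem_relStar {R S S' : Finset Φ} {η η' : E} (h1 : R ⊆ S') (h2 : S' ⊆ S)
    (h3 : F.Rel S η η') :
    F.cellChain S' η' ∈ supported (ZMod 2) (ZMod 2) (F.relStar R S η) := by
  refine cellChain_mem_supported fun t ht hr => coe_mem_relStar.2 ?_
  rw [ht]
  exact ⟨h1, h2, h3.trans (hr.symm.mono h2)⟩

omit [Finite I] in
lemma differential_mem_relStar {R S : Finset Φ} {η : E} {x : F.CellChain}
    (hx : x ∈ supported (ZMod 2) (ZMod 2) (F.relStar R S η)) :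
    F.differential R x ∈ supported (ZMod 2) (ZMod 2) (F.relStar R S η) := by
  refine cellChain_induction (p := fun x => F.differential R x ∈ supported (ZMod 2) (ZMod 2)
    (F.relStar R S η)) hx (by simp) (fun a b ha hb => by rw [map_add]; exact add_mem ha hb)
    (fun _ => by simp) fun t ht => ?_
  obtain ⟨h1, h2, h3⟩ := coe_mem_relStar.1 ht
  rw [differential_coe]
  refine add_mem ?_ (sum_mem fun a ha => ?_)
  · split_ifs
    · exact topChain_mem_relStar R S η
    · exact zero_mem _
  · rw [Finset.mem_sdiff] at ha
    have h4 : R ⊆ t.facets.erase a := fun b hb =>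
      Finset.mem_erase.2 ⟨fun e => ha.2 (e ▸ hb), h1 hb⟩
    have h5 : t.facets.erase a ⊆ S := (Finset.erase_subset _ _).trans h2
    exact add_mem (cellChain_mem_relStar h4 h5 h3)
      (cellChain_mem_relStar h4 h5 (h3.trans (Rel.flip (h2 ha.1) _)))

lemma differential_differential (R : Finset Φ) (x : F.CellChain) :
    F.differential R (F.differential R x) = 0 := by
  refine cellChain_induction (U := Set.univ)
    (p := fun x => F.differential R (F.differential R x) = 0) (by simp) (by simp)
    (fun a b ha hb => by rw [map_add, map_add, ha, hb, add_zero])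
    (fun _ => by simp) fun t ht => ?_
  rw [← cellChain_self]
  exact differential_differential_cellChain t.isFace _

/-! ### Acyclicity of the stars -/

variable (F) in
/-- The homotopy that pushes a star across the wall of the facet `a` into one of the halves; `T` and
`η` specify the half that is pushed. -/
def pushHomotopy (a : Φ) (T : Finset Φ) (η : E) : F.CellChain →ₗ[ZMod 2] F.CellChain :=
  linearCombination (ZMod 2) fun q : WithTop F.Cell => match q with
    | Option.none => 0
    | Option.some t =>
      if a ∉ t.facets ∧ F.Rel T η t.sign then F.cellChain (insert a t.facets) t.sign
        else 0

omit [Finite I] in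
@[simp]
lemma pushHomotopy_topChain (a : Φ) (T : Finset Φ) (η : E) :
    F.pushHomotopy a T η F.topChain = 0 := by
  rw [pushHomotopy, topChain, linearCombination_single, one_smul]

omit [Finite I] in
-- The inclusion of `S'` in `T` ensures that the half in which a cell lies does not depend on its
-- representative.
lemma pushHomotopy_cellChain {a : Φ} {S' T : Finset Φ} (hS' : F.IsFace S') (η η' : E)
    (hT : a ∉ S' → S' ⊆ T) : F.pushHomotopy a T η (F.cellChain S' η') =
      if a ∉ S' ∧ F.Rel T η η' then F.cellChain (insert a S') η' else 0 := by
  have hrel := Cell.rel_mk_sign S' hS' η'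
  have h1 : F.pushHomotopy a T η (F.cellChain S' η') =
      if a ∉ S' ∧ F.Rel T η (Cell.mk F S' hS' η').sign then
        F.cellChain (insert a S') (Cell.mk F S' hS' η').sign else 0 := by
    rw [cellChain_eq hS', pushHomotopy, linearCombination_single, one_smul]
    rfl
  rw [h1]
  by_cases ha : a ∉ S'
  · have h2 : F.Rel T η (Cell.mk F S' hS' η').sign ↔ F.Rel T η η' :=
      ⟨fun h => h.trans (hrel.mono (hT ha)), fun h => h.trans (hrel.mono (hT ha)).symm⟩
    rw [h2, cellChain_congr (hrel.mono (Finset.subset_insert a S'))]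
  · simp [ha]

/-- The star of `S` is a cube, and `id + d h + h d` is its projection along the direction `a` to the
end containing `η`. Here `h` sends a cell at the opposite end to the prism over it. -/
lemma add_push_mem {R S : Finset Φ} (hS : F.IsFace S) {a : Φ} (ha : a ∈ S) (haR : a ∉ R) (η : E)
    {x : F.CellChain} (hx : x ∈ supported (ZMod 2) (ZMod 2) (F.relStar R S η)) :
    x + F.differential R (F.pushHomotopy a (S.erase a) (F.flip a η) x) +
      F.pushHomotopy a (S.erase a) (F.flip a η) (F.differential R x) ∈
      supported (ZMod 2) (ZMod 2) (F.relStar R (S.erase a) η) := by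
  set h := F.pushHomotopy a (S.erase a) (F.flip a η) with hh
  refine cellChain_induction (p := fun x => x + F.differential R (h x) + h (F.differential R x) ∈
    supported (ZMod 2) (ZMod 2) (F.relStar R (S.erase a) η)) hx (by simp) (fun x y hx hy => ?_)
    (fun _ => ?_) fun t ht => ?_
  · convert add_mem hx hy using 1
    simp only [map_add]
    abel
  · simpa [h] using topChain_mem_relStar R (S.erase a) η
  rw [← cellChain_self]
  obtain ⟨h1, h2, h3⟩ := coe_mem_relStar.1 ht
  have hface := t.isFace
  generalize t.facets = S' at h1 h2 h3 hface
  generalize t.sign = η' at h1 h2 h3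
  have hSub : ∀ T : Finset Φ, T ⊆ S → a ∉ T → T ⊆ S.erase a := fun T hT haT b hb =>
    Finset.mem_erase.2 ⟨fun e => haT (e ▸ hb), hT hb⟩
  have hpush : ∀ (T : Finset Φ) (θ : E), T ⊆ S → h (F.cellChain T θ) =
      if a ∉ T ∧ F.Rel (S.erase a) (F.flip a η) θ then F.cellChain (insert a T) θ else 0 :=
    fun T θ hT => pushHomotopy_cellChain (hS.mono hT) _ _ (hSub T hT)
  have hdh : h (F.differential R (F.cellChain S' η')) = ∑ b ∈ S' \ R,
      (h (F.cellChain (S'.erase b) η') + h (F.cellChain (S'.erase b) (F.flip b η'))) := by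
    rw [differential_cellChain R hface, map_add, map_sum]
    have : h (if S' = R then F.topChain else 0) = 0 := by split_ifs <;> simp [h]
    rw [this, zero_add]
    simp only [map_add]
  rw [hdh]
  have hsub' : ∀ b, S'.erase b ⊆ S := fun b => (Finset.erase_subset _ _).trans h2
  by_cases haS' : a ∈ S'
  -- A cell that extends in the direction `a` collapses under the projection: exactly one of its
  -- ends is pushed, and its prism is the cell itself.
  · have hz : h (F.cellChain S' η') = 0 := by rw [hpush _ _ h2]; simp [haS']
    rw [hz, map_zero, add_zero, Finset.sum_eq_single_of_mem a (Finset.mem_sdiff.2 ⟨haS', haR⟩)]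
    · rw [hpush _ _ (hsub' a), hpush _ _ (hsub' a)]
      simp only [Finset.notMem_erase, not_false_eq_true, true_and, Finset.insert_erase haS']
      have h5 : F.Rel (S.erase a) (F.flip a η) (F.flip a η') ↔ F.Rel (S.erase a) η η' := by
        constructor
        · intro h
          have := h.flip_flip hS (Finset.erase_subset _ _) ha
          rwa [flip_flip hS ha, flip_flip hS ha] at this
        · intro h
          exact h.flip_flip hS (Finset.erase_subset _ _) ha
      rw [h5]
      have hcc : F.cellChain S' (F.flip a η') = F.cellChain S' η' :=
        cellChain_congr (Rel.flip haS' η').symm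
      rcases h3.erase hS ha with h6 | h6
      · rw [if_neg (not_rel_and_rel hS ha h6), if_pos h6, zero_add, hcc, ZModModule.add_self]
        exact zero_mem _
      · rw [if_pos h6, if_neg fun h7 => not_rel_and_rel hS ha h7 h6, add_zero,
          ZModModule.add_self]
        exact zero_mem _
    · intro b _ hb
      rw [hpush _ _ (hsub' b), hpush _ _ (hsub' b)]
      simp [haS', Ne.symm hb]
  · have hsum : ∀ b ∈ S' \ R, (h (F.cellChain (S'.erase b) η') +
        h (F.cellChain (S'.erase b) (F.flip b η'))) =
        if F.Rel (S.erase a) (F.flip a η) η' then F.cellChain (insert a (S'.erase b)) η' +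
          F.cellChain (insert a (S'.erase b)) (F.flip b η') else 0 := by
      intro b hb
      have hbS' : b ∈ S' := (Finset.mem_sdiff.1 hb).1
      have hbS : b ∈ S.erase a := hSub S' h2 haS' hbS'
      rw [hpush _ _ (hsub' b), hpush _ _ (hsub' b)]
      have h6 : F.Rel (S.erase a) (F.flip a η) (F.flip b η') ↔
          F.Rel (S.erase a) (F.flip a η) η' :=
        ⟨fun h => h.trans (Rel.flip hbS η').symm, fun h => h.trans (Rel.flip hbS η')⟩
      have h7 : a ∉ S'.erase b := fun h => haS' (Finset.mem_of_mem_erase h)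
      simp only [h6, h7, not_false_eq_true, true_and]
      split_ifs <;> simp
    rw [Finset.sum_congr rfl hsum, hpush _ _ h2]
    simp only [haS', not_false_eq_true, true_and]
    -- Cells at the end of `η` are fixed. A cell at the other end is replaced by its mirror image,
    -- the opposite end of its prism; the remaining faces of the prism cancel against the prisms
    -- over the faces.
    rcases h3.erase hS ha with h6 | h6
    · have h7 := not_rel_and_rel hS ha h6
      simp only [h7, if_false, map_zero, Finset.sum_const_zero, add_zero]
      exact cellChain_mem_relStar h1 (hSub S' h2 haS') h6
    · simp only [h6, if_true]
      have hins : insert a S' ⊆ S := Finset.insert_subset ha h2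
      rw [differential_cellChain R (hS.mono hins), if_neg (by
        rintro rfl
        exact haR (Finset.mem_insert_self a S')), zero_add]
      have hsd : insert a S' \ R = insert a (S' \ R) := Finset.insert_sdiff_of_notMem _ haR
      rw [hsd, Finset.sum_insert (by simp [haS']), Finset.erase_insert haS']
      have hcomm : ∀ b ∈ S' \ R, (insert a S').erase b = insert a (S'.erase b) := fun b hb =>
        Finset.erase_insert_of_ne (by
          rintro rfl
          exact haS' (Finset.mem_sdiff.1 hb).1)
      rw [Finset.sum_congr rfl fun b hb => by rw [hcomm b hb]]
      generalize ∑ b ∈ S' \ R, (F.cellChain (insert a (S'.erase b)) η' +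
        F.cellChain (insert a (S'.erase b)) (F.flip b η')) = z
      rw [show F.cellChain S' η' + (F.cellChain S' η' + F.cellChain S' (F.flip a η') + z) + z =
        (F.cellChain S' η' + F.cellChain S' η') + (z + z) + F.cellChain S' (F.flip a η') by abel,
        ZModModule.add_self, ZModModule.add_self, zero_add, zero_add]
      refine cellChain_mem_relStar h1 (hSub S' h2 haS') ?_
      have := h6.flip_flip hS (Finset.erase_subset _ _) ha
      rwa [flip_flip hS ha] at this

/-- The augmented relative star of a cell is acyclic. -/
theorem acyclicOn_relStar {R S : Finset Φ} (hS : F.IsFace S) (hR : R ⊆ S) (η : E) :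
    AcyclicOn (F.differential R) (supported (ZMod 2) (ZMod 2) (F.relStar R S η)) := by
  generalize hn : (S \ R).card = n
  induction n generalizing S with
  | zero =>
    have hSR : S = R :=
      (Finset.sdiff_eq_empty_iff_subset.1 (Finset.card_eq_zero.1 hn)).antisymm hR
    subst hSR
    intro x hx hdx
    -- With no free direction the star has a single cell, and the augmentation sends it to the top
    -- generator.
    have hform : ∃ α β : ZMod 2, x = α • F.cellChain S η + β • F.topChain := by
      refine cellChain_induction
        (p := fun x => ∃ α β : ZMod 2, x = α • F.cellChain S η + β • F.topChain) hx
        ⟨0, 0, by simp⟩ ?_ (fun _ => ⟨0, 1, by simp⟩) fun t ht => ⟨1, 0, ?_⟩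
      · rintro _ _ ⟨α, β, rfl⟩ ⟨α', β', rfl⟩
        exact ⟨α + α', β + β', by rw [add_smul, add_smul]; abel⟩
      · obtain ⟨h1, h2, h3⟩ := coe_mem_relStar.1 ht
        rw [← cellChain_self, h2.antisymm h1, cellChain_congr h3]
        simp
    obtain ⟨α, β, rfl⟩ := hform
    have hd : F.differential S (F.cellChain S η) = F.topChain := by
      rw [differential_cellChain S hS]
      simp
    rw [map_add, map_smul, map_smul, hd, differential_topChain, smul_zero, add_zero,
      smul_eq_zero] at hdx
    have hα : α = 0 := hdx.resolve_right (by simp [topChain])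
    refine ⟨β • F.cellChain S η, Submodule.smul_mem _ _
      (cellChain_mem_relStar subset_rfl subset_rfl (Rel.refl _ _)), ?_⟩
    rw [map_smul, hd, hα, zero_smul, zero_add]
  | succ n ih =>
    obtain ⟨a, ha⟩ : (S \ R).Nonempty := Finset.card_pos.1 (by omega)
    obtain ⟨haS, haR⟩ := Finset.mem_sdiff.1 ha
    have hsub : S.erase a ⊆ S := Finset.erase_subset _ _
    have hRa : R ⊆ S.erase a := fun b hb =>
      Finset.mem_erase.2 ⟨fun e => haR (e ▸ hb), hR hb⟩
    have hle : F.relStar R (S.erase a) η ⊆ F.relStar R S η := by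
      intro q hq t ht
      obtain ⟨h1, h2, h3⟩ := hq t ht
      exact ⟨h1, h2.trans hsub, h3.mono hsub⟩
    have hstar := ih (S := S.erase a) (hS.mono hsub) hRa (by
      rw [show S.erase a \ R = (S \ R).erase a from Finset.erase_sdiff_comm S R a,
        Finset.card_erase_of_mem ha, hn]
      rfl)
    intro x hx hdx
    set y := F.pushHomotopy a (S.erase a) (F.flip a η) x with hy
    have hyS : y ∈ supported (ZMod 2) (ZMod 2) (F.relStar R S η) := by
      refine cellChain_induction (p := fun x => F.pushHomotopy a (S.erase a) (F.flip a η) x ∈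
        supported (ZMod 2) (ZMod 2) (F.relStar R S η)) hx (by simp)
        (fun _ _ h h' => by rw [map_add]; exact add_mem h h') (fun _ => by simp) fun t ht => ?_
      obtain ⟨h1, h2, h3⟩ := coe_mem_relStar.1 ht
      rw [← cellChain_self, pushHomotopy_cellChain t.isFace _ _ fun h b hb =>
        Finset.mem_erase.2 ⟨fun e => h (e ▸ hb), h2 hb⟩]
      split_ifs
      · exact cellChain_mem_relStar (h1.trans (Finset.subset_insert _ _))
          (Finset.insert_subset haS h2) h3
      · exact zero_mem _
    have hmem := add_push_mem hS haS haR η hx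
    -- For a cycle the term `h d` vanishes, so the cycle is homologous to its projection, which lies
    -- in a cube of smaller dimension.
    rw [hdx, map_zero, add_zero, ← hy] at hmem
    obtain ⟨z, hz, hdz⟩ := hstar _ hmem (by
      rw [map_add, hdx, differential_differential, add_zero])
    refine ⟨z + y, add_mem (supported_mono hle hz) hyS, ?_⟩
    rw [map_add, hdz, add_assoc, ZModModule.add_self, add_zero]

end FacetColoring

end

open Finsupp

noncomputable section

namespace FacetColoring

variable {I W Φ E : Type*} {F : FacetColoring I W Φ E} [Finite I]

open scoped Classical

/-! ### The degree of a cell -/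

variable (F) in
/-- The degree of a cell, shifted by one because of the augmentation. -/
def cellDegree : WithTop F.Cell → ℕ
  | Option.none => 0
  | Option.some t => t.facets.card + 1

omit [Finite I] in
@[simp]
lemma cellDegree_top : F.cellDegree ⊤ = 0 := rfl

omit [Finite I] in
@[simp]
lemma cellDegree_coe (t : F.Cell) : F.cellDegree t = t.facets.card + 1 := rfl

omit [Finite I] in
lemma cellDegree_eq_zero_iff (q : WithTop F.Cell) : F.cellDegree q = 0 ↔ q = ⊤ := by
  induction q using WithTop.recTopCoe with
  | top => simp
  | coe t => simp

omit [Finite I] in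
lemma differential_single_mem (q : WithTop F.Cell) : F.differential ∅ (single q 1) ∈
    supported (ZMod 2) (ZMod 2) {q' | q ≤ q' ∧ F.cellDegree q' + 1 = F.cellDegree q} := by
  induction q using WithTop.recTopCoe with
  | top =>
    change F.differential ∅ F.topChain ∈ _
    simp
  | coe t =>
    rw [differential_coe]
    refine add_mem ?_ (sum_mem fun a ha => ?_)
    · split_ifs with h
      · exact single_mem_supported _ _ ⟨le_top, by simp [h]⟩
      · exact zero_mem _
    · have ha' : a ∈ t.facets := (Finset.mem_sdiff.1 ha).1
      have hcard : (t.facets.erase a).card + 1 = t.facets.card := Finset.card_erase_add_one ha'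
      refine add_mem (cellChain_mem_supported fun t' ht' hr => ⟨?_, ?_⟩)
        (cellChain_mem_supported fun t' ht' hr => ⟨?_, ?_⟩)
      · rw [WithTop.coe_le_coe, Cell.le_iff, ht']
        exact ⟨Finset.erase_subset _ _, hr.symm.mono (Finset.erase_subset _ _)⟩
      · simp [ht', hcard]
      · rw [WithTop.coe_le_coe, Cell.le_iff, ht']
        exact ⟨Finset.erase_subset _ _,
          (Rel.flip ha' _).trans (hr.symm.mono (Finset.erase_subset _ _))⟩
      · simp [ht', hcard]

/-- The cells above a given cell, together with the augmentation, are the faces of its dual cube. -/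
lemma acyclicOn_Ici {q : WithTop F.Cell} (hq : q ≠ ⊤) :
    AcyclicOn (F.differential ∅) (supported (ZMod 2) (ZMod 2) (Set.Ici q)) := by
  obtain ⟨t, rfl⟩ := WithTop.ne_top_iff_exists.1 hq
  have : Set.Ici (t : WithTop F.Cell) = F.relStar ∅ t.facets t.sign := by
    ext q
    induction q using WithTop.recTopCoe with
    | top => simp [top_mem_relStar]
    | coe t' => simp [coe_mem_relStar, Cell.le_iff]
  rw [this]
  exact acyclicOn_relStar t.isFace (Finset.empty_subset _) _

/-! ### The top vertex of a face -/

variable [Fintype I]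

variable (F) in
/-- The facets at a vertex. -/
def vertexFacets (w : W) : Finset Φ := Finset.univ.image (F.facet w)

variable (F) in
/-- The facets at a vertex opposite to the ascending edges. -/
def lowerFacets (w : W) : Finset Φ :=
  (Finset.univ.filter fun i => i ∈ F.ascending w).image (F.facet w)

omit [Finite I] in
lemma lowerFacets_subset (w : W) : F.lowerFacets w ⊆ F.vertexFacets w :=
  Finset.image_subset_image (Finset.filter_subset _ _)

omit [Finite I] in
lemma mem_vertexFacets {w : W} {a : Φ} : a ∈ F.vertexFacets w ↔ a ∈ Set.range (F.facet w) := by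
  simp [vertexFacets]

omit [Finite I] in
lemma isFace_vertexFacets (w : W) : F.IsFace (F.vertexFacets w) :=
  ⟨w, fun _ ha => mem_vertexFacets.1 ha⟩

omit [Finite I] in
lemma isFace_lowerFacets (w : W) : F.IsFace (F.lowerFacets w) :=
  (isFace_vertexFacets w).mono (lowerFacets_subset w)

omit [Finite I] in
lemma card_lowerFacets (w : W) : (F.lowerFacets w).card = (F.ascending w).ncard := by
  rw [lowerFacets, Finset.card_image_of_injective _ (F.facet_injective w),
    ← Set.ncard_coe_finset]
  congr 1
  ext i
  simp

omit [Finite I] in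
lemma eq_or_height_lt_of_subset {w u : W} (h : F.lowerFacets w ⊆ F.vertexFacets u) :
    u = w ∨ F.height u < F.height w := by
  refine F.eq_or_height_lt w u fun i hi => mem_vertexFacets.1 (h ?_)
  exact Finset.mem_image_of_mem _ (by simpa using hi)

omit [Finite I] in
-- Take a vertex of the face of maximal height. An ascending edge not leaving any facet of `S` would
-- stay in the face and lead higher, so all facets opposite to ascending edges belong to `S`.
lemma exists_topVertex [Finite W] {S : Finset Φ} (hS : F.IsFace S) :
    ∃ w, F.lowerFacets w ⊆ S ∧ S ⊆ F.vertexFacets w := by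
  have hne : {w | S ⊆ F.vertexFacets w}.Nonempty := by
    obtain ⟨w, hw⟩ := hS
    exact ⟨w, fun a ha => mem_vertexFacets.2 (hw a ha)⟩
  obtain ⟨w, hw, hmax⟩ := (Set.toFinite {w | S ⊆ F.vertexFacets w}).exists_maximalFor
    F.height _ hne
  refine ⟨w, fun a ha => ?_, hw⟩
  obtain ⟨i, hi, rfl⟩ := Finset.mem_image.1 ha
  by_contra hc
  obtain ⟨u, hu, hju⟩ := F.exists_height_lt w i (by simpa using hi)
  have hSu : S ⊆ F.vertexFacets u := fun b hb => by
    obtain ⟨j, rfl⟩ := mem_vertexFacets.1 (hw hb)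
    refine mem_vertexFacets.2 (hju j ?_)
    rintro rfl
    exact hc hb
  exact absurd (hmax hSu hu.le) (not_le.2 hu)

section TopVertex

variable [Finite W]

/-- The highest vertex of the face of a cell. -/
def Cell.topVertex (t : F.Cell) : W := (exists_topVertex t.isFace).choose

omit [Finite I] in
lemma Cell.lowerFacets_subset (t : F.Cell) : F.lowerFacets t.topVertex ⊆ t.facets :=
  (exists_topVertex t.isFace).choose_spec.1

omit [Finite I] in
lemma Cell.subset_vertexFacets (t : F.Cell) : t.facets ⊆ F.vertexFacets t.topVertex :=
  (exists_topVertex t.isFace).choose_spec.2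

omit [Finite I] in
-- Of two different vertices with this property, each would be lower than the other.
lemma Cell.topVertex_eq {t : F.Cell} {w : W} (h1 : F.lowerFacets w ⊆ t.facets)
    (h2 : t.facets ⊆ F.vertexFacets w) : t.topVertex = w := by
  rcases eq_or_height_lt_of_subset (h1.trans t.subset_vertexFacets) with h | h
  · exact h
  · rcases eq_or_height_lt_of_subset (t.lowerFacets_subset.trans h2) with h' | h'
    · exact h'.symm
    · exact absurd h (not_lt.2 h'.le)

omit [Finite I] in
lemma Cell.topVertex_eq_or_height_lt {t t' : F.Cell} (h : t'.facets ⊆ t.facets) :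
    t.topVertex = t'.topVertex ∨ F.height t.topVertex < F.height t'.topVertex :=
  eq_or_height_lt_of_subset (t'.lowerFacets_subset.trans (h.trans t.subset_vertexFacets))

variable (F) in
/-- The cells with top vertex in a given set, and the augmentation. -/
def cellsOver (B : Set W) : Set (WithTop F.Cell) := {q | ∀ t : F.Cell, q = t → t.topVertex ∈ B}

omit [Finite I] in
lemma coe_mem_cellsOver {B : Set W} {t : F.Cell} :
    (t : WithTop F.Cell) ∈ F.cellsOver B ↔ t.topVertex ∈ B :=
  ⟨fun h => h t rfl, fun h t' e => by rwa [← WithTop.coe_inj.1 e]⟩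

omit [Finite I] in
lemma topChain_mem_cellsOver (B : Set W) :
    F.topChain ∈ supported (ZMod 2) (ZMod 2) (F.cellsOver B) :=
  single_mem_supported _ _ fun _ h => absurd h.symm WithTop.coe_ne_top

/-! ### The comparison with the set of vertices -/

variable (F) in
/-- The map from the chains of cells to the functions on the vertices that takes a cell to the
vertex at which it is the lower face. -/
def toVertices : F.CellChain →ₗ[ZMod 2] (W → ZMod 2) :=
  linearCombination (ZMod 2) fun q w =>
    if ∃ t : F.Cell, q = t ∧ t.facets = F.lowerFacets w then 1 else 0

omit [Finite I] [Finite W] in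
@[simp]
lemma toVertices_topChain : F.toVertices F.topChain = 0 := by
  funext w
  rw [toVertices, topChain, linearCombination_single, one_smul, if_neg]
  · rfl
  · rintro ⟨t, h, -⟩
    exact WithTop.coe_ne_top h.symm

omit [Finite I] [Finite W] in
lemma toVertices_coe (t : F.Cell) (w : W) :
    F.toVertices (single ↑t 1) w = if t.facets = F.lowerFacets w then 1 else 0 := by
  rw [toVertices, linearCombination_single, one_smul]
  congr 1
  simp

omit [Finite I] [Finite W] in
lemma toVertices_cellChain {S : Finset Φ} (hS : F.IsFace S) (η : E) (w : W) :
    F.toVertices (F.cellChain S η) w = if S = F.lowerFacets w then 1 else 0 := by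
  rw [cellChain_eq hS, toVertices_coe, Cell.mk_facets]

omit [Finite I] [Finite W] in
-- The point where coefficients modulo two are decisive. The value on a cell depends only on its
-- face of the polytope, and the two ends of a cube in one direction belong to the same face. This
-- makes the height function perfect: one independent class for each vertex.
lemma toVertices_differential (x : F.CellChain) : F.toVertices (F.differential ∅ x) = 0 := by
  refine cellChain_induction (U := Set.univ)
    (p := fun x => F.toVertices (F.differential ∅ x) = 0) (by simp) (by simp)
    (fun a b ha hb => by rw [map_add, map_add, ha, hb, add_zero])
    (fun _ => by simp) fun t _ => ?_
  rw [differential_coe, map_add, map_sum]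
  have h1 : F.toVertices (if t.facets = ∅ then F.topChain else 0) = 0 := by split_ifs <;> simp
  rw [h1, zero_add]
  refine Finset.sum_eq_zero fun a _ => ?_
  funext w
  have hf : F.IsFace (t.facets.erase a) := t.isFace.mono (Finset.erase_subset _ _)
  rw [map_add, Pi.add_apply, toVertices_cellChain hf, toVertices_cellChain hf]
  exact ZModModule.add_self _

omit [Finite I] in
lemma toVertices_eq_zero {B : Set W} {x : F.CellChain}
    (hx : x ∈ supported (ZMod 2) (ZMod 2) (F.cellsOver B)) {w : W} (hw : w ∉ B) :
    F.toVertices x w = 0 := by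
  refine cellChain_induction (p := fun x => F.toVertices x w = 0) hx (by simp)
    (fun a b ha hb => by rw [map_add, Pi.add_apply, ha, hb, add_zero]) (fun _ => by simp)
    fun t ht => ?_
  rw [toVertices_coe, if_neg]
  intro h
  refine hw ((Cell.topVertex_eq (w := w) h.ge ?_) ▸ coe_mem_cellsOver.1 ht)
  rw [h]
  exact FacetColoring.lowerFacets_subset w

/-- The involutions of all facets at a vertex act transitively on `E`, so the sign imposes no
condition and the cells over `w` form a single relative star, which is acyclic. -/
lemma relStar_vertexFacets (w : W) (η : E) :
    F.relStar (F.lowerFacets w) (F.vertexFacets w) η = F.cellsOver {w} := by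
  ext q
  induction q using WithTop.recTopCoe with
  | top => exact ⟨fun _ _ h => absurd h.symm WithTop.coe_ne_top, fun _ => top_mem_relStar _ _ _⟩
  | coe t =>
    rw [coe_mem_relStar, coe_mem_cellsOver, Set.mem_singleton_iff]
    constructor
    · rintro ⟨h1, h2, -⟩
      exact Cell.topVertex_eq h1 h2
    · rintro rfl
      refine ⟨t.lowerFacets_subset, t.subset_vertexFacets, ?_⟩
      rw [rel_iff (w := t.topVertex) fun a ha => mem_vertexFacets.1 ha]
      intro i hi
      exact absurd (mem_vertexFacets.2 ⟨i, rfl⟩) hi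

omit [Finite I] in
/-- Up to cells over higher vertices, the differential of the cells over a vertex is the relative
differential. -/
lemma differential_add_differential_mem {w : W} {B : Set W}
    (hB : ∀ u, F.height w < F.height u → u ∈ B) {x : F.CellChain}
    (hx : x ∈ supported (ZMod 2) (ZMod 2) (F.cellsOver {w})) :
    F.differential ∅ x + F.differential (F.lowerFacets w) x ∈
      supported (ZMod 2) (ZMod 2) (F.cellsOver B) := by
  refine cellChain_induction (p := fun x => F.differential ∅ x +
    F.differential (F.lowerFacets w) x ∈ supported (ZMod 2) (ZMod 2) (F.cellsOver B)) hx (by simp)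
    (fun a b ha hb => ?_) (fun _ => by simp) fun t ht => ?_
  · convert add_mem ha hb using 1
    rw [map_add, map_add]
    abel
  have ht' := coe_mem_cellsOver.1 ht
  rw [Set.mem_singleton_iff] at ht'
  subst ht'
  rw [differential_coe, differential_coe, Finset.sdiff_empty,
    ← Finset.sum_sdiff t.lowerFacets_subset, add_add_add_comm]
  refine add_mem (add_mem ?_ ?_) ?_
  · split_ifs
    · exact topChain_mem_cellsOver B
    · exact zero_mem _
  · split_ifs
    · exact topChain_mem_cellsOver B
    · exact zero_mem _
  · rw [add_right_comm, ZModModule.add_self, zero_add]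
    refine sum_mem fun a ha => ?_
    have key : ∀ t' : F.Cell, t'.facets = t.facets.erase a →
        (t' : WithTop F.Cell) ∈ F.cellsOver B := by
      intro t' h'
      rw [coe_mem_cellsOver]
      apply hB
      -- Dropping a lower facet enlarges the face along an ascending edge, so its highest vertex
      -- must change, and it can only move up.
      refine (Cell.topVertex_eq_or_height_lt (h'.trans_subset
        (Finset.erase_subset _ _))).resolve_left fun he => ?_
      have := t'.lowerFacets_subset
      rw [h', ← he] at this
      exact Finset.notMem_erase a _ (this ha)
    exact add_mem (cellChain_mem_supported fun t' h _ => key t' h)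
      (cellChain_mem_supported fun t' h _ => key t' h)

omit [Finite I] in
lemma supported_cellsOver_insert (w : W) (B : Set W) :
    supported (ZMod 2) (ZMod 2) (F.cellsOver (insert w B)) ≤
      supported (ZMod 2) (ZMod 2) (F.cellsOver {w}) ⊔
        supported (ZMod 2) (ZMod 2) (F.cellsOver B) := by
  rw [← supported_union]
  refine supported_mono fun q hq => ?_
  induction q using WithTop.recTopCoe with
  | top => exact Or.inl fun _ h => absurd h.symm WithTop.coe_ne_top
  | coe t =>
    rcases coe_mem_cellsOver.1 hq with h | h
    · exact Or.inl (coe_mem_cellsOver.2 h)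
    · exact Or.inr (coe_mem_cellsOver.2 h)

variable (F) in
/-- The multiples of the generator of the augmentation. -/
def topSpan : Submodule (ZMod 2) F.CellChain := Submodule.span (ZMod 2) {F.topChain}

omit [Finite I] in
lemma topSpan_le_cellsOver (B : Set W) :
    F.topSpan ≤ supported (ZMod 2) (ZMod 2) (F.cellsOver B) :=
  Submodule.span_le.2 (by simpa using topChain_mem_cellsOver B)

omit [Finite I] in
lemma mem_topSpan_of_mem_cellsOver {B B' : Set W} (hB : Disjoint B B') {x : F.CellChain}
    (hx : x ∈ supported (ZMod 2) (ZMod 2) (F.cellsOver B))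
    (hx' : x ∈ supported (ZMod 2) (ZMod 2) (F.cellsOver B')) : x ∈ F.topSpan := by
  have h : x ∈ supported (ZMod 2) (ZMod 2) {(⊤ : WithTop F.Cell)} := by
    have h1 : x ∈ supported (ZMod 2) (ZMod 2) (F.cellsOver B ∩ F.cellsOver B') := by
      rw [supported_inter]
      exact ⟨hx, hx'⟩
    refine supported_mono (fun q hq => ?_) h1
    induction q using WithTop.recTopCoe with
    | top => rfl
    | coe t =>
      exact absurd (coe_mem_cellsOver.1 hq.2)
        (Set.disjoint_left.1 hB (coe_mem_cellsOver.1 hq.1))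
  rw [supported_eq_span_single, Set.image_singleton] at h
  exact h

omit [Finite I] in
/-- The top coefficient of the relative differential. -/
lemma differential_lowerFacets_top {w : W} {x : F.CellChain}
    (hx : x ∈ supported (ZMod 2) (ZMod 2) (F.cellsOver {w})) :
    F.differential (F.lowerFacets w) x ⊤ = F.toVertices x w := by
  refine cellChain_induction
    (p := fun x => F.differential (F.lowerFacets w) x ⊤ = F.toVertices x w) hx (by simp)
    (fun a b ha hb => by
      rw [map_add, map_add, Finsupp.add_apply, Pi.add_apply, ha, hb]) (fun _ => by simp)
    fun t _ => ?_
  have hzero : ∀ S η, F.cellChain S η ⊤ = 0 := fun S η => by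
    have := cellChain_mem_supported (F := F) (S := S) (η := η) (U := {⊤}ᶜ)
      fun t _ _ => WithTop.coe_ne_top
    exact (mem_supported' _ _).1 this ⊤ (by simp)
  rw [differential_coe, toVertices_coe, Finsupp.add_apply, Finsupp.finsetSum_apply]
  simp only [Finsupp.add_apply, hzero, add_zero, Finset.sum_const_zero]
  split_ifs <;> simp [topChain]

/-- Induction on an upward closed set of vertices, clearing the part of `x` over the lowest vertex
first. The freedom to prescribe `toVertices y` is built in, so that one statement gives two results:
`x = 0` produces cycles with prescribed values, and arbitrary `x` shows that no other classes exist.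
Differentials in `topSpan`, rather than zero, correspond to unreduced cycles. -/
lemma exists_add_differential_mem_topSpan [Nonempty E] (B : Finset W)
    (hB : ∀ w ∈ B, ∀ u, F.height w < F.height u → u ∈ B) {x : F.CellChain}
    (hx : x ∈ supported (ZMod 2) (ZMod 2) (F.cellsOver (B : Set W)))
    (hdx : F.differential ∅ x ∈ F.topSpan) (hΨ : F.toVertices x = 0) {v : W → ZMod 2}
    (hv : ∀ w, w ∉ B → v w = 0) :
    ∃ y ∈ supported (ZMod 2) (ZMod 2) (F.cellsOver (B : Set W)),
      x + F.differential ∅ y ∈ F.topSpan ∧ F.toVertices y = v := by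
  generalize hn : B.card = n
  induction n generalizing B x v with
  | zero =>
    obtain rfl := Finset.card_eq_zero.1 hn
    refine ⟨0, zero_mem _, ?_, ?_⟩
    · rw [map_zero, add_zero]
      exact mem_topSpan_of_mem_cellsOver (B := ∅) (B' := ∅) (by simp) (by simpa using hx)
        (by simpa using hx)
    · rw [map_zero]
      funext w
      exact (hv w (Finset.notMem_empty w)).symm
  | succ n ih =>
    obtain ⟨w, hwB, hmin⟩ := B.exists_minimalFor F.height (Finset.card_pos.1 (by omega))
    set B' := B.erase w with hB'
    have hBB' : (B : Set W) = insert w (B' : Set W) := by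
      rw [hB', ← Finset.coe_insert, Finset.insert_erase hwB]
    have hwB' : ∀ u, F.height w < F.height u → u ∈ B' := fun u hu =>
      Finset.mem_erase.2 ⟨by rintro rfl; exact lt_irrefl _ hu, hB w hwB u hu⟩
    have hB'up : ∀ u ∈ B', ∀ u', F.height u < F.height u' → u' ∈ B' := fun u hu u' h =>
      hwB' u' ((le_of_not_gt fun h' => absurd (hmin (Finset.mem_of_mem_erase hu) h'.le)
        (not_le.2 h')).trans_lt h)
    have hdisj : Disjoint ({w} : Set W) (B' : Set W) := by simp [hB']
    have hdB' : ∀ z ∈ supported (ZMod 2) (ZMod 2) (F.cellsOver (B' : Set W)),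
        F.differential ∅ z ∈ supported (ZMod 2) (ZMod 2) (F.cellsOver (B' : Set W)) := by
      intro z hz
      refine cellChain_induction (p := fun z => F.differential ∅ z ∈ supported (ZMod 2) (ZMod 2)
        (F.cellsOver (B' : Set W))) hz (by simp)
        (fun a b ha hb => by rw [map_add]; exact add_mem ha hb) (fun _ => by simp) fun t ht => ?_
      have ht' : t.topVertex ∈ B' := by simpa using coe_mem_cellsOver.1 ht
      refine supported_mono (fun q hq t' e => ?_) (differential_single_mem (t : WithTop F.Cell))
      subst e
      have hle := (Cell.le_iff.1 (WithTop.coe_le_coe.1 hq.1)).1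
      rcases Cell.topVertex_eq_or_height_lt hle with h | h
      · rw [← h]; exact ht'
      · exact hB'up _ ht' _ h
    rw [hBB'] at hx
    obtain ⟨xw, hxw, x', hx', rfl⟩ := Submodule.mem_sup.1 (supported_cellsOver_insert w _ hx)
    obtain ⟨η⟩ := ‹Nonempty E›
    have hrel := differential_add_differential_mem (B := (B' : Set W))
      (fun u hu => by simpa using hwB' u hu) hxw
    have hdw : F.differential (F.lowerFacets w) xw ∈
        supported (ZMod 2) (ZMod 2) (F.cellsOver (B' : Set W)) := by
      have h1 : F.differential ∅ xw ∈ supported (ZMod 2) (ZMod 2) (F.cellsOver (B' : Set W)) := by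
        have := sub_mem (topSpan_le_cellsOver (B' : Set W) hdx) (hdB' x' hx')
        rwa [map_add, add_sub_cancel_right] at this
      have := sub_mem hrel h1
      rwa [add_sub_cancel_left] at this
    have hdw' : F.differential (F.lowerFacets w) xw ∈
        supported (ZMod 2) (ZMod 2) (F.cellsOver {w}) := by
      rw [← relStar_vertexFacets w η] at hxw ⊢
      exact differential_mem_relStar hxw
    have hΨw : F.toVertices xw w = 0 := by
      have := congrFun hΨ w
      rwa [map_add, Pi.add_apply, toVertices_eq_zero hx' (w := w) (by simp [hB']), add_zero]
        at this
    -- This chain lies over `w` and over the higher vertices at once, so only the augmentation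
    -- generator can occur in it; its coefficient is the value of `toVertices` at `w`, which
    -- vanishes.
    have hdw0 : F.differential (F.lowerFacets w) xw = 0 := by
      obtain ⟨c, hc⟩ := Submodule.mem_span_singleton.1
        (mem_topSpan_of_mem_cellsOver hdisj hdw' hdw)
      have h1 := differential_lowerFacets_top hxw
      rw [hΨw, ← hc] at h1
      have hc0 : c = 0 := by simpa [topChain] using h1
      rw [← hc, hc0, zero_smul]
    have hacyc := acyclicOn_relStar (isFace_vertexFacets (F := F) w)
      (FacetColoring.lowerFacets_subset w) η
    rw [relStar_vertexFacets] at hacyc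
    obtain ⟨y₀, hy₀, hdy₀⟩ := hacyc xw hxw hdw0
    have hlow : F.cellChain (F.lowerFacets w) η ∈
        supported (ZMod 2) (ZMod 2) (F.cellsOver {w}) := by
      rw [← relStar_vertexFacets w η]
      exact cellChain_mem_relStar subset_rfl (lowerFacets_subset w) (Rel.refl _ _)
    -- A multiple of a lowest cell over `w` corrects the value at `w` to `v w`. Its relative
    -- differential is just a multiple of the top generator, so it does no harm to the solution
    -- `y₀`.
    set μ := v w + F.toVertices y₀ w with hμ
    set y := y₀ + μ • F.cellChain (F.lowerFacets w) η with hydef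
    have hy : y ∈ supported (ZMod 2) (ZMod 2) (F.cellsOver {w}) :=
      add_mem hy₀ (Submodule.smul_mem _ _ hlow)
    have hyw : F.toVertices y w = v w := by
      rw [hydef, map_add, map_smul, Pi.add_apply, Pi.smul_apply,
        toVertices_cellChain (isFace_lowerFacets w), if_pos rfl, smul_eq_mul, mul_one, hμ,
        add_comm, add_assoc, ZModModule.add_self, add_zero]
    have hdy : F.differential (F.lowerFacets w) y = xw + μ • F.topChain := by
      rw [hydef, map_add, map_smul, hdy₀, differential_cellChain _ (isFace_lowerFacets w),
        if_pos rfl, Finset.sdiff_self, Finset.sum_empty, add_zero]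
    have hx1 : xw + x' + F.differential ∅ y ∈
        supported (ZMod 2) (ZMod 2) (F.cellsOver (B' : Set W)) := by
      have h1 := differential_add_differential_mem (B := (B' : Set W))
        (fun u hu => by simpa using hwB' u hu) hy
      rw [hdy] at h1
      have h2 := add_mem (add_mem h1 hx')
        (Submodule.smul_mem _ μ (topChain_mem_cellsOver (F := F) (B' : Set W)))
      convert h2 using 1
      rw [show F.differential ∅ y + (xw + μ • F.topChain) + x' + μ • F.topChain =
        xw + x' + F.differential ∅ y + (μ • F.topChain + μ • F.topChain) by abel,
        ZModModule.add_self, add_zero]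
    have hyB : ∀ u, u ≠ w → F.toVertices y u = 0 := fun u hu =>
      toVertices_eq_zero hy (by simpa using hu)
    obtain ⟨y₁, hy₁, hdy₁, hΨ₁⟩ := ih B' hB'up hx1
      (by rw [map_add, differential_differential, add_zero]; exact hdx)
      (by rw [map_add, toVertices_differential, add_zero]; exact hΨ)
      (v := v + F.toVertices y) (fun u hu => by
        by_cases huw : u = w
        · subst huw
          rw [Pi.add_apply, hyw, ZModModule.add_self]
        · rw [Pi.add_apply, hyB u huw, add_zero]
          exact hv u fun h => hu (Finset.mem_erase.2 ⟨huw, h⟩))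
      (by rw [hB', Finset.card_erase_of_mem hwB, hn]; rfl)
    refine ⟨y + y₁, add_mem ?_ ?_, ?_, ?_⟩
    · refine supported_mono (fun q hq t e => ?_) hy
      rw [hBB', hq t e]
      exact Set.mem_insert _ _
    · refine supported_mono (fun q hq t e => ?_) hy₁
      rw [hBB']
      exact Set.mem_insert_of_mem _ (hq t e)
    · rw [map_add, ← add_assoc]
      exact hdy₁
    · rw [map_add, hΨ₁, add_comm, add_assoc, ZModModule.add_self, add_zero]

/-! ### Homogeneous parts and the basis of cellular homology -/

variable (F) in
/-- The part of a chain of cells in a given degree. -/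
def cellDegreePart (n : ℕ) : F.CellChain →ₗ[ZMod 2] F.CellChain :=
  linearCombination (ZMod 2) fun q => if F.cellDegree q = n then single q 1 else 0

omit [Finite I] [Fintype I] [Finite W] in
lemma cellDegreePart_single (n : ℕ) (q : WithTop F.Cell) :
    F.cellDegreePart n (single q 1) = if F.cellDegree q = n then single q 1 else 0 := by
  rw [cellDegreePart, linearCombination_single, one_smul]

omit [Finite I] [Fintype I] [Finite W] in
lemma cellDegreePart_of_mem {m n : ℕ} {x : F.CellChain}
    (hx : x ∈ supported (ZMod 2) (ZMod 2) {q | F.cellDegree q = m}) :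
    F.cellDegreePart n x = if m = n then x else 0 := by
  have : F.cellDegreePart n x =
      (if m = n then LinearMap.id else 0 : F.CellChain →ₗ[ZMod 2] F.CellChain) x :=
    SingularModTwo.linearMap_eqOn_supported (fun q hq => by
      rw [cellDegreePart_single, show F.cellDegree q = m from hq]
      split_ifs <;> rfl) hx
  rw [this]
  split_ifs <;> rfl

omit [Finite I] [Fintype I] [Finite W] in
lemma cellDegreePart_differential (n : ℕ) (x : F.CellChain) :
    F.cellDegreePart n (F.differential ∅ x) =
      F.differential ∅ (F.cellDegreePart (n + 1) x) := by
  suffices h : ∀ q, F.cellDegreePart n (F.differential ∅ (single q 1)) =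
      F.differential ∅ (F.cellDegreePart (n + 1) (single q 1)) by
    have := cellChain_induction (U := Set.univ) (x := x) (p := fun x =>
      F.cellDegreePart n (F.differential ∅ x) = F.differential ∅ (F.cellDegreePart (n + 1) x))
      (by simp) (by simp) (fun a b ha hb => by simp only [map_add, ha, hb])
      (fun _ => h _) (fun t _ => h _)
    exact this
  intro q
  rw [cellDegreePart_single]
  by_cases hq : F.cellDegree q = 0
  · rw [(cellDegree_eq_zero_iff q).1 hq]
    have : F.differential ∅ (single ⊤ 1) = 0 := differential_topChain ∅
    rw [this]
    simp
  · obtain ⟨m, hm⟩ := Nat.exists_eq_succ_of_ne_zero hq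
    rw [cellDegreePart_of_mem (m := m) (supported_mono (fun q' hq' => by
      have := hq'.2
      simp only [Set.mem_ofPred_eq]
      omega) (differential_single_mem q)), hm]
    by_cases h : m = n
    · simp [h]
    · simp [h]

omit [Finite I] [Finite W] in
lemma toVertices_cellDegreePart (n : ℕ) (x : F.CellChain) (w : W) :
    F.toVertices (F.cellDegreePart n x) w =
      if (F.lowerFacets w).card + 1 = n then F.toVertices x w else 0 := by
  refine cellChain_induction (U := Set.univ) (p := fun x => F.toVertices (F.cellDegreePart n x) w =
      if (F.lowerFacets w).card + 1 = n then F.toVertices x w else 0) (by simp) (by simp)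
    (fun a b ha hb => ?_) (fun _ => ?_) fun t _ => ?_
  · rw [map_add, map_add, Pi.add_apply, ha, hb, map_add, Pi.add_apply]
    split_ifs <;> simp
  · rw [topChain, cellDegreePart_single]
    change F.toVertices (if _ then F.topChain else 0) w = if _ then F.toVertices F.topChain w else 0
    split_ifs <;> simp
  · rw [cellDegreePart_single, cellDegree_coe]
    by_cases h : t.facets = F.lowerFacets w
    · rw [h]
      split_ifs <;> simp
    · have h0 : F.toVertices (single (t : WithTop F.Cell) 1) w = 0 := by
        rw [toVertices_coe, if_neg h]
      rw [h0]
      split_ifs <;> simp [h0]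

omit [Finite I] [Fintype I] [Finite W] in
lemma cellDegreePart_mem_topSpan (n : ℕ) {x : F.CellChain} (hx : x ∈ F.topSpan) :
    F.cellDegreePart n x ∈ F.topSpan := by
  obtain ⟨c, rfl⟩ := Submodule.mem_span_singleton.1 hx
  rw [map_smul, topChain, cellDegreePart_single]
  refine Submodule.smul_mem _ _ ?_
  split_ifs
  · exact Submodule.mem_span_singleton_self _
  · exact zero_mem _

omit [Finite I] [Fintype I] [Finite W] in
lemma cellDegreePart_cellDegreePart (n : ℕ) (x : F.CellChain) :
    F.cellDegreePart n (F.cellDegreePart n x) = F.cellDegreePart n x := by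
  suffices h : ∀ q, F.cellDegreePart n (F.cellDegreePart n (single q 1)) =
      F.cellDegreePart n (single q 1) by
    have := cellChain_induction (U := Set.univ) (x := x) (p := fun x =>
      F.cellDegreePart n (F.cellDegreePart n x) = F.cellDegreePart n x)
      (by simp) (by simp) (fun a b ha hb => by simp only [map_add, ha, hb])
      (fun _ => h _) (fun t _ => h _)
    exact this
  intro q
  rw [cellDegreePart_single]
  split_ifs with h
  · rw [cellDegreePart_single, if_pos h]
  · simp

variable (F) in
/-- The homology of the complex of cells: cycles that correspond to the vertices. -/
theorem exists_vertex_cycles [Nonempty E] :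
    ∃ z : W → F.CellChain,
      (∀ w, F.cellDegreePart ((F.lowerFacets w).card + 1) (z w) = z w) ∧
      (∀ w, F.differential ∅ (z w) ∈ F.topSpan) ∧
      (∀ w, F.toVertices (z w) = Pi.single w 1) ∧
      ∀ x, F.differential ∅ x ∈ F.topSpan → F.toVertices x = 0 →
        ∃ y, x + F.differential ∅ y ∈ F.topSpan := by
  have := Fintype.ofFinite W
  have key : ∀ (x : F.CellChain) (v : W → ZMod 2), F.differential ∅ x ∈ F.topSpan →
      F.toVertices x = 0 → ∃ y, x + F.differential ∅ y ∈ F.topSpan ∧ F.toVertices y = v := by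
    intro x v h1 h2
    obtain ⟨y, -, hy⟩ := exists_add_differential_mem_topSpan (F := F) Finset.univ (by simp)
      (x := x) (v := v) (fun q _ t _ => by simp) h1 h2 (by simp)
    exact ⟨y, hy⟩
  have hz : ∀ w, ∃ z, F.differential ∅ z ∈ F.topSpan ∧ F.toVertices z = Pi.single w 1 := by
    intro w
    obtain ⟨y, h1, h2⟩ := key 0 (Pi.single w 1) (by simp) (by simp)
    exact ⟨y, by simpa using h1, h2⟩
  choose z hz1 hz2 using hz
  -- The cycle for `w` is cut down to the degree of the lowest cells over `w`, which is all that the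
  -- value at `w` depends on.
  refine ⟨fun w => F.cellDegreePart ((F.lowerFacets w).card + 1) (z w),
    fun w => cellDegreePart_cellDegreePart _ _, fun w => ?_, fun w => ?_, fun x h1 h2 => ?_⟩
  · rw [← cellDegreePart_differential]
    exact cellDegreePart_mem_topSpan _ (hz1 w)
  · funext u
    rw [toVertices_cellDegreePart, hz2]
    by_cases h : u = w
    · simp [h]
    · simp [h]
  · obtain ⟨y, hy, -⟩ := key x 0 h1 h2
    exact ⟨y, hy⟩

end TopVertex

end FacetColoring

end

open Finsupp

noncomputable section

/-! ### Spaces glued from copies of a polytope -/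

namespace FacetColoring

open scoped Classical

/-- A space glued from copies of a polytope, indexed by `E`, along the facets: a copy is glued to
another one along a facet if the involution of the facet interchanges them. -/
structure Realization {I W Φ E : Type*} [Fintype Φ] [TopologicalSpace E]
    (F : FacetColoring I W Φ E) (X H : Type*) [TopologicalSpace X] [AddCommGroup H] [Module ℝ H]
    [TopologicalSpace H] where
  /-- The polytope. -/
  polytope : Set H
  convex_polytope : Convex ℝ polytope
  /-- The linear form that defines a facet. -/
  form : Φ → H →L[ℝ] ℝ
  /-- The value of the linear form on the facet. -/
  bound : Φ → ℝ
  form_le : ∀ a, ∀ q ∈ polytope, form a q ≤ bound a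
  isFace : ∀ q ∈ polytope, F.IsFace (Finset.univ.filter fun a => form a q = bound a)
  exists_point : ∀ S, F.IsFace S →
    ∃ q ∈ polytope, (Finset.univ.filter fun a => form a q = bound a) = S
  /-- The projection of the disjoint union of the polytopes to the glued space. -/
  proj : E × polytope → X
  isQuotientMap_proj : Topology.IsQuotientMap proj
  proj_eq_iff : ∀ η q η' q', proj (η, q) = proj (η', q') ↔
    q = q' ∧ F.Rel (Finset.univ.filter fun a => form a (q : H) = bound a) η η'

/-! ### Open stars in the glued space -/

namespace Realization

variable {I W Φ E : Type*} [Fintype Φ] [TopologicalSpace E] {F : FacetColoring I W Φ E}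
  {X H : Type*} [TopologicalSpace X] [AddCommGroup H] [Module ℝ H] [TopologicalSpace H]
  (R : F.Realization X H)

/-- The facets through a point. -/
def facetsAt (q : H) : Finset Φ := Finset.univ.filter fun a => R.form a q = R.bound a

lemma mem_facetsAt {q : H} {a : Φ} : a ∈ R.facetsAt q ↔ R.form a q = R.bound a := by
  simp [facetsAt]

lemma isFace_facetsAt (q : R.polytope) : F.IsFace (R.facetsAt q) := R.isFace q q.2

/-- The cell that contains a point of the glued space. -/
def cellOf (x : X) : F.Cell :=
  Cell.mk F (R.facetsAt (Function.surjInv R.isQuotientMap_proj.surjective x).2)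
    (R.isFace_facetsAt _) (Function.surjInv R.isQuotientMap_proj.surjective x).1

lemma cellOf_proj (η : E) (q : R.polytope) :
    R.cellOf (R.proj (η, q)) = Cell.mk F (R.facetsAt q) (R.isFace_facetsAt q) η := by
  have h := Function.surjInv_eq R.isQuotientMap_proj.surjective (R.proj (η, q))
  set z := Function.surjInv R.isQuotientMap_proj.surjective (R.proj (η, q)) with hz
  obtain ⟨h1, h2⟩ := (R.proj_eq_iff z.1 z.2 η q).1 h
  have hf : R.facetsAt z.2 = R.facetsAt q := by rw [h1]
  refine Cell.ext_of_rel hf ?_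
  exact (Cell.rel_mk_sign _ _ _).trans (h2.trans
    ((Cell.rel_mk_sign _ (R.isFace_facetsAt q) η).symm.mono hf.ge))

lemma le_cellOf_proj_iff (t : F.Cell) (η : E) (q : R.polytope) :
    (t : WithTop F.Cell) ≤ (R.cellOf (R.proj (η, q)) : WithTop F.Cell) ↔
      R.facetsAt q ⊆ t.facets ∧ F.Rel t.facets t.sign η := by
  rw [WithTop.coe_le_coe, Cell.le_iff, cellOf_proj, Cell.mk_facets]
  refine and_congr_right fun h => ?_
  have := (Cell.rel_mk_sign _ (R.isFace_facetsAt q) η).mono h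
  exact ⟨fun h' => h'.trans this, fun h' => h'.trans this.symm⟩

/-- The open star of a cell. -/
def star (t : F.Cell) : Set X := {x | (t : WithTop F.Cell) ≤ (R.cellOf x : WithTop F.Cell)}

lemma proj_mem_star_iff (t : F.Cell) (η : E) (q : R.polytope) :
    R.proj (η, q) ∈ R.star t ↔ R.facetsAt q ⊆ t.facets ∧ F.Rel t.facets t.sign η :=
  R.le_cellOf_proj_iff t η q

/-- The preimage in each copy is empty or the polytope with the facets not containing the cell
removed. -/
lemma isOpen_star [DiscreteTopology E] (t : F.Cell) : IsOpen (R.star t) := by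
  rw [← R.isQuotientMap_proj.isOpen_preimage]
  have : R.proj ⁻¹' R.star t = {η | F.Rel t.facets t.sign η} ×ˢ
      {q : R.polytope | ∀ a ∈ (t.facets : Set Φ)ᶜ, R.form a q < R.bound a} := by
    ext ⟨η, q⟩
    rw [Set.mem_preimage, proj_mem_star_iff, Set.mem_prod, and_comm]
    refine and_congr_right fun _ => ⟨fun h a ha => ?_, fun h a ha => ?_⟩
    · exact (R.form_le a q q.2).lt_of_ne fun he => ha (h (R.mem_facetsAt.2 he))
    · by_contra hc
      exact (h a hc).ne (R.mem_facetsAt.1 ha)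
  rw [this]
  refine (isOpen_discrete _).prod ?_
  simp only [Set.ofPred_forall]
  exact isOpen_iInter_of_finite fun a => isOpen_iInter_of_finite fun _ =>
    isOpen_lt ((R.form a).continuous.comp continuous_subtype_val) continuous_const

/-- Every copy is moved along straight lines to a point `q₀` lying on exactly the facets of the
cell. No facet outside those of the cell is hit, so the motion stays in the star. Facets through the
starting point are never left, so points glued at the start remain glued. -/
lemma contractibleSpace_star [DiscreteTopology E] [IsTopologicalAddGroup H] [ContinuousSMul ℝ H]
    (t : F.Cell) : ContractibleSpace (R.star t) := by
  obtain ⟨q₀, hq₀, hS⟩ := R.exists_point t.facets t.isFace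
  replace hS : R.facetsAt q₀ = t.facets := hS
  have hmem : ∀ (s : unitInterval) (q : R.polytope),
      (1 - (s : ℝ)) • (q : H) + (s : ℝ) • q₀ ∈ R.polytope := fun s q =>
    R.convex_polytope q.2 hq₀ (by linarith [s.2.2]) s.2.1 (by ring)
  have hsub : ∀ (s : unitInterval) (q : R.polytope), R.facetsAt q ⊆ t.facets →
      R.facetsAt ((1 - (s : ℝ)) • (q : H) + (s : ℝ) • q₀) ⊆ t.facets := by
    intro s q hq a ha
    rw [mem_facetsAt, map_add, map_smul, map_smul, smul_eq_mul, smul_eq_mul] at ha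
    have h1 := R.form_le a q q.2
    have h2 := R.form_le a q₀ hq₀
    rcases s.2.1.eq_or_lt with hs | hs
    · rw [← hs] at ha
      exact hq (R.mem_facetsAt.2 (by linarith))
    · rw [← hS, mem_facetsAt]
      refine h2.antisymm (le_of_not_gt fun hlt => ?_)
      have h3 := mul_le_mul_of_nonneg_left h1 (sub_nonneg.2 s.2.2)
      have h4 := mul_lt_mul_of_pos_left hlt hs
      linarith
  have hsup : ∀ (s : unitInterval) (q : R.polytope), R.facetsAt q ⊆ t.facets →
      R.facetsAt q ⊆ R.facetsAt ((1 - (s : ℝ)) • (q : H) + (s : ℝ) • q₀) := by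
    intro s q hq a ha
    have h0 : R.form a q₀ = R.bound a := R.mem_facetsAt.1 (hS ▸ hq ha)
    rw [mem_facetsAt, map_add, map_smul, map_smul, smul_eq_mul, smul_eq_mul,
      R.mem_facetsAt.1 ha, h0]
    ring
  let move : unitInterval → E × R.polytope → E × R.polytope := fun s z =>
    (z.1, ⟨(1 - (s : ℝ)) • (z.2 : H) + (s : ℝ) • q₀, hmem s z.2⟩)
  have hmove : Continuous fun z : unitInterval × (E × R.polytope) => move z.1 z.2 := by fun_prop
  have hstar : ∀ s z, R.proj z ∈ R.star t → R.proj (move s z) ∈ R.star t := fun s z hz => by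
    obtain ⟨h1, h2⟩ := (R.proj_mem_star_iff t z.1 z.2).1 hz
    exact (R.proj_mem_star_iff t _ _).2 ⟨hsub s z.2 h1, h2⟩
  have hcongr : ∀ s z z', R.proj z ∈ R.star t → R.proj z = R.proj z' →
      R.proj (move s z) = R.proj (move s z') := by
    rintro s ⟨η, q⟩ ⟨η', q'⟩ hz h
    obtain ⟨rfl, h2⟩ := (R.proj_eq_iff η q η' q').1 h
    exact (R.proj_eq_iff _ _ _ _).2
      ⟨rfl, h2.mono (hsup s q ((R.proj_mem_star_iff t η q).1 hz).1)⟩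
  -- The projection restricted to an open star is still a quotient map, so continuity of the
  -- contraction can be checked upstairs, also after taking the product with the interval.
  have hquot := R.isQuotientMap_proj.restrictPreimage_isOpen (R.isOpen_star t)
  let inv : R.star t → R.proj ⁻¹' R.star t := Function.surjInv hquot.surjective
  have hinv : ∀ x, R.proj (inv x).1 = x := fun x =>
    congrArg Subtype.val (Function.surjInv_eq hquot.surjective x)
  let G : unitInterval × R.star t → R.star t := fun y =>
    ⟨R.proj (move y.1 (inv y.2).1), hstar _ _ (inv y.2).2⟩
  have hG : Continuous G := by
    refine hquot.continuous_lift_prod_right ?_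
    have : (fun p : unitInterval × (R.proj ⁻¹' R.star t) =>
        G (p.1, (R.star t).restrictPreimage R.proj p.2)) =
        fun p => ⟨R.proj (move p.1 p.2.1), hstar _ _ p.2.2⟩ := by
      funext p
      refine Subtype.ext (hcongr _ _ _ (inv _).2 ?_)
      rw [hinv]
      rfl
    rw [this]
    refine Continuous.subtype_mk (R.isQuotientMap_proj.continuous.comp ?_) _
    exact hmove.comp (continuous_fst.prodMk (continuous_subtype_val.comp continuous_snd))
  have hbase : R.proj (t.sign, ⟨q₀, hq₀⟩) ∈ R.star t :=
    (R.proj_mem_star_iff t _ _).2 ⟨hS.le, Rel.refl _ _⟩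
  rw [contractible_iff_id_nullhomotopic]
  refine ⟨⟨_, hbase⟩, ⟨⟨⟨G, hG⟩, fun x => ?_, fun x => ?_⟩⟩⟩
  · refine Subtype.ext ?_
    have : move 0 (inv x).1 = (inv x).1 := by
      refine Prod.ext rfl (Subtype.ext ?_)
      simp [move]
    change R.proj (move 0 (inv x).1) = x
    rw [this, hinv]
  · refine Subtype.ext ?_
    change R.proj (move 1 (inv x).1) = R.proj (t.sign, ⟨q₀, hq₀⟩)
    have : move 1 (inv x).1 = ((inv x).1.1, ⟨q₀, hq₀⟩) := by
      refine Prod.ext rfl (Subtype.ext ?_)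
      simp [move]
    rw [this, R.proj_eq_iff]
    have h2 := ((R.proj_mem_star_iff t (inv x).1.1 (inv x).1.2).1 (inv x).2).2
    exact ⟨rfl, h2.symm.mono hS.ge⟩

/-! ### Singular homology of the glued space -/

open SingularModTwo in
/-- The singular homology of a glued space: there are cycles that correspond to the vertices of
the polytope and form a basis of the homology. -/
theorem exists_singular_cycles (R : F.Realization X H) [DiscreteTopology E]
    [IsTopologicalAddGroup H] [ContinuousSMul ℝ H] [Fintype I] [Fintype W] [Finite E] [Nonempty E] :
    ∃ c : W → Chain X,
      (∀ w, degreePart ((F.ascending w).ncard + 1) (c w) = c w) ∧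
      (∀ w, ∃ a : ZMod 2, boundary (c w) = a • of (emptySimplex X)) ∧
      (∀ (c' : Chain X) (a : ZMod 2), boundary c' = a • of (emptySimplex X) →
        ∃ (v : W → ZMod 2) (e : Chain X) (a' : ZMod 2),
          c' = ∑ w, v w • c w + boundary e + a' • of (emptySimplex X)) ∧
      ∀ (v : W → ZMod 2) (e : Chain X), ∑ w, v w • c w = boundary e → v = 0 := by
  obtain ⟨φ, hφ, hφtop, hφdeg, hcone⟩ := exists_carried_map (X := X) (deg := F.cellDegree)
    (d := F.differential ∅) (κ := fun x => (R.cellOf x : WithTop F.Cell))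
    cellDegree_eq_zero_iff differential_single_mem (differential_differential ∅)
    (fun q hq => by
      obtain ⟨t, rfl⟩ := WithTop.ne_top_iff_exists.1 hq
      have := R.contractibleSpace_star t
      exact fun c hc h => exists_boundary_eq_of_contractible (A := R.star t) hc h)
    (fun x => WithTop.coe_ne_top)
    (fun q => by
      induction q using WithTop.recTopCoe with
      | top =>
        have : (fun x => (R.cellOf x : WithTop F.Cell)) ⁻¹' Set.Ici ⊤ = ∅ := by ext; simp
        rw [this]
        exact isOpen_empty
      | coe t => exact R.isOpen_star t)
    (fun q hq => acyclicOn_Ici hq)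
  obtain ⟨z, hz1, hz2, hz3, hz4⟩ := exists_vertex_cycles F
  have hφtop' : φ F.topChain = of (emptySimplex X) := hφtop
  have hφpart : ∀ n x, φ (F.cellDegreePart n x) = degreePart n (φ x) := by
    intro n x
    have := cellChain_induction (F := F) (U := Set.univ) (x := x) (p := fun x =>
      φ (F.cellDegreePart n x) = degreePart n (φ x)) (by simp) (by simp)
      (fun a b ha hb => by simp only [map_add, ha, hb])
    have hq : ∀ q, φ (F.cellDegreePart n (single q 1)) = degreePart n (φ (single q 1)) := by
      intro q
      rw [cellDegreePart_single, ← hφdeg q, degreePart_degreePart]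
      split_ifs with h
      · exact (hφdeg q).symm
      · simp
    exact this (fun _ => hq _) fun t _ => hq _
  have hsum : ∀ v : W → ZMod 2, F.toVertices (∑ w, v w • z w) = v := by
    intro v
    rw [map_sum]
    simp only [map_smul, hz3]
    funext u
    simp [Finset.sum_apply, Pi.single_apply]
  have hdsum : ∀ v : W → ZMod 2, F.differential ∅ (∑ w, v w • z w) ∈ F.topSpan := by
    intro v
    rw [map_sum]
    exact sum_mem fun w _ => by rw [map_smul]; exact Submodule.smul_mem _ _ (hz2 w)
  refine ⟨fun w => φ (z w), fun w => ?_, fun w => ?_, fun c' a hc' => ?_, fun v e h => ?_⟩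
  · rw [← card_lowerFacets, ← hφpart, hz1]
  · obtain ⟨a, ha⟩ := Submodule.mem_span_singleton.1 (hz2 w)
    exact ⟨a, by rw [hφ, ← ha, map_smul, hφtop']⟩
  · obtain ⟨e, y, he, hy⟩ := hcone c' (a • F.topChain) (by rw [map_smul, hφtop', hc'])
      (by simp)
    have hdy : F.differential ∅ y ∈ F.topSpan :=
      hy ▸ Submodule.smul_mem _ _ (Submodule.mem_span_singleton_self _)
    -- Subtracting the vertex cycles with the same values leaves a cellular cycle on which
    -- `toVertices` vanishes; such a cycle is a boundary up to the augmentation.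
    obtain ⟨y', hy'⟩ := hz4 (y + ∑ w, F.toVertices y w • z w)
      (by rw [map_add]; exact add_mem hdy (hdsum _))
      (by rw [map_add, hsum, ZModModule.add_self])
    obtain ⟨a', ha'⟩ := Submodule.mem_span_singleton.1 hy'
    refine ⟨F.toVertices y, e + φ y', a', ?_⟩
    have h1 := congrArg φ ha'
    rw [map_smul, hφtop', map_add, map_add, map_sum, ← hφ] at h1
    simp only [map_smul] at h1
    rw [h1, he, map_add]
    generalize ∑ w, F.toVertices y w • φ (z w) = s
    generalize boundary (φ y') = r
    rw [show s + (boundary e + r) + (φ y + s + r) = boundary e + φ y + (s + s) + (r + r) by abel,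
      ZModModule.add_self, ZModModule.add_self, add_zero, add_zero]
  · set x := ∑ w, v w • z w with hx
    have hxe : boundary e = φ x := by rw [← h, hx, map_sum]; simp only [map_smul]
    -- The differential of `x` is a multiple of the top generator, and `φ` maps that generator to
    -- the nonzero empty simplex. As `φ x` is a boundary, the multiple is zero.
    have hdx : F.differential ∅ x = 0 := by
      obtain ⟨a, ha⟩ := Submodule.mem_span_singleton.1 (hdsum v)
      have h1 : φ (F.differential ∅ x) = 0 := by rw [← hφ, ← hxe, boundary_boundary]
      rw [← ha, map_smul, hφtop', smul_eq_zero] at h1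
      rw [← ha, h1.resolve_right (of_ne_zero _), zero_smul]
    obtain ⟨e', y, -, hy⟩ := hcone e x hxe hdx
    rw [← hsum v, ← hx, hy, toVertices_differential]

end Realization

end FacetColoring

end

open Finsupp

noncomputable section

namespace SingularModTwo

universe v

open CategoryTheory

/-! ### The comparison with the singular chain complex -/

/-- The rank of the homology of a complex of vector spaces from a basis given by cycles. -/
lemma rank_homology_eq_card (S : ShortComplex (ModuleCat.{v} (ZMod 2))) {J : Type*} [Fintype J]
    (c : J → S.X₂) (hc : ∀ j, S.g (c j) = 0)
    (hspan : ∀ x, S.g x = 0 → ∃ (a : J → ZMod 2) (e : S.X₁), x = ∑ j, a j • c j + S.f e)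
    (hind : ∀ (a : J → ZMod 2) (e : S.X₁), ∑ j, a j • c j = S.f e → a = 0) :
    Module.rank (ZMod 2) S.homology = Fintype.card J := by
  rw [S.moduleCatHomologyIso.toLinearEquiv.rank_eq]
  let N := LinearMap.range S.moduleCatToCycles
  let b : J → LinearMap.ker S.g.hom ⧸ N := fun j => N.mkQ ⟨c j, hc j⟩
  have hsum : ∀ a : J → ZMod 2, ∑ j, a j • b j = N.mkQ (∑ j, a j • ⟨c j, hc j⟩) := fun a => by
    rw [map_sum]; rfl
  have hcoe : ∀ a : J → ZMod 2, ((∑ j, a j • ⟨c j, hc j⟩ : LinearMap.ker S.g.hom) : S.X₂) =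
      ∑ j, a j • c j := fun a => by simp
  have hli : LinearIndependent (ZMod 2) b := by
    rw [Fintype.linearIndependent_iff]
    intro a ha
    rw [hsum, Submodule.mkQ_apply, Submodule.Quotient.mk_eq_zero] at ha
    obtain ⟨e, he⟩ := ha
    have := congrArg Subtype.val he
    rw [hcoe] at this
    exact congrFun (hind a e this.symm)
  have hsp : ⊤ ≤ Submodule.span (ZMod 2) (Set.range b) := by
    rintro y -
    obtain ⟨⟨x, hx⟩, rfl⟩ := N.mkQ_surjective y
    obtain ⟨a, e, h⟩ := hspan x hx
    have : N.mkQ ⟨x, hx⟩ = ∑ j, a j • b j := by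
      rw [hsum, ← sub_eq_zero, ← map_sub, Submodule.mkQ_apply, Submodule.Quotient.mk_eq_zero]
      refine ⟨e, Subtype.ext ?_⟩
      rw [Submodule.coe_sub, hcoe]
      change S.f e = x - _
      rw [h, add_sub_cancel_left]
    rw [this]
    exact sum_mem fun j _ => Submodule.smul_mem _ _ (Submodule.subset_span ⟨j, rfl⟩)
  exact rank_eq_card_basis (Module.Basis.mk hli hsp)

/-- The coefficients. -/
abbrev coeff : ModuleCat.{v} (ZMod 2) := ModuleCat.of (ZMod 2) (ULift.{v} (ZMod 2))

variable (X : Type v) [TopologicalSpace X]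

/-- The singular chain complex. -/
abbrev singularComplex : ChainComplex (ModuleCat.{v} (ZMod 2)) ℕ :=
  (TopCat.toSSet.obj (TopCat.of X)).chainComplex coeff

variable {X}

open Simplicial

/-- A singular simplex as a continuous map. -/
def toMap {n : ℕ} (x : TopCat.toSSet.obj (TopCat.of X) _⦋n⦌) : C(Simplex (n + 1), X) :=
  TopCat.toSSetObjEquiv (TopCat.of X) _ x

/-- A continuous map as a singular simplex. -/
def ofMap {n : ℕ} (σ : C(Simplex (n + 1), X)) : TopCat.toSSet.obj (TopCat.of X) _⦋n⦌ :=
  (TopCat.toSSetObjEquiv (TopCat.of X) (Opposite.op ⦋n⦌)).symm σ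

lemma toMap_ofMap {n : ℕ} (σ : C(Simplex (n + 1), X)) : toMap (ofMap σ) = σ :=
  Equiv.apply_symm_apply _ _

lemma ofMap_toMap {n : ℕ} (x : TopCat.toSSet.obj (TopCat.of X) _⦋n⦌) : ofMap (toMap x) = x :=
  Equiv.symm_apply_apply _ _

lemma toMap_δ {n : ℕ} (x : TopCat.toSSet.obj (TopCat.of X) _⦋n + 1⦌) (i : Fin (n + 2)) :
    toMap ((TopCat.toSSet.obj (TopCat.of X)).δ i x) = (toMap x).comp (face i) := by
  ext1 z
  exact TopCat.toSSetObjEquiv_δ_apply x i z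

/-- The generator of the singular chain complex of a singular simplex. -/
def gen {n : ℕ} (x : TopCat.toSSet.obj (TopCat.of X) _⦋n⦌) : (singularComplex X).X n :=
  SSet.ιChainComplex (R := coeff) _ x (ULift.up (1 : ZMod 2))

lemma singularComplex_hom_ext {n : ℕ} {M : Type v} [AddCommGroup M] [Module (ZMod 2) M]
    {f g : (singularComplex X).X n →ₗ[ZMod 2] M} (h : ∀ x, f (gen x) = g (gen x)) : f = g := by
  have : ModuleCat.ofHom f = ModuleCat.ofHom g := by
    refine SSet.chainComplex_hom_ext fun x => ?_
    ext a
    have ha : a = a.down • (ULift.up 1 : ULift.{v} (ZMod 2)) :=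
      ULift.ext _ _ (by simp)
    rw [ha, map_smul, map_smul]
    exact congrArg (a.down • ·) (h x)
  exact congrArg ModuleCat.Hom.hom this

lemma d_gen {n : ℕ} (x : TopCat.toSSet.obj (TopCat.of X) _⦋n + 1⦌) :
    (singularComplex X).d (n + 1) n (gen x) =
      ∑ i : Fin (n + 2), gen ((TopCat.toSSet.obj (TopCat.of X)).δ i x) := by
  have h := SSet.ιChainComplex_d (TopCat.toSSet.obj (TopCat.of X)) (coeff : ModuleCat.{v} _) x
  have h' := congrArg (fun f => f.hom (ULift.up (1 : ZMod 2))) h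
  rw [ModuleCat.hom_sum, LinearMap.sum_apply] at h'
  refine h'.trans (Finset.sum_congr rfl fun i _ => ?_)
  -- The alternating signs disappear modulo two.
  rcases neg_one_pow_eq_or ℤ i.val with hi | hi
  · rw [hi, one_smul]
    rfl
  · rw [hi, neg_smul, one_smul, ModuleCat.hom_neg, LinearMap.neg_apply, ZModModule.neg_eq_self]
    rfl

/-- The comparison map to the chains. -/
def toChain (n : ℕ) : (singularComplex X).X n →ₗ[ZMod 2] Chain X :=
  ((SSet.isColimitChainComplexXCofan (TopCat.toSSet.obj (TopCat.of X)) coeff n).desc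
    (Limits.Cofan.mk (ModuleCat.of (ZMod 2) (Chain X)) fun x =>
      ModuleCat.ofHom ((LinearMap.toSpanSingleton (ZMod 2) _ (of (toMap x))).comp
        ULift.moduleEquiv.toLinearMap))).hom

lemma toChain_gen {n : ℕ} (x : TopCat.toSSet.obj (TopCat.of X) _⦋n⦌) :
    toChain n (gen x) = of (toMap x) := by
  have h := (SSet.isColimitChainComplexXCofan (TopCat.toSSet.obj (TopCat.of X)) coeff n).fac
    (Limits.Cofan.mk (ModuleCat.of (ZMod 2) (Chain X)) fun x =>
      ModuleCat.ofHom ((LinearMap.toSpanSingleton (ZMod 2) _ (of (toMap x))).comp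
        ULift.moduleEquiv.toLinearMap)) ⟨x⟩
  have h' := congrArg (fun f => f.hom (ULift.up (1 : ZMod 2))) h
  refine Eq.trans h' ?_
  change (1 : ZMod 2) • of (toMap x) = _
  rw [one_smul]

/-- The value of the comparison map from the chains on a simplex. -/
def simpGen (n : ℕ) (s : Simp X) : (singularComplex X).X n :=
  if h : s.1 = n + 1 then gen (ofMap (h ▸ s.2)) else 0

/-- The comparison map from the chains. -/
def ofChain (n : ℕ) : Chain X →ₗ[ZMod 2] (singularComplex X).X n :=
  linearCombination (ZMod 2) (simpGen n)

lemma ofChain_of {n : ℕ} (σ : C(Simplex (n + 1), X)) : ofChain n (of σ) = gen (ofMap σ) := by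
  rw [ofChain, of, linearCombination_single, one_smul, simpGen, dif_pos rfl]

lemma ofChain_of_ne {m n : ℕ} (σ : C(Simplex m, X)) (h : m ≠ n + 1) : ofChain n (of σ) = 0 := by
  rw [ofChain, of, linearCombination_single, one_smul, simpGen, dif_neg h]

lemma ofChain_toChain {n : ℕ} (x : (singularComplex X).X n) : ofChain n (toChain n x) = x := by
  have : ofChain n ∘ₗ toChain (X := X) n = LinearMap.id := singularComplex_hom_ext fun x => by
    rw [LinearMap.comp_apply, toChain_gen, ofChain_of, ofMap_toMap]; rfl
  exact LinearMap.congr_fun this x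

lemma toChain_ofChain {n : ℕ} (c : Chain X) : toChain n (ofChain n c) = degreePart (n + 1) c := by
  have : toChain n ∘ₗ ofChain (X := X) n = degreePart (n + 1) := hom_ext fun m σ => by
    rw [LinearMap.comp_apply, degreePart_of]
    split_ifs with h
    · subst h
      rw [ofChain_of, toChain_gen, toMap_ofMap]
    · rw [ofChain_of_ne σ h, map_zero]
  exact LinearMap.congr_fun this c

lemma toChain_d {n : ℕ} (x : (singularComplex X).X (n + 1)) :
    toChain n ((singularComplex X).d (n + 1) n x) = boundary (toChain (n + 1) x) := by
  have : toChain n ∘ₗ ((singularComplex X).d (n + 1) n).hom =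
      boundary ∘ₗ toChain (X := X) (n + 1) :=
    singularComplex_hom_ext fun x => by
      rw [LinearMap.comp_apply, LinearMap.comp_apply, toChain_gen, boundary_of_succ]
      refine (congrArg (toChain n) (d_gen x)).trans ?_
      simp only [map_sum, toChain_gen, toMap_δ]
  exact LinearMap.congr_fun this x

lemma ofChain_degreePart {n : ℕ} (c : Chain X) :
    ofChain n (degreePart (n + 1) c) = ofChain n c := by
  rw [← toChain_ofChain, ofChain_toChain]

lemma ofChain_boundary {n : ℕ} (c : Chain X) :
    ofChain n (boundary c) = (singularComplex X).d (n + 1) n (ofChain (n + 1) c) := by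
  rw [← ofChain_degreePart, degreePart_boundary, ← toChain_ofChain (n := n + 1), ← toChain_d,
    ofChain_toChain]

lemma degreePart_toChain {n : ℕ} (x : (singularComplex X).X n) :
    degreePart (n + 1) (toChain n x) = toChain n x := by
  rw [← toChain_ofChain, ofChain_toChain]

lemma boundary_toChain_zero (x : (singularComplex X).X 0) :
    ∃ a : ZMod 2, boundary (toChain 0 x) = a • of (emptySimplex X) := by
  have h : degreePart 0 (boundary (toChain 0 x)) = boundary (toChain 0 x) := by
    rw [degreePart_boundary, degreePart_toChain]
  rw [← h]
  refine eq_smul_of_mem_chainsIn_empty ?_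
  have : ∀ c : Chain X, degreePart 0 c ∈ chainsIn (∅ : Set X) := fun c => by
    refine chainsIn_induction (A := Set.univ) (p := fun c => degreePart 0 c ∈ chainsIn (∅ : Set X))
      (by simp [chainsIn_univ]) (by simp) (fun a b ha hb => by rw [map_add]; exact add_mem ha hb)
      fun n σ _ => ?_
    rw [degreePart_of]
    split_ifs with h
    · subst h
      exact of_mem_chainsIn fun x => isEmptyElim x
    · exact zero_mem _
  exact this _

/-- Unreduced cycles have a uniform description in the augmented complex: in degree zero every
boundary is a multiple of the empty simplex, and in positive degrees such a multiple must vanish. -/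
lemma d_eq_zero_iff {k : ℕ} (x : (singularComplex X).X k) :
    (singularComplex X).d k ((ComplexShape.down ℕ).next k) x = 0 ↔
      ∃ a : ZMod 2, boundary (toChain k x) = a • of (emptySimplex X) := by
  cases k with
  | zero =>
    refine iff_of_true ?_ (boundary_toChain_zero x)
    rw [(singularComplex X).shape _ _ (by simp)]
    rfl
  | succ k =>
    rw [ChainComplex.next_nat_succ]
    constructor
    · intro h
      exact ⟨0, by rw [← toChain_d, h, map_zero, zero_smul]⟩
    · rintro ⟨a, ha⟩
      have h := ofChain_toChain ((singularComplex X).d (k + 1) k x)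
      rw [← h, toChain_d, ha, map_smul, ofChain_of_ne _ (by omega), smul_zero]

/-- The rank of singular homology from a basis of cycles. -/
theorem rank_homologyModTwo {J : Type*} [Fintype J] {deg : J → ℕ} {c : J → Chain X}
    (hdeg : ∀ j, degreePart (deg j + 1) (c j) = c j)
    (hc : ∀ j, ∃ a : ZMod 2, boundary (c j) = a • of (emptySimplex X))
    (hspan : ∀ (c' : Chain X) (a : ZMod 2), boundary c' = a • of (emptySimplex X) →
      ∃ (v : J → ZMod 2) (e : Chain X) (a' : ZMod 2),
        c' = ∑ j, v j • c j + boundary e + a' • of (emptySimplex X))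
    (hind : ∀ (v : J → ZMod 2) (e : Chain X), ∑ j, v j • c j = boundary e → v = 0) (k : ℕ) :
    Module.rank (ZMod 2) (TwistedTomei.HomologyModTwo k X) = Nat.card {j // deg j = k} := by
  classical
  rw [Nat.card_eq_fintype_card]
  have hpart : ∀ v : J → ZMod 2, degreePart (k + 1) (∑ j, v j • c j) =
      ∑ j : {j // deg j = k}, v j • c j := by
    intro v
    have h1 : ∀ j, degreePart (k + 1) (v j • c j) = if deg j = k then v j • c j else 0 := by
      intro j
      rw [map_smul, ← hdeg j, degreePart_degreePart]
      by_cases h : deg j = k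
      · simp [h]
      · simp [h]
    rw [map_sum, Finset.sum_congr rfl fun j _ => h1 j, ← Finset.sum_filter]
    exact Finset.sum_subtype _ (by simp) _
  have hempty : degreePart (k + 1) (of (emptySimplex X)) = 0 := by
    rw [degreePart_of, if_neg (by omega)]
  change Module.rank (ZMod 2) ((singularComplex X).sc k).homology = _
  rw [(ShortComplex.homologyMapIso ((singularComplex X).isoSc' (k + 1) k _
    (ChainComplex.prev ℕ k) rfl)).toLinearEquiv.rank_eq]
  refine rank_homology_eq_card _ (fun j : {j // deg j = k} => ofChain k (c j)) (fun j => ?_)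
    (fun (x : (singularComplex X).X k) hx => ?_)
    fun v (e : (singularComplex X).X (k + 1)) h => ?_
  · refine (d_eq_zero_iff _).2 ?_
    have hj := hdeg j.1
    rw [j.2] at hj
    rw [toChain_ofChain, hj]
    exact hc j
  · obtain ⟨a, ha⟩ := (d_eq_zero_iff x).1 hx
    obtain ⟨v, e, a', h⟩ := hspan _ a ha
    refine ⟨fun j => v j, ofChain (k + 1) e, ?_⟩
    have h1 := congrArg (degreePart (k + 1)) h
    rw [degreePart_toChain, map_add, map_add, map_smul, hempty, smul_zero, add_zero, hpart] at h1
    have h2 := congrArg (ofChain k) h1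
    rw [ofChain_toChain, map_add, map_sum, ofChain_degreePart, ofChain_boundary] at h2
    simp only [map_smul] at h2
    exact h2
  · replace h : ∑ j, v j • ofChain k (c j) = (singularComplex X).d (k + 1) k e := h
    have h1 := congrArg (toChain k) h
    rw [map_sum] at h1
    replace h1 := h1.trans (toChain_d e)
    simp only [map_smul, toChain_ofChain] at h1
    -- A relation in degree `k` is extended by zero to a relation among all the cycles.
    have h2 := hind (fun j => if h : deg j = k then v ⟨j, h⟩ else 0) (toChain (k + 1) e) (by
      rw [← h1]
      have h3 : ∀ j : J, (if h : deg j = k then v ⟨j, h⟩ else 0) • c j =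
          if h : deg j = k then v ⟨j, h⟩ • c j else 0 := fun j => by split_ifs <;> simp
      rw [Finset.sum_congr rfl fun j _ => h3 j, Finset.sum_dite, Finset.sum_const_zero, add_zero]
      refine Finset.sum_bij' (fun j _ => ⟨j.1, (Finset.mem_filter.1 j.2).2⟩)
        (fun j _ => ⟨j.1, Finset.mem_filter.2 ⟨Finset.mem_univ _, j.2⟩⟩) (by simp) (by simp)
        (by simp) (by simp) fun j _ => ?_
      have hj := hdeg j.1
      rw [(Finset.mem_filter.1 j.2).2] at hj
      rw [hj])
    funext j
    have := congrFun h2 j.1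
    rw [dif_pos j.2] at this
    exact this

end SingularModTwo

end

noncomputable section

namespace TwistedTomei

universe v

/-! ### The action of the Weyl group -/

section Action

variable {ι V H : Type v} [AddCommGroup V] [Module ℝ V] [AddCommGroup H] [Module ℝ H]
  {P : RootPairing ι ℝ V H}

/-- The pairing of roots with the Cartan subalgebra. -/
abbrev rootForm (P : RootPairing ι ℝ V H) (j : ι) : H →ₗ[ℝ] ℝ := P.toLinearMap (P.root j)

lemma toLinearMap_weylAct (w : P.weylGroup) (v : V) (x : H) :
    P.toLinearMap v (weylAct P w x) = P.toLinearMap (w⁻¹ • v) x := by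
  have := LinearMap.congr_fun (LinearMap.congr_fun
    ((w⁻¹ : P.weylGroup) : P.Aut).weight_coweight_transpose x) v
  exact this.symm

lemma rootForm_weylAct (w : P.weylGroup) (j : ι) (x : H) :
    rootForm P (P.weylGroupToPerm w j) (weylAct P w x) = rootForm P j x := by
  rw [rootForm, rootForm, toLinearMap_weylAct, ← RootPairing.weylGroup_apply_root, inv_smul_smul]

lemma weylAct_one (x : H) : weylAct P 1 x = x := by
  rw [weylAct, inv_one]
  exact one_smul _ x

lemma weylAct_mul (w w' : P.weylGroup) (x : H) :
    weylAct P (w * w') x = weylAct P w (weylAct P w' x) := by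
  rw [weylAct, weylAct, weylAct, mul_inv_rev, ← mul_smul, ← MulOpposite.op_mul]
  rfl

lemma weylAct_inv_weylAct (w : P.weylGroup) (x : H) : weylAct P w⁻¹ (weylAct P w x) = x := by
  rw [← weylAct_mul, inv_mul_cancel, weylAct_one]

lemma weylAct_weylAct_inv (w : P.weylGroup) (x : H) : weylAct P w (weylAct P w⁻¹ x) = x := by
  rw [← weylAct_mul, mul_inv_cancel, weylAct_one]

variable (P) in
/-- The action of a Weyl group element as a linear map. -/
def weylLin (w : P.weylGroup) : H →ₗ[ℝ] H where
  toFun := weylAct P w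
  map_add' x y := smul_add _ x y
  map_smul' r x := smul_comm _ r x

@[simp]
lemma weylLin_apply (w : P.weylGroup) (x : H) : weylLin P w x = weylAct P w x := rfl

lemma weylAct_coroot (w : P.weylGroup) (j : ι) :
    weylAct P w (P.coroot j) = P.coroot (P.weylGroupToPerm w j) := by
  have := RootPairing.Hom.coroot_coweightMap_apply P P j ((w⁻¹ : P.weylGroup) : P.Aut).toHom
  exact this

lemma weylAct_ofIdx (i : ι) (x : H) :
    weylAct P (RootPairing.weylGroup.ofIdx P i) x = x - rootForm P i x • P.coroot i := by
  have : (RootPairing.weylGroup.ofIdx P i)⁻¹ = RootPairing.weylGroup.ofIdx P i :=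
    Subtype.ext (RootPairing.Equiv.reflection_inv P i)
  rw [weylAct, this]
  rfl

lemma weylGroupToPerm_ofIdx (i : ι) :
    P.weylGroupToPerm (RootPairing.weylGroup.ofIdx P i) = P.reflectionPerm i := rfl

lemma ofIdx_mul_self (i : ι) :
    RootPairing.weylGroup.ofIdx P i * RootPairing.weylGroup.ofIdx P i = 1 := by
  have : (RootPairing.weylGroup.ofIdx P i)⁻¹ = RootPairing.weylGroup.ofIdx P i :=
    Subtype.ext (RootPairing.Equiv.reflection_inv P i)
  nth_rw 1 [← this]
  exact inv_mul_cancel _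

lemma weylGroup_ext {w w' : P.weylGroup} (h : ∀ v : V, w • v = w' • v) : w = w' := by
  apply Subtype.ext
  apply RootPairing.Equiv.weightHom_injective P
  ext v
  exact h v

lemma ofIdx_perm (w : P.weylGroup) (i : ι) :
    RootPairing.weylGroup.ofIdx P (P.weylGroupToPerm w i) =
      w * RootPairing.weylGroup.ofIdx P i * w⁻¹ := by
  refine weylGroup_ext fun v => ?_
  rw [mul_smul, mul_smul]
  change P.reflection (P.weylGroupToPerm w i) v = w • P.reflection i (w⁻¹ • v)
  rw [RootPairing.reflection_apply, RootPairing.reflection_apply, smul_sub, smul_inv_smul,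
    smul_comm w, RootPairing.weylGroup_apply_root]
  congr 2
  change P.toLinearMap v (P.coroot (P.weylGroupToPerm w i)) = P.toLinearMap (w⁻¹ • v) (P.coroot i)
  rw [← weylAct_coroot, toLinearMap_weylAct]

variable (P) in
lemma root_indexNeg (i : ι) :
    let := P.indexNeg
    P.root (-i) = -P.root i := by
  simp

variable (P) in
lemma coroot_indexNeg (i : ι) :
    let := P.indexNeg
    P.coroot (-i) = -P.coroot i := by
  simp

variable [P.IsRootSystem]

lemma weylGroupToPerm_injective : Function.Injective P.weylGroupToPerm := by
  intro w w' h
  refine weylGroup_ext fun v => ?_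
  have hv : v ∈ Submodule.span ℝ (Set.range P.root) := by
    have : Submodule.span ℝ (Set.range P.root) = ⊤ := RootPairing.IsRootSystem.span_root_eq_top
    rw [this]; trivial
  induction hv using Submodule.span_induction with
  | mem v h' =>
    obtain ⟨i, rfl⟩ := h'
    rw [RootPairing.weylGroup_apply_root, RootPairing.weylGroup_apply_root, h]
  | zero => rw [smul_zero, smul_zero]
  | add x y _ _ hx hy => rw [smul_add, smul_add, hx, hy]
  | smul r x _ hx => rw [smul_comm w, hx, smul_comm w']

instance finite_weylGroup [Finite ι] : Finite P.weylGroup :=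
  Finite.of_injective _ weylGroupToPerm_injective

end Action

/-! ### Lengths and positive roots -/

section Length

variable {ι V H : Type v} [Finite ι] [AddCommGroup V] [Module ℝ V] [AddCommGroup H] [Module ℝ H]
  {P : RootPairing ι ℝ V H} [P.IsCrystallographic] [P.IsReduced] (b : P.Base)


omit [Finite ι] [P.IsCrystallographic] [P.IsReduced] in
lemma simpleReflection_mul_self (i : b.support) :
    simpleReflection b i * simpleReflection b i = 1 :=
  ofIdx_mul_self _

omit [Finite ι] [P.IsCrystallographic] [P.IsReduced] in
lemma simpleReflection_inv (i : b.support) : (simpleReflection b i)⁻¹ = simpleReflection b i :=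
  inv_eq_of_mul_eq_one_left (simpleReflection_mul_self b i)

/-- Every root arises from simple roots by simple reflections, and the reflection in `w α` is the
conjugate by `w` of the reflection in `α`. -/
lemma closure_range_simpleReflection :
    Subgroup.closure (Set.range (simpleReflection b)) = ⊤ := by
  have key : ∀ i, RootPairing.weylGroup.ofIdx P i ∈
      Subgroup.closure (Set.range (simpleReflection b)) := by
    intro i
    refine b.induction_reflect i (p := fun i => RootPairing.weylGroup.ofIdx P i ∈
      Subgroup.closure (Set.range (simpleReflection b))) (fun i h => ?_) (fun i h => ?_)
      fun i j hi hj => ?_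
    · have := ofIdx_perm (RootPairing.weylGroup.ofIdx P i) i
      rw [weylGroupToPerm_ofIdx] at this
      rw [this]
      exact mul_mem (mul_mem h h) (inv_mem h)
    · exact Subgroup.subset_closure ⟨⟨i, h⟩, rfl⟩
    · have := ofIdx_perm (RootPairing.weylGroup.ofIdx P j) i
      rw [weylGroupToPerm_ofIdx] at this
      rw [this]
      have hj' : RootPairing.weylGroup.ofIdx P j ∈
        Subgroup.closure (Set.range (simpleReflection b)) :=
          Subgroup.subset_closure ⟨⟨j, hj⟩, rfl⟩
      exact mul_mem (mul_mem hj' hi) (inv_mem hj')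
  rw [eq_top_iff]
  rintro ⟨w, hw⟩ -
  induction hw using RootPairing.weylGroup.induction with
  | mem i => exact key i
  | one => exact one_mem _
  | mul x y hx hy h1 h2 => exact mul_mem h1 h2

lemma exists_word (w : P.weylGroup) :
    ∃ c : List b.support, (c.map (simpleReflection b)).prod = w := by
  have hw : w ∈ Subgroup.closure (Set.range (simpleReflection b)) := by
    rw [closure_range_simpleReflection]; trivial
  induction hw using Subgroup.closure_induction with
  | mem x h =>
    obtain ⟨i, rfl⟩ := h
    exact ⟨[i], by simp⟩
  | one => exact ⟨[], rfl⟩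
  | mul x y _ _ hx hy =>
    obtain ⟨c, rfl⟩ := hx
    obtain ⟨c', rfl⟩ := hy
    exact ⟨c ++ c', by simp⟩
  | inv x _ hx =>
    obtain ⟨c, rfl⟩ := hx
    refine ⟨c.reverse, ?_⟩
    rw [List.prod_inv_reverse, List.map_map, List.map_reverse]
    congr 2
    exact List.map_congr_left fun i _ => (simpleReflection_inv b i).symm

lemma exists_reduced_word (w : P.weylGroup) :
    ∃ c : List b.support, c.length = length b w ∧ (c.map (simpleReflection b)).prod = w := by
  obtain ⟨c, hc⟩ := exists_word b w
  exact Nat.sInf_mem (s := {n | ∃ c : List b.support, c.length = n ∧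
    (c.map (simpleReflection b)).prod = w}) ⟨_, c, rfl, hc⟩

omit [Finite ι] [P.IsCrystallographic] [P.IsReduced] in
lemma length_prod_le (c : List b.support) :
    length b (c.map (simpleReflection b)).prod ≤ c.length :=
  Nat.sInf_le ⟨c, rfl, rfl⟩

variable {b}

lemma eq_of_not_isPos_reflectionPerm {i : b.support} {j : ι} (hj : b.IsPos j)
    (h : ¬ b.IsPos (P.reflectionPerm i j)) : j = i := by
  by_contra hne
  exact h (hj.reflectionPerm i.2 hne)

variable (b) in
-- The letters act on the simple root from the right end of the word. At the letter `j` where it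
-- first turns negative it must be the simple root `α_j`. So `s_j` is the conjugate of `s_i` by the
-- tail, and the letter can be deleted in exchange for `s_i` on the right.
lemma exchange (c : List b.support) (i : b.support)
    (h : ¬ b.IsPos (P.weylGroupToPerm (c.map (simpleReflection b)).prod i)) :
    ∃ c' : List b.support, c'.length + 1 = c.length ∧
      (c'.map (simpleReflection b)).prod =
        (c.map (simpleReflection b)).prod * simpleReflection b i := by
  induction c with
  | nil =>
    exact absurd (b.isPos_of_mem_support i.2) h
  | cons j c ih =>
    rw [List.map_cons, List.prod_cons] at h ⊢
    by_cases hc : b.IsPos (P.weylGroupToPerm (c.map (simpleReflection b)).prod i)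
    · refine ⟨c, rfl, ?_⟩
      have he : P.weylGroupToPerm (c.map (simpleReflection b)).prod i = j :=
        eq_of_not_isPos_reflectionPerm hc (by rwa [map_mul] at h)
      have h1 := ofIdx_perm (c.map (simpleReflection b)).prod (i : ι)
      rw [he] at h1
      have h2 : simpleReflection b j * (c.map (simpleReflection b)).prod =
          (c.map (simpleReflection b)).prod * simpleReflection b i := by
        rw [simpleReflection, simpleReflection, h1, inv_mul_cancel_right]
      rw [h2, mul_assoc, simpleReflection_mul_self, mul_one]
    · obtain ⟨c', h1, h2⟩ := ih hc
      refine ⟨j :: c', by simp [h1], ?_⟩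
      rw [List.map_cons, List.prod_cons, h2, mul_assoc]

omit [Finite ι] [P.IsCrystallographic] [P.IsReduced] in
lemma perm_reflection_self (w : P.weylGroup) (i : ι) :
    let := P.indexNeg
    P.weylGroupToPerm (w * RootPairing.weylGroup.ofIdx P i) i = -P.weylGroupToPerm w i := by
  let := P.indexNeg
  apply P.root.injective
  rw [root_indexNeg, ← RootPairing.weylGroup_apply_root, ← RootPairing.weylGroup_apply_root,
    mul_smul]
  have : RootPairing.weylGroup.ofIdx P i • P.root i = -P.root i := by
    rw [RootPairing.weylGroup.ofIdx_smul, RootPairing.Equiv.reflection_smul,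
      RootPairing.reflection_apply_self]
  rw [this, smul_neg]

omit [Finite ι] [P.IsCrystallographic] [P.IsReduced] in
lemma isPos_mul_simpleReflection_iff (w : P.weylGroup) (i : b.support) :
    b.IsPos (P.weylGroupToPerm (w * simpleReflection b i) i) ↔
      ¬ b.IsPos (P.weylGroupToPerm w i) := by
  rw [simpleReflection, perm_reflection_self, RootPairing.Base.IsPos.neg_iff_not]

lemma length_mul_lt {w : P.weylGroup} {i : b.support} (h : ¬ b.IsPos (P.weylGroupToPerm w i)) :
    length b (w * simpleReflection b i) < length b w := by
  obtain ⟨c, hc, rfl⟩ := exists_reduced_word b w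
  obtain ⟨c', h1, h2⟩ := exchange b c i h
  rw [← h2, ← hc]
  have := length_prod_le b c'
  omega

lemma length_lt_mul {w : P.weylGroup} {i : b.support} (h : b.IsPos (P.weylGroupToPerm w i)) :
    length b w < length b (w * simpleReflection b i) := by
  have := length_mul_lt (w := w * simpleReflection b i) (i := i)
    (by rw [isPos_mul_simpleReflection_iff]; exact not_not.2 h)
  rwa [mul_assoc, simpleReflection_mul_self, mul_one] at this

lemma length_inv_le (w : P.weylGroup) : length b w⁻¹ ≤ length b w := by
  obtain ⟨c, hc, rfl⟩ := exists_reduced_word b w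
  have : ((c.map (simpleReflection b)).prod)⁻¹ = (c.reverse.map (simpleReflection b)).prod := by
    rw [List.prod_inv_reverse, List.map_map, List.map_reverse]
    congr 2
    exact List.map_congr_left fun i _ => simpleReflection_inv b i
  rw [← hc, this, ← c.length_reverse]
  exact length_prod_le b _

lemma length_inv (w : P.weylGroup) : length b w⁻¹ = length b w :=
  (length_inv_le w).antisymm (by simpa using length_inv_le (b := b) w⁻¹)

/-- Length is invariant under inversion, which turns left multiplication into right multiplication;
there the sign of the root decides whether the length goes up or down. -/
lemma mem_unstableRoots_iff {w : P.weylGroup} {i : b.support} :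
    i ∈ unstableRoots b w ↔ b.IsPos (P.weylGroupToPerm w⁻¹ i) := by
  have h : length b (simpleReflection b i * w) = length b (w⁻¹ * simpleReflection b i) := by
    rw [← length_inv, mul_inv_rev, simpleReflection_inv]
  rw [unstableRoots, Set.mem_ofPred_eq, h, ← length_inv w]
  constructor
  · intro hl
    by_contra hc
    exact absurd (length_mul_lt hc) (not_lt.2 hl.le)
  · exact length_lt_mul

/-- The last letter of a reduced word can be removed on the right, so it cannot give a positive
root. -/
lemma exists_not_isPos {w : P.weylGroup} (hw : w ≠ 1) :
    ∃ i : b.support, ¬ b.IsPos (P.weylGroupToPerm w i) := by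
  obtain ⟨c, hc, rfl⟩ := exists_reduced_word b w
  rcases List.eq_nil_or_concat c with rfl | ⟨c', i, rfl⟩
  · exact absurd rfl hw
  · refine ⟨i, fun h => ?_⟩
    have h1 := length_lt_mul h
    rw [← hc] at h1
    simp only [List.concat_eq_append, List.map_append, List.map_cons, List.map_nil,
      List.prod_append, List.prod_singleton, List.length_append, List.length_singleton] at h1
    rw [mul_assoc, simpleReflection_mul_self, mul_one] at h1
    have := length_prod_le b c'
    omega

/-- Induction on the length of Weyl group elements by multiplication from the right. -/
lemma weyl_induction (b : P.Base) {p : P.weylGroup → Prop} (one : p 1)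
    (step : ∀ (w : P.weylGroup) (i : b.support), ¬ b.IsPos (P.weylGroupToPerm w i) →
      p (w * simpleReflection b i) → p w) (w : P.weylGroup) : p w := by
  generalize hn : length b w = n
  induction n using Nat.strongRecOn generalizing w with
  | ind n ih =>
    by_cases hw : w = 1
    · rwa [hw]
    · obtain ⟨i, hi⟩ := exists_not_isPos (b := b) hw
      exact step w i hi (ih _ (hn ▸ length_mul_lt hi) _ rfl)

/-- Induction on the length of Weyl group elements by multiplication from the left. -/
lemma weyl_induction_left (b : P.Base) {p : P.weylGroup → Prop} (one : p 1)
    (step : ∀ (w : P.weylGroup) (i : b.support), ¬ b.IsPos (P.weylGroupToPerm w⁻¹ i) →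
      p (simpleReflection b i * w) → p w) (w : P.weylGroup) : p w := by
  have := weyl_induction b (p := fun w => p w⁻¹) (by simpa using one) (fun w i hi hp => by
    refine step w⁻¹ i (by rwa [inv_inv]) ?_
    rwa [mul_inv_rev, simpleReflection_inv] at hp) w⁻¹
  simpa using this

end Length

/-! ### Dominant points -/

section Dominant

variable {ι V H : Type v} [Finite ι] [AddCommGroup V] [Module ℝ V] [AddCommGroup H] [Module ℝ H]
  {P : RootPairing ι ℝ V H} [P.IsCrystallographic] [P.IsReduced] (b : P.Base)

/-- The points of the closed dominant chamber. -/
def Dominant (x : H) : Prop := ∀ i : b.support, 0 ≤ rootForm P i x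

/-- The subgroup generated by a set of simple reflections. -/
def parabolic (J : Set b.support) : Subgroup P.weylGroup :=
  Subgroup.closure (simpleReflection b '' J)

variable {b}

omit [Finite ι] [P.IsCrystallographic] [P.IsReduced] in
lemma parabolic_mono {J K : Set b.support} (h : J ⊆ K) : parabolic b J ≤ parabolic b K :=
  Subgroup.closure_mono (Set.image_mono h)

omit [Finite ι] [P.IsCrystallographic] [P.IsReduced] in
lemma simpleReflection_mem_parabolic {J : Set b.support} {i : b.support} (h : i ∈ J) :
    simpleReflection b i ∈ parabolic b J :=
  Subgroup.subset_closure ⟨i, h, rfl⟩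

omit [Finite ι] [P.IsCrystallographic] [P.IsReduced] in
lemma weylAct_simpleReflection (i : b.support) (x : H) :
    weylAct P (simpleReflection b i) x = x - rootForm P i x • P.coroot i :=
  weylAct_ofIdx _ x

omit [P.IsReduced] in
lemma Dominant.nonneg {x : H} (hx : Dominant b x) {j : ι} (hj : b.IsPos j) :
    0 ≤ rootForm P j x := by
  refine hj.induction_on_add (p := fun j => 0 ≤ rootForm P j x) (fun i hi => hx ⟨i, hi⟩)
    fun i j k h hi hj => ?_
  rw [rootForm, h, map_add, LinearMap.add_apply]
  exact add_nonneg hi (hx ⟨j, hj⟩)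

omit [P.IsReduced] in
lemma Dominant.nonpos {x : H} (hx : Dominant b x) {j : ι} (hj : ¬ b.IsPos j) :
    rootForm P j x ≤ 0 := by
  let := P.indexNeg
  have := hx.nonneg ((RootPairing.Base.IsPos.neg_iff_not b j).2 hj)
  rw [rootForm, root_indexNeg, map_neg, LinearMap.neg_apply] at this
  linarith

/-- A dominant point is the only dominant point in its orbit, and its stabilizer is generated by
simple reflections. -/
lemma Dominant.mem_parabolic {x : H} (hx : Dominant b x) (u : P.weylGroup)
    (hu : Dominant b (weylAct P u x)) :
    weylAct P u x = x ∧ u ∈ parabolic b {j | rootForm P j x = 0} := by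
  induction u using weyl_induction b with
  | one => exact ⟨weylAct_one x, one_mem _⟩
  | step u j hj ih =>
    -- The value of `α_j` at `x` equals that of the negative root `u α_j` at the dominant point `u
    -- x`, so it is at most zero.
    have h0 : rootForm P j x = 0 := by
      refine le_antisymm ?_ (hx j)
      rw [← rootForm_weylAct u]
      exact hu.nonpos hj
    have hs : weylAct P (simpleReflection b j) x = x := by
      rw [weylAct_simpleReflection, h0, zero_smul, sub_zero]
    have hus : weylAct P (u * simpleReflection b j) x = weylAct P u x := by rw [weylAct_mul, hs]
    obtain ⟨h1, h2⟩ := ih (by rwa [hus])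
    refine ⟨hus ▸ h1, ?_⟩
    have h3 := mul_mem h2 (simpleReflection_mem_parabolic (b := b) (J := {j | rootForm P j x = 0})
      (i := j) h0)
    rwa [mul_assoc, simpleReflection_mul_self, mul_one] at h3

/-! ### Fundamental weights -/

variable [P.IsRootSystem]

variable (b) in
/-- The fundamental weights. -/
def weight (i : b.support) : H →ₗ[ℝ] ℝ := b.toCoweightBasis.coord i

omit [Finite ι] [P.IsCrystallographic] [P.IsReduced] in
lemma weight_coroot_self (i : b.support) : weight b i (P.coroot i) = 1 := by
  simp [weight]

omit [Finite ι] [P.IsCrystallographic] [P.IsReduced] in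
lemma weight_coroot_of_ne {i j : b.support} (h : i ≠ j) : weight b i (P.coroot j) = 0 := by
  simp [weight, h.symm]

omit [Finite ι] [P.IsCrystallographic] [P.IsReduced] in
lemma sum_weight_smul_coroot (x : H) : ∑ i, weight b i x • P.coroot i = x := by
  have := b.toCoweightBasis.sum_repr x
  simpa [weight] using this

omit [Finite ι] [P.IsCrystallographic] [P.IsReduced] in
lemma weight_parabolic {i : b.support} {J : Set b.support} (hi : i ∉ J) {v : P.weylGroup}
    (hv : v ∈ parabolic b J) (x : H) : weight b i (weylAct P v x) = weight b i x := by
  induction hv using Subgroup.closure_induction generalizing x with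
  | mem v h =>
    obtain ⟨j, hj, rfl⟩ := h
    have hij : i ≠ j := by
      rintro rfl
      exact hi hj
    rw [weylAct_simpleReflection, map_sub, map_smul, weight_coroot_of_ne hij, smul_zero, sub_zero]
  | one => rw [weylAct_one]
  | mul v v' _ _ h h' => rw [weylAct_mul, h, h']
  | inv v _ h => rw [← h, weylAct_weylAct_inv]

/-- When `u` is built up from the left, each factor `s_j` subtracts a nonnegative multiple of
`α_j^∨`, and only `s_i` can lower the `i`-th weight. In the case of equality the factors `s_i` act
trivially and can be omitted. -/
lemma Dominant.weight_le {x : H} (hx : Dominant b x) (i : b.support) (u : P.weylGroup) :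
    weight b i (weylAct P u x) ≤ weight b i x ∧
      (weight b i (weylAct P u x) = weight b i x →
        ∃ v ∈ parabolic b {i}ᶜ, weylAct P v x = weylAct P u x) := by
  induction u using weyl_induction_left b with
  | one => exact ⟨by rw [weylAct_one], fun _ => ⟨1, one_mem _, rfl⟩⟩
  | step u j hj ih =>
    set u' := simpleReflection b j * u with hu'
    have hu : u = simpleReflection b j * u' := by
      rw [hu', ← mul_assoc, simpleReflection_mul_self, one_mul]
    have hpos : 0 ≤ rootForm P j (weylAct P u' x) := by
      have h1 : b.IsPos (P.weylGroupToPerm u'⁻¹ j) := by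
        rw [hu', mul_inv_rev, simpleReflection_inv, isPos_mul_simpleReflection_iff]
        exact hj
      have h2 := hx.nonneg h1
      rwa [← rootForm_weylAct u', ← Equiv.Perm.mul_apply, ← map_mul, mul_inv_cancel, map_one,
        Equiv.Perm.one_apply] at h2
    have hact : weylAct P u x = weylAct P u' x -
        rootForm P j (weylAct P u' x) • P.coroot j := by
      rw [hu, weylAct_mul, weylAct_simpleReflection]
    by_cases hij : i = j
    · subst hij
      have hw : weight b i (weylAct P u x) = weight b i (weylAct P u' x) -
          rootForm P i (weylAct P u' x) := by
        rw [hact, map_sub, map_smul, weight_coroot_self, smul_eq_mul, mul_one]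
      refine ⟨by linarith [ih.1], fun h => ?_⟩
      have h0 : rootForm P i (weylAct P u' x) = 0 := by linarith [ih.1]
      obtain ⟨v, hv, hvx⟩ := ih.2 (by linarith)
      exact ⟨v, hv, by rw [hvx, hact, h0, zero_smul, sub_zero]⟩
    · have hw : weight b i (weylAct P u x) = weight b i (weylAct P u' x) := by
        rw [hact, map_sub, map_smul, weight_coroot_of_ne hij, smul_zero, sub_zero]
      refine ⟨hw.trans_le ih.1, fun h => ?_⟩
      obtain ⟨v, hv, hvx⟩ := ih.2 (hw.symm.trans h)
      refine ⟨simpleReflection b j * v, mul_mem (simpleReflection_mem_parabolic ?_) hv, ?_⟩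
      · exact fun h => hij (Set.mem_singleton_iff.1 h).symm
      · rw [weylAct_mul, hvx, ← weylAct_mul, ← hu]

omit [P.IsRootSystem] in
-- A root is positive exactly if its coroot is a positive combination of simple coroots. One
-- direction suffices here, to make the height function positive on positive coroots. The proof
-- follows reflections from the simple roots, where a simple reflection changes the sign only of its
-- own root and its negative.
lemma isPos_flip {j : ι} (hj : b.IsPos j) : b.flip.IsPos j := by
  let := P.indexNeg
  refine hj.induction_on_reflect (p := fun j => b.IsPos j → b.flip.IsPos j)
    (fun i hi _ => RootPairing.Base.isPos_of_mem_support (b := b.flip) hi)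
    (fun i j hi hj h => ?_) hj
  by_cases hpos : b.IsPos i
  · by_cases hij : i = j
    · subst hij
      exact absurd hpos ((RootPairing.Base.IsPos.neg_iff_not b i).1 h)
    · exact (hi hpos).reflectionPerm (b := b.flip) hj hij
  · have h1 := (RootPairing.Base.IsPos.neg_iff_not b i).2 hpos
    have h2 : -i = j := by
      refine eq_of_not_isPos_reflectionPerm (i := ⟨j, hj⟩) h1 ?_
      rw [← RootPairing.Base.IsPos.neg_iff_not]
      convert h using 1
      apply P.root.injective
      rw [root_indexNeg, RootPairing.root_reflectionPerm, RootPairing.root_reflectionPerm,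
        root_indexNeg, map_neg, neg_neg]
    have h3 : P.reflectionPerm j i = j := by
      apply P.root.injective
      rw [RootPairing.root_reflectionPerm, ← neg_neg (P.root i), ← root_indexNeg, h2, map_neg,
        RootPairing.reflection_apply_self, neg_neg]
    rw [h3]
    exact RootPairing.Base.isPos_of_mem_support (b := b.flip) hj

variable (b) in
/-- The sum of the fundamental weights. -/
def weightSum : H →ₗ[ℝ] ℝ := ∑ i, weight b i

omit [Finite ι] [P.IsCrystallographic] [P.IsReduced] in
lemma weightSum_coroot (i : b.support) : weightSum b (P.coroot i) = 1 := by
  rw [weightSum, LinearMap.sum_apply, Finset.sum_eq_single i, weight_coroot_self]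
  · intro j _ h
    exact weight_coroot_of_ne h
  · simp

lemma weightSum_coroot_pos {j : ι} (hj : b.IsPos j) : 0 < weightSum b (P.coroot j) := by
  refine (isPos_flip hj).induction_on_add (p := fun j => 0 < weightSum b (P.coroot j))
    (fun i hi => ?_) fun i j k h hi hj => ?_
  · rw [weightSum_coroot (b := b) ⟨i, hi⟩]
    exact one_pos
  · have h' : P.coroot k = P.coroot i + P.coroot j := h
    rw [h', map_add]
    exact add_pos hi (by rw [weightSum_coroot (b := b) ⟨j, hj⟩]; exact one_pos)

lemma weightSum_coroot_neg {j : ι} (hj : ¬ b.IsPos j) : weightSum b (P.coroot j) < 0 := by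
  let := P.indexNeg
  have := weightSum_coroot_pos ((RootPairing.Base.IsPos.neg_iff_not b j).2 hj)
  rw [coroot_indexNeg, map_neg] at this
  linarith

end Dominant

end TwistedTomei

end

noncomputable section

namespace TwistedTomei

universe v

/-! ### The polytope -/

section Polytope

variable {ι V H : Type v} [Finite ι] [AddCommGroup V] [Module ℝ V] [AddCommGroup H] [Module ℝ H]
  {P : RootPairing ι ℝ V H} [P.IsCrystallographic] [P.IsReduced] {b : P.Base} {x₀ : H}

omit [Finite ι] [P.IsCrystallographic] [P.IsReduced] in
lemma StrictlyDominant.dominant (hx₀ : StrictlyDominant b x₀) : Dominant b x₀ := fun i =>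
  (hx₀ i).le

omit [Finite ι] [P.IsCrystallographic] [P.IsReduced] in
lemma weylAct_mem_polytope {q : H} (hq : q ∈ polytope P x₀) (w : P.weylGroup) :
    weylAct P w q ∈ polytope P x₀ := by
  have h : weylLin P w '' polytope P x₀ ⊆ polytope P x₀ := by
    rw [polytope, LinearMap.image_convexHull]
    refine convexHull_mono ?_
    rintro _ ⟨_, ⟨u, rfl⟩, rfl⟩
    exact ⟨w * u, weylAct_mul w u x₀⟩
  exact h ⟨q, hq, rfl⟩

omit [Finite ι] [P.IsCrystallographic] [P.IsReduced] in
lemma vertex_mem_polytope (w : P.weylGroup) : weylAct P w x₀ ∈ polytope P x₀ :=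
  subset_convexHull ℝ _ ⟨w, rfl⟩

omit [Finite ι] [P.IsCrystallographic] [P.IsReduced] in
lemma mem_chamberCell_iff {q : H} {w : P.weylGroup} :
    q ∈ chamberCell b x₀ w ↔ q ∈ polytope P x₀ ∧ Dominant b (weylAct P w⁻¹ q) := by
  constructor
  · rintro ⟨x, ⟨hx, hx'⟩, rfl⟩
    refine ⟨weylAct_mem_polytope hx w, ?_⟩
    rw [weylAct_inv_weylAct]
    exact hx'
  · rintro ⟨h, h'⟩
    exact ⟨weylAct P w⁻¹ q, ⟨weylAct_mem_polytope h _, h'⟩, weylAct_weylAct_inv w q⟩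

omit [Finite ι] [P.IsCrystallographic] [P.IsReduced] in
lemma mem_innerWall_iff {q : H} {w : P.weylGroup} {i : b.support} :
    q ∈ innerWall b x₀ w i ↔
      q ∈ chamberCell b x₀ w ∧ rootForm P i (weylAct P w⁻¹ q) = 0 := by
  constructor
  · rintro ⟨x, ⟨hx, hx'⟩, rfl⟩
    refine ⟨⟨x, hx, rfl⟩, ?_⟩
    rw [weylAct_inv_weylAct]
    exact hx'
  · rintro ⟨⟨x, hx, rfl⟩, h⟩
    rw [weylAct_inv_weylAct] at h
    exact ⟨x, ⟨hx, h⟩, rfl⟩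

variable [P.IsRootSystem]

omit [Finite ι] [P.IsCrystallographic] [P.IsReduced] in
lemma mem_span_coroot_iff {i : b.support} {y : H} :
    y ∈ Submodule.span ℝ {y | ∃ j : b.support, j ≠ i ∧ y = P.coroot j} ↔ weight b i y = 0 := by
  constructor
  · intro h
    induction h using Submodule.span_induction with
    | mem y h =>
      obtain ⟨j, hj, rfl⟩ := h
      exact weight_coroot_of_ne hj.symm
    | zero => exact map_zero _
    | add x y _ _ hx hy => rw [map_add, hx, hy, add_zero]
    | smul r x _ hx => rw [map_smul, hx, smul_zero]
  · intro h
    rw [← sum_weight_smul_coroot (b := b) y]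
    refine sum_mem fun j _ => ?_
    by_cases hj : j = i
    · rw [hj, h, zero_smul]
      exact zero_mem _
    · exact Submodule.smul_mem _ _ (Submodule.subset_span ⟨j, hj, rfl⟩)

omit [Finite ι] [P.IsCrystallographic] [P.IsReduced] in
lemma mem_outerWall_iff {q : H} {w : P.weylGroup} {i : b.support} :
    q ∈ outerWall b x₀ w i ↔
      q ∈ chamberCell b x₀ w ∧ weight b i (weylAct P w⁻¹ q) = weight b i x₀ := by
  constructor
  · rintro ⟨x, ⟨hx, hx'⟩, rfl⟩
    refine ⟨⟨x, hx, rfl⟩, ?_⟩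
    rw [weylAct_inv_weylAct, ← sub_eq_zero, ← map_sub]
    exact mem_span_coroot_iff.1 hx'
  · rintro ⟨⟨x, hx, rfl⟩, h⟩
    rw [weylAct_inv_weylAct, ← sub_eq_zero, ← map_sub] at h
    exact ⟨x, ⟨hx, mem_span_coroot_iff.2 h⟩, rfl⟩

lemma weight_le_of_mem_polytope (hx₀ : StrictlyDominant b x₀) {q : H} (hq : q ∈ polytope P x₀)
    (i : b.support) : weight b i q ≤ weight b i x₀ := by
  refine convexHull_min (t := {q | weight b i q ≤ weight b i x₀}) ?_
    (convex_halfSpace_le (weight b i).isLinear _) hq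
  rintro _ ⟨w, rfl⟩
  exact (hx₀.dominant.weight_le i w).1

omit [P.IsCrystallographic] [P.IsReduced] in
variable (b) in
-- Choose a point of the orbit with maximal sum of weights: a simple reflection in a root with
-- negative value would increase it.
lemma exists_dominant (q : H) : ∃ w : P.weylGroup, Dominant b (weylAct P w⁻¹ q) := by
  obtain ⟨w, hw⟩ := Finite.exists_max fun w : P.weylGroup => weightSum b (weylAct P w⁻¹ q)
  refine ⟨w, fun i => ?_⟩
  have h := hw (w * simpleReflection b i)
  rw [mul_inv_rev, simpleReflection_inv, weylAct_mul, weylAct_simpleReflection, map_sub, map_smul,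
    weightSum_coroot, smul_eq_mul, mul_one] at h
  linarith

omit [P.IsReduced] in
-- The point `p` is `x₀` minus a nonnegative combination of simple coroots other than `α_i^∨`, and
-- on these `α_i` is nonpositive. Geometrically, the external wall of type `i` does not meet the
-- internal wall of type `i`.
lemma rootForm_pos_of_weight_eq (hx₀ : StrictlyDominant b x₀) {p : H}
    (hp : ∀ j, weight b j p ≤ weight b j x₀) {i : b.support} (hi : weight b i p = weight b i x₀) :
    0 < rootForm P i p := by
  have h1 : p = x₀ - ∑ j, weight b j (x₀ - p) • P.coroot j := by
    rw [sum_weight_smul_coroot, sub_sub_cancel]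
  rw [h1, map_sub, map_sum]
  have h2 : ∑ j : b.support, rootForm P i (weight b j (x₀ - p) • P.coroot j) ≤ 0 := by
    refine Finset.sum_nonpos fun j _ => ?_
    rw [map_smul, map_sub, smul_eq_mul]
    by_cases hj : j = i
    · rw [hj, hi, sub_self, zero_mul]
    · refine mul_nonpos_of_nonneg_of_nonpos (sub_nonneg.2 (hp j)) ?_
      have h3 := b.pairingIn_le_zero_of_ne (i := i) (j := j)
        (fun h => hj (Subtype.ext h).symm) i.2 j.2
      have h4 : rootForm P i (P.coroot j) = (P.pairingIn ℤ i j : ℝ) := by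
        have := P.algebraMap_pairingIn ℤ i j
        rw [rootForm, RootPairing.root_coroot_eq_pairing, ← this]
        rfl
      rw [h4]
      exact_mod_cast h3
  have := hx₀ i
  change 0 < rootForm P i x₀ at this
  linarith

/-- A point in the relative interior of the face at `x₀` spanned by a set of directions. -/
lemma exists_face_point (hx₀ : StrictlyDominant b x₀) (J : Set b.support) :
    ∃ p ∈ polytope P x₀, Dominant b p ∧ ∀ i, weight b i p = weight b i x₀ ↔ i ∉ J := by
  classical
  have := Fintype.ofFinite (parabolic b J)
  set n : ℝ := ((Fintype.card (parabolic b J) : ℕ) : ℝ) with hn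
  have hn0 : 0 < n := by
    rw [hn]
    exact_mod_cast Fintype.card_pos
  -- The average of `x₀` over the parabolic subgroup of `J`. It is fixed by the simple reflections
  -- in `J`, and the weights outside `J` are unchanged.
  set p : H := ∑ v : parabolic b J, n⁻¹ • weylAct P (v : P.weylGroup) x₀ with hp
  have hsum : ∑ _v : parabolic b J, n⁻¹ = 1 := by
    rw [Finset.sum_const, Finset.card_univ, nsmul_eq_mul, ← hn, mul_inv_cancel₀ hn0.ne']
  have hmem : p ∈ polytope P x₀ :=
    (convex_convexHull ℝ _).sum_mem (fun _ _ => (inv_pos.2 hn0).le) hsum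
      fun v _ => vertex_mem_polytope _
  have hw : ∀ i, weight b i p =
      ∑ v : parabolic b J, n⁻¹ * weight b i (weylAct P (v : P.weylGroup) x₀) := by
    intro i
    rw [hp, map_sum]
    simp only [map_smul, smul_eq_mul]
  have hx : ∀ i, weight b i x₀ = ∑ _v : parabolic b J, n⁻¹ * weight b i x₀ := by
    intro i
    rw [← Finset.sum_mul, hsum, one_mul]
  have hiff : ∀ i, weight b i p = weight b i x₀ ↔ i ∉ J := by
    intro i
    constructor
    · intro h hi
      refine h.not_lt ?_
      rw [hw, hx]
      refine Finset.sum_lt_sum (fun v _ => mul_le_mul_of_nonneg_left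
        (hx₀.dominant.weight_le i v).1 (inv_pos.2 hn0).le)
        ⟨⟨simpleReflection b i, simpleReflection_mem_parabolic hi⟩, Finset.mem_univ _, ?_⟩
      refine mul_lt_mul_of_pos_left ?_ (inv_pos.2 hn0)
      rw [weylAct_simpleReflection, map_sub, map_smul, weight_coroot_self, smul_eq_mul, mul_one]
      have := hx₀ i
      change 0 < rootForm P i x₀ at this
      linarith
    · intro hi
      rw [hw, hx]
      exact Finset.sum_congr rfl fun v _ => by rw [weight_parabolic hi v.2]
  refine ⟨p, hmem, fun i => ?_, hiff⟩
  by_cases hi : i ∈ J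
  · have hinv : weylAct P (simpleReflection b i) p = p := by
      rw [← weylLin_apply, hp, map_sum]
      refine Fintype.sum_equiv
        (Equiv.mulLeft ⟨simpleReflection b i, simpleReflection_mem_parabolic hi⟩) _ _ fun v => ?_
      rw [map_smul, weylLin_apply, ← weylAct_mul]
      rfl
    have h := congrArg (weight b i) hinv
    rw [weylAct_simpleReflection, map_sub, map_smul, weight_coroot_self, smul_eq_mul,
      mul_one] at h
    linarith
  · exact (rootForm_pos_of_weight_eq hx₀ (weight_le_of_mem_polytope hx₀ hmem)
      ((hiff i).2 hi)).le

end Polytope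

/-! ### The colouring of the facets by the sign action -/

section Coloring

variable {ι V H : Type v} [Finite ι] [AddCommGroup V] [Module ℝ V] [AddCommGroup H] [Module ℝ H]
  {P : RootPairing ι ℝ V H} [P.IsRootSystem] [P.IsCrystallographic] [P.IsReduced] {b : P.Base}
  {x₀ : H}

variable (b) in
/-- The facets of the polytope. -/
abbrev FacetIndex : Type v := Σ i : b.support, P.weylGroup ⧸ parabolic b {i}ᶜ

instance : Fintype (FacetIndex b) := Fintype.ofFinite _

variable (b) in
/-- The facets at a vertex. -/
def facetAt (w : P.weylGroup) (i : b.support) : FacetIndex b := ⟨i, (w : P.weylGroup ⧸ _)⟩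

omit [Finite ι] [P.IsRootSystem] [P.IsCrystallographic] [P.IsReduced] in
lemma facetAt_eq_iff {w u : P.weylGroup} {i j : b.support} :
    facetAt b w i = facetAt b u j ↔ i = j ∧ w⁻¹ * u ∈ parabolic b {i}ᶜ := by
  constructor
  · intro h
    obtain rfl : i = j := congrArg Sigma.fst h
    rw [facetAt, facetAt, Sigma.mk.injEq] at h
    exact ⟨rfl, QuotientGroup.eq.1 (eq_of_heq h.2)⟩
  · rintro ⟨rfl, h⟩
    rw [facetAt, facetAt, QuotientGroup.eq.2 h]

/-- The linear form that defines a facet. -/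
def facetForm (a : FacetIndex b) : H →ₗ[ℝ] ℝ :=
  Quotient.liftOn' a.2 (fun w => weight b a.1 ∘ₗ weylLin P w⁻¹) fun w u h => by
    rw [QuotientGroup.leftRel_apply] at h
    ext x
    simp only [LinearMap.comp_apply, weylLin_apply]
    have h1 := weight_parabolic (i := a.1) (by simp) (inv_mem h) (weylAct P w⁻¹ x)
    rw [← weylAct_mul, mul_inv_rev, inv_inv, mul_assoc, mul_inv_cancel, mul_one] at h1
    exact h1.symm

omit [Finite ι] [P.IsCrystallographic] [P.IsReduced] in
lemma facetForm_facetAt (w : P.weylGroup) (i : b.support) (x : H) :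
    facetForm (facetAt b w i) x = weight b i (weylAct P w⁻¹ x) := rfl

variable {δ : MarkedDynkinDiagram b} {ρ : P.weylGroup →* Equiv.Perm (Signs b)}
  (hρ : ∀ (i : b.support) (ε : Signs b), ρ (simpleReflection b i) ε = δ.reflectSigns i ε)

omit [Finite ι] [P.IsRootSystem] [P.IsCrystallographic] [P.IsReduced] in
lemma signAction_apply_inv (w : P.weylGroup) (ε : Signs b) : ρ w (ρ w⁻¹ ε) = ε := by
  rw [← Equiv.Perm.mul_apply, ← map_mul, mul_inv_cancel, map_one, Equiv.Perm.one_apply]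

omit [Finite ι] [P.IsRootSystem] [P.IsCrystallographic] [P.IsReduced] in
lemma signAction_inv_apply (w : P.weylGroup) (ε : Signs b) : ρ w⁻¹ (ρ w ε) = ε := by
  rw [← Equiv.Perm.mul_apply, ← map_mul, inv_mul_cancel, map_one, Equiv.Perm.one_apply]

omit [Finite ι] [P.IsRootSystem] [P.IsReduced] in
-- The reflection `s_j` reads only the coordinate `j`, which the flip leaves alone, and it acts on
-- the others by multiplication with signs.
lemma reflectSigns_flipSign {i j : b.support} (h : j ≠ i) (ε : Signs b) :
    δ.reflectSigns j (flipSign b i ε) = flipSign b i (δ.reflectSigns j ε) := by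
  classical
  have hj : flipSign b i ε j = ε j := by simp [flipSign, h]
  funext k
  rw [MarkedDynkinDiagram.reflectSigns, hj]
  by_cases hk : k = i
  · subst hk
    simp only [flipSign, Function.update_self, MarkedDynkinDiagram.reflectSigns]
    split_ifs <;> simp
  · simp [flipSign, hk, MarkedDynkinDiagram.reflectSigns]

include hρ in
omit [Finite ι] [P.IsRootSystem] [P.IsReduced] in
-- This makes the involution of a facet independent of the vertex chosen in its coset.
lemma signAction_flipSign {i : b.support} {v : P.weylGroup} (hv : v ∈ parabolic b {i}ᶜ)
    (ε : Signs b) : ρ v (flipSign b i ε) = flipSign b i (ρ v ε) := by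
  induction hv using Subgroup.closure_induction generalizing ε with
  | mem v h =>
    obtain ⟨j, hj, rfl⟩ := h
    rw [hρ, hρ, reflectSigns_flipSign hj]
  | one => rw [map_one]; rfl
  | mul v v' _ _ h h' => rw [map_mul, Equiv.Perm.mul_apply, Equiv.Perm.mul_apply, h', h]
  | inv v _ h =>
    apply (ρ v).injective
    rw [h, signAction_apply_inv, signAction_apply_inv]

/-- The involution of the signs attached to a facet. -/
def facetFlip (hρ : ∀ (i : b.support) (ε : Signs b),
    ρ (simpleReflection b i) ε = δ.reflectSigns i ε) (a : FacetIndex b) (η : Signs b) : Signs b :=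
  Quotient.liftOn' a.2 (fun w => ρ w (flipSign b a.1 (ρ w⁻¹ η))) fun w u h => by
    rw [QuotientGroup.leftRel_apply] at h
    have hu : u = w * (w⁻¹ * u) := by rw [mul_inv_cancel_left]
    generalize w⁻¹ * u = v at h hu
    subst hu
    rw [mul_inv_rev, map_mul, map_mul, Equiv.Perm.mul_apply, Equiv.Perm.mul_apply,
      signAction_flipSign hρ h, signAction_apply_inv]

omit [Finite ι] [P.IsRootSystem] [P.IsReduced] in
lemma facetFlip_facetAt (w : P.weylGroup) (i : b.support) (η : Signs b) :
    facetFlip hρ (facetAt b w i) η = ρ w (flipSign b i (ρ w⁻¹ η)) := rfl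

/-- The colouring of the facets of the polytope by the twisted sign action. -/
def coloring (hx₀ : StrictlyDominant b x₀) :
    FacetColoring b.support P.weylGroup (FacetIndex b) (Signs b) where
  facet := facetAt b
  facet_injective _ _ _ h := (facetAt_eq_iff.1 h).1
  coord w := ρ w⁻¹
  flip := facetFlip hρ
  coord_flip w i η := by
    rw [facetFlip_facetAt, signAction_inv_apply, flipSign]
    congr!
  -- The edge in direction `i` joins `w x₀` to `w x₀` minus a positive multiple of `w α_i^∨`. This
  -- lowers the sum of weights exactly if `w α_i` is positive, hence the minus sign in the height.
  ascending w := {i | b.IsPos (P.weylGroupToPerm w i)}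
  height w := -weightSum b (weylAct P w x₀)
  eq_or_height_lt w u h := by
    by_cases huw : u = w
    · exact Or.inl huw
    refine Or.inr (neg_lt_neg ?_)
    set v := w⁻¹ * u with hv
    have hu : u = w * v := by rw [hv, mul_inv_cancel_left]
    -- These coefficients write `w x₀ - u x₀` in the coroots `w α_j^∨`. They are nonnegative and
    -- vanish in the ascending directions, where `u` lies on the same facet; the remaining coroots
    -- are negative. Equality of heights would make them all vanish, and `x₀` has trivial
    -- stabilizer.
    set c : b.support → ℝ := fun j => weight b j (x₀ - weylAct P v x₀) with hc
    have hc0 : ∀ j, 0 ≤ c j := fun j => by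
      rw [hc]
      simp only [map_sub]
      exact sub_nonneg.2 (hx₀.dominant.weight_le j v).1
    have hcasc : ∀ j : b.support, b.IsPos (P.weylGroupToPerm w j) → c j = 0 := fun j hj => by
      obtain ⟨i, hi⟩ := h j hj
      obtain ⟨rfl, h'⟩ := facetAt_eq_iff.1 hi.symm
      rw [hc]
      simp only [map_sub]
      rw [weight_parabolic (by simp) h', sub_self]
    have hx : weylAct P w x₀ - weylAct P u x₀ =
        ∑ j, c j • P.coroot (P.weylGroupToPerm w j) := by
      rw [hu, weylAct_mul, ← weylLin_apply, ← weylLin_apply w (weylAct P v x₀), ← map_sub]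
      conv_lhs => rw [← sum_weight_smul_coroot (b := b) (x₀ - weylAct P v x₀), map_sum]
      refine Finset.sum_congr rfl fun j _ => ?_
      rw [map_smul, weylLin_apply, weylAct_coroot]
    rw [← sub_neg, ← map_sub, hx, map_sum]
    have hle : ∀ j, weightSum b (c j • P.coroot (P.weylGroupToPerm w j)) ≤ 0 := fun j => by
      rw [map_smul, smul_eq_mul]
      by_cases hj : b.IsPos (P.weylGroupToPerm w j)
      · rw [hcasc j hj, zero_mul]
      · exact mul_nonpos_of_nonneg_of_nonpos (hc0 j) (weightSum_coroot_neg hj).le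
    refine (Finset.sum_nonpos fun j _ => hle j).lt_of_ne fun h0 => huw ?_
    have h1 := (Finset.sum_eq_zero_iff_of_nonpos fun j _ => hle j).1 h0
    have hcz : ∀ j, c j = 0 := fun j => by
      by_cases hj : b.IsPos (P.weylGroupToPerm w j)
      · exact hcasc j hj
      · have h2 := h1 j (Finset.mem_univ j)
        rw [map_smul, smul_eq_mul] at h2
        exact (mul_eq_zero.1 h2).resolve_right (weightSum_coroot_neg hj).ne
    have hvx : weylAct P v x₀ = x₀ := by
      have h2 := sum_weight_smul_coroot (b := b) (x₀ - weylAct P v x₀)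
      rw [Finset.sum_eq_zero fun j _ => by rw [show weight b j _ = 0 from hcz j, zero_smul]] at h2
      exact (sub_eq_zero.1 h2.symm).symm
    have hv1 := (hx₀.dominant.mem_parabolic v (hvx.symm ▸ hx₀.dominant)).2
    have hempty : {j : b.support | rootForm P j x₀ = 0} = ∅ := by
      ext j
      simpa using (hx₀ j).ne'
    rw [hempty, parabolic, Set.image_empty, Subgroup.closure_empty, Subgroup.mem_bot] at hv1
    rw [hu, hv1, mul_one]
  exists_height_lt w i hi := by
    refine ⟨w * simpleReflection b i, neg_lt_neg ?_, fun j hj => ⟨j, ?_⟩⟩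
    · rw [weylAct_mul, weylAct_simpleReflection, ← weylLin_apply, map_sub, map_smul, weylLin_apply,
        weylLin_apply, weylAct_coroot, map_sub, map_smul, smul_eq_mul]
      have h1 := mul_pos (hx₀ i) (weightSum_coroot_pos hi)
      change 0 < rootForm P i x₀ * _ at h1
      linarith
    · rw [facetAt_eq_iff]
      refine ⟨rfl, ?_⟩
      rw [mul_inv_rev, simpleReflection_inv, inv_mul_cancel_right]
      exact simpleReflection_mem_parabolic fun h => hj (Set.mem_singleton_iff.1 h).symm

/-- The facets that contain a point, in terms of a chamber that contains the point. -/
lemma facetForm_eq_iff (hx₀ : StrictlyDominant b x₀) {q : H} {w : P.weylGroup}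
    (hq : q ∈ chamberCell b x₀ w) {a : FacetIndex b} :
    facetForm a q = weight b a.1 x₀ ↔
      ∃ i, a = facetAt b w i ∧ weight b i (weylAct P w⁻¹ q) = weight b i x₀ := by
  obtain ⟨hqP, hdom⟩ := mem_chamberCell_iff.1 hq
  constructor
  · intro h
    obtain ⟨i, u⟩ := a
    induction u using QuotientGroup.induction_on with
    | H u =>
    change facetForm (facetAt b u i) q = weight b i x₀ at h
    rw [facetForm_facetAt] at h
    set p := weylAct P w⁻¹ q with hp
    have hqp : q = weylAct P w p := (weylAct_weylAct_inv w q).symm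
    have hpP : p ∈ polytope P x₀ := weylAct_mem_polytope hqP _
    rw [hqp, ← weylAct_mul] at h
    -- The `i`-th weight of `u⁻¹ q` is at most that of `p`, which is at most that of `x₀`; equality
    -- at the ends forces it throughout. The equality case shows that `u` and `w` differ by an
    -- element of `W_i` and one of the stabilizer of `p`, and the latter also lies in `W_i`, as
    -- `α_i` is positive at `p`.
    have h1 := hdom.weight_le i (u⁻¹ * w)
    have h2 := weight_le_of_mem_polytope hx₀ hpP i
    have h3 : weight b i p = weight b i x₀ := le_antisymm h2 (h ▸ h1.1)
    obtain ⟨v, hv, hvp⟩ := h1.2 (h.trans h3.symm)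
    have h4 : weylAct P (w⁻¹ * u * v) p = p := by
      rw [weylAct_mul, hvp, ← weylAct_mul, mul_assoc, mul_inv_cancel_left, inv_mul_cancel,
        weylAct_one]
    have h5 := (hdom.mem_parabolic _ (by rw [h4]; exact hdom)).2
    have h6 : w⁻¹ * u * v ∈ parabolic b {i}ᶜ := by
      refine parabolic_mono (fun j hj hji => ?_) h5
      rw [Set.mem_singleton_iff] at hji
      subst hji
      exact (rootForm_pos_of_weight_eq hx₀ (weight_le_of_mem_polytope hx₀ hpP) h3).ne' hj
    refine ⟨i, (facetAt_eq_iff.2 ⟨rfl, ?_⟩).symm, h3⟩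
    have h7 := mul_mem h6 (inv_mem hv)
    rwa [mul_inv_cancel_right] at h7
  · rintro ⟨i, rfl, h⟩
    rw [facetForm_facetAt]
    exact h

end Coloring

end TwistedTomei

end

noncomputable section

namespace TwistedTomei

universe v

/-! ### The twisted Tomei manifold as a space glued from polytopes -/

section Realization

variable {ι V H : Type v} [Finite ι] [AddCommGroup V] [Module ℝ V] [AddCommGroup H] [Module ℝ H]
  {P : RootPairing ι ℝ V H} [P.IsRootSystem] [P.IsCrystallographic] [P.IsReduced] {b : P.Base}
  {x₀ : H} {δ : MarkedDynkinDiagram b} {ρ : P.weylGroup →* Equiv.Perm (Signs b)}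
  (hρ : ∀ (i : b.support) (ε : Signs b), ρ (simpleReflection b i) ε = δ.reflectSigns i ε)

variable (δ) in
/-- The point of the twisted Tomei manifold given by a signed chamber and a point of it. -/
def point (ε : Signs b) (w : P.weylGroup) (q : H) (hq : q ∈ chamberCell b x₀ w) :
    TwistedTomeiManifold δ x₀ :=
  Quot.mk _ ⟨(ε, w), ⟨q, hq⟩⟩

omit [Finite ι] [P.IsRootSystem] [P.IsReduced] in
lemma point_congr {ε ε' : Signs b} {w w' : P.weylGroup} {q : H} (hε : ε = ε') (hw : w = w')
    (hq : q ∈ chamberCell b x₀ w) (hq' : q ∈ chamberCell b x₀ w') :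
    point δ ε w q hq = point δ ε' w' q hq' := by
  subst hε hw
  rfl

omit [Finite ι] [P.IsRootSystem] [P.IsCrystallographic] [P.IsReduced] in
lemma mem_chamberCell_mul {p q : H} {w v : P.weylGroup} (hq : q ∈ chamberCell b x₀ w)
    (hp : weylAct P w⁻¹ q = p) (hv : weylAct P v p = p) :
    q ∈ chamberCell b x₀ (w * v) ∧ weylAct P (w * v)⁻¹ q = p := by
  have h : weylAct P (w * v)⁻¹ q = p := by
    rw [mul_inv_rev, weylAct_mul, hp]
    nth_rw 1 [← hv]
    rw [weylAct_inv_weylAct]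
  rw [mem_chamberCell_iff] at hq ⊢
  rw [h]
  exact ⟨⟨hq.1, hp ▸ hq.2⟩, rfl⟩

include hρ in
omit [Finite ι] [P.IsRootSystem] [P.IsReduced] in
-- The simple reflections that vanish at `p` correspond to the internal walls through `q`, so a
-- product of them is realised by successive internal gluings.
lemma point_mul {p q : H} {v : P.weylGroup} (hv : v ∈ parabolic b {j | rootForm P j p = 0}) :
    weylAct P v p = p ∧ ∀ (ε : Signs b) (w : P.weylGroup) (hq : q ∈ chamberCell b x₀ w)
      (hq' : q ∈ chamberCell b x₀ (w * v)), weylAct P w⁻¹ q = p →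
      point δ ε w q hq = point δ (ρ v⁻¹ ε) (w * v) q hq' := by
  induction hv using Subgroup.closure_induction with
  | mem v h =>
    obtain ⟨j, hj, rfl⟩ := h
    refine ⟨?_, fun ε w hq hq' hp => ?_⟩
    · rw [weylAct_simpleReflection, show rootForm P j p = 0 from hj, zero_smul, sub_zero]
    · rw [simpleReflection_inv, point_congr (hρ j ε) rfl hq' hq']
      exact Quot.sound (Glue.inner j ε w q hq hq' (mem_innerWall_iff.2 ⟨hq, hp ▸ hj⟩))
  | one =>
    refine ⟨weylAct_one p, fun ε w hq hq' _ => point_congr ?_ (mul_one w).symm _ _⟩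
    rw [inv_one, map_one]
    rfl
  | mul v v' _ _ h h' =>
    refine ⟨by rw [weylAct_mul, h'.1, h.1], fun ε w hq hq' hp => ?_⟩
    obtain ⟨h1, h2⟩ := mem_chamberCell_mul hq hp h.1
    rw [h.2 ε w hq h1 hp, h'.2 _ _ h1 (mem_chamberCell_mul h1 h2 h'.1).1 h2]
    refine point_congr ?_ (mul_assoc _ _ _) _ _
    rw [mul_inv_rev, map_mul, Equiv.Perm.mul_apply]
  | inv v _ h =>
    have hv' : weylAct P v⁻¹ p = p := by
      nth_rw 1 [← h.1]
      rw [weylAct_inv_weylAct]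
    refine ⟨hv', fun ε w hq hq' hp => ?_⟩
    obtain ⟨h1, h2⟩ := mem_chamberCell_mul hq hp hv'
    have hw : w * v⁻¹ * v = w := inv_mul_cancel_right w v
    have := h.2 (ρ v ε) (w * v⁻¹) h1 (hw.symm ▸ hq) h2
    rw [point_congr (congrArg (fun u => ρ u ε) (inv_inv v)) rfl hq' h1, this]
    exact point_congr (signAction_inv_apply v ε).symm hw.symm _ _

omit [P.IsCrystallographic] [P.IsReduced] in
lemma mem_chamberCell_choose (q : polytope P x₀) :
    (q : H) ∈ chamberCell b x₀ (exists_dominant b (q : H)).choose :=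
  mem_chamberCell_iff.2 ⟨q.2, (exists_dominant b (q : H)).choose_spec⟩

variable (δ ρ x₀) in
/-- The projection of the disjoint union of the polytopes to the twisted Tomei manifold. -/
def glueMap (z : Signs b × polytope P x₀) : TwistedTomeiManifold δ x₀ :=
  point δ (ρ (exists_dominant b (z.2 : H)).choose⁻¹ z.1) _ z.2 (mem_chamberCell_choose z.2)

include hρ in
-- Two chambers containing `q` differ by an element of the stabilizer of its dominant
-- representative, and this stabilizer is generated by simple reflections.
lemma glueMap_eq (η : Signs b) (q : polytope P x₀) {w : P.weylGroup}
    (hq : (q : H) ∈ chamberCell b x₀ w) :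
    glueMap x₀ δ ρ (η, q) = point δ (ρ w⁻¹ η) w q hq := by
  set u := (exists_dominant b (q : H)).choose with hu
  have hqu : (q : H) ∈ chamberCell b x₀ u := mem_chamberCell_choose q
  have hwd := (mem_chamberCell_iff.1 hq).2
  have hud := (mem_chamberCell_iff.1 hqu).2
  set p := weylAct P w⁻¹ (q : H) with hp
  have h1 : weylAct P (u⁻¹ * w) p = weylAct P u⁻¹ (q : H) := by
    rw [hp, weylAct_mul, weylAct_weylAct_inv]
  have h2 := inv_mem (hwd.mem_parabolic (u⁻¹ * w) (by rw [h1]; exact hud)).2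
  rw [mul_inv_rev, inv_inv] at h2
  have hwu : w * (w⁻¹ * u) = u := mul_inv_cancel_left w u
  rw [(point_mul hρ h2).2 (ρ w⁻¹ η) w hq (hwu.symm ▸ hqu) rfl]
  refine point_congr ?_ hwu.symm _ _
  rw [← Equiv.Perm.mul_apply, ← map_mul, mul_inv_rev, inv_inv, mul_inv_cancel_right]

/-- The signs of a signed chamber in the coordinates of the dominant chamber. -/
lemma rel_of_eqvGen (hx₀ : StrictlyDominant b x₀) {z z' : SignedChambers b x₀}
    (h : Relation.EqvGen (Glue δ x₀) z z') : (z.2 : H) = z'.2 ∧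
      (coloring hρ hx₀).Rel (Finset.univ.filter fun a => facetForm a (z.2 : H) = weight b a.1 x₀)
        (ρ z.1.2 z.1.1) (ρ z'.1.2 z'.1.1) := by
  classical
  induction h with
  | rel z z' h =>
    cases h with
    | inner i ε w x hx hx' h =>
      refine ⟨rfl, ?_⟩
      -- The sign change of the internal gluing is undone by the extra factor `s_i`, so the global
      -- sign is constant across internal walls.
      have : ρ (w * simpleReflection b i) (δ.reflectSigns i ε) = ρ w ε := by
        rw [← hρ, map_mul, Equiv.Perm.mul_apply, ← Equiv.Perm.mul_apply (ρ _) (ρ _) ε, ← map_mul,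
          simpleReflection_mul_self, map_one, Equiv.Perm.one_apply]
      rw [this]
      exact FacetColoring.Rel.refl _ _
    | outer i ε w x hx h =>
      refine ⟨rfl, ?_⟩
      have h1 : facetFlip hρ (facetAt b w i) (ρ w ε) = ρ w (flipSign b i ε) := by
        rw [facetFlip_facetAt, signAction_inv_apply]
      rw [← h1]
      exact FacetColoring.Rel.flip (F := coloring hρ hx₀) (a := facetAt b w i)
        (Finset.mem_filter.2 ⟨Finset.mem_univ _, (mem_outerWall_iff.1 h).2⟩) (ρ w ε)
  | refl z => exact ⟨rfl, FacetColoring.Rel.refl _ _⟩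
  | symm z z' _ ih =>
    obtain ⟨h1, h2⟩ := ih
    exact ⟨h1.symm, h1 ▸ h2.symm⟩
  | trans z z' z'' _ _ ih ih' =>
    obtain ⟨h1, h2⟩ := ih
    obtain ⟨h1', h2'⟩ := ih'
    rw [← h1] at h2' h1'
    exact ⟨h1', h2.trans h2'⟩

/-- The global sign and the point are invariants of the gluing up to the involutions of the facets
through the point. Conversely, all those facets appear as external walls in any one chamber
containing the point. -/
lemma glueMap_eq_iff (hx₀ : StrictlyDominant b x₀) (η : Signs b) (q : polytope P x₀)
    (η' : Signs b) (q' : polytope P x₀) :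
    glueMap x₀ δ ρ (η, q) = glueMap x₀ δ ρ (η', q') ↔ q = q' ∧
      (coloring hρ hx₀).Rel (Finset.univ.filter fun a => facetForm a (q : H) = weight b a.1 x₀)
        η η' := by
  constructor
  · intro h
    obtain ⟨h1, h2⟩ := rel_of_eqvGen hρ hx₀ (Quot.eqvGen_exact h)
    refine ⟨Subtype.ext h1, ?_⟩
    simp only [signAction_apply_inv] at h2
    exact h2
  · rintro ⟨rfl, h⟩
    obtain ⟨w, hw⟩ := exists_dominant b (q : H)
    have hq : (q : H) ∈ chamberCell b x₀ w := mem_chamberCell_iff.2 ⟨q.2, hw⟩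
    induction h with
    | rel η η' h =>
      obtain ⟨a, ha, rfl⟩ := h
      rw [Finset.mem_filter] at ha
      obtain ⟨i, rfl, hi⟩ := (facetForm_eq_iff hx₀ hq).1 ha.2
      rw [glueMap_eq hρ η q hq, glueMap_eq hρ _ q hq]
      have h1 : ρ w⁻¹ ((coloring hρ hx₀).flip (facetAt b w i) η) = flipSign b i (ρ w⁻¹ η) := by
        change ρ w⁻¹ (facetFlip hρ (facetAt b w i) η) = _
        rw [facetFlip_facetAt, signAction_inv_apply]
      rw [point_congr h1 rfl hq hq]
      exact Quot.sound (Glue.outer i _ w q hq (mem_outerWall_iff.2 ⟨hq, hi⟩))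
    | refl => rfl
    | symm _ _ _ ih => exact ih.symm
    | trans _ _ _ _ _ ih ih' => exact ih.trans ih'

variable [TopologicalSpace H] [IsTopologicalAddGroup H] [ContinuousSMul ℝ H] [T2Space H]

include hρ in
-- The map is continuous on each of the finitely many closed chambers covering the polytope. It is a
-- quotient map because its composite with the continuous map `flatten` is the defining quotient of
-- the signed chambers.
lemma isQuotientMap_glueMap : Topology.IsQuotientMap (glueMap x₀ δ ρ) := by
  have : FiniteDimensional ℝ H := b.toCoweightBasis.finiteDimensional_of_finite
  have hlin : ∀ f : H →ₗ[ℝ] ℝ, Continuous f := fun f => f.continuous_of_finiteDimensional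
  have hclosed : ∀ w : P.weylGroup,
      IsClosed {q : polytope P x₀ | Dominant b (weylAct P w⁻¹ (q : H))} := by
    intro w
    simp only [Dominant, Set.ofPred_forall]
    refine isClosed_iInter fun i => isClosed_le continuous_const ?_
    exact (hlin (rootForm P i ∘ₗ weylLin P w⁻¹)).comp continuous_subtype_val
  let cover : Signs b × P.weylGroup → Set (Signs b × polytope P x₀) := fun k =>
    {k.1} ×ˢ {q : polytope P x₀ | Dominant b (weylAct P k.2⁻¹ (q : H))}
  have hcont : Continuous (glueMap x₀ δ ρ) := by
    refine (locallyFinite_of_finite cover).continuous ?_ ?_ ?_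
    · ext ⟨η, q⟩
      obtain ⟨w, hw⟩ := exists_dominant b (q : H)
      simp only [Set.mem_iUnion, Set.mem_univ, iff_true]
      exact ⟨(η, w), rfl, hw⟩
    · exact fun k => isClosed_singleton.prod (hclosed k.2)
    · rintro ⟨η, w⟩
      rw [continuousOn_iff_continuous_domRestrict]
      have hmem : ∀ z : cover (η, w), (z.1.2 : H) ∈ chamberCell b x₀ w := fun z =>
        mem_chamberCell_iff.2 ⟨z.1.2.2, z.2.2⟩
      have heq : (cover (η, w)).domRestrict (glueMap x₀ δ ρ) = fun z =>
          Quot.mk _ ⟨(ρ w⁻¹ η, w), ⟨z.1.2, hmem z⟩⟩ := by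
        funext z
        have hz : z.1.1 = η := z.2.1
        refine (glueMap_eq hρ z.1.1 z.1.2 (hmem z)).trans ?_
        exact point_congr (by rw [hz]) rfl _ _
      rw [heq]
      refine continuous_quot_mk.comp (continuous_sigmaMk.comp (Continuous.subtype_mk ?_ _))
      exact continuous_subtype_val.comp (continuous_snd.comp continuous_subtype_val)
  let flatten : SignedChambers b x₀ → Signs b × polytope P x₀ := fun z =>
    (ρ z.1.2 z.1.1, ⟨z.2, (mem_chamberCell_iff.1 z.2.2).1⟩)
  have hflatten : Continuous flatten := by
    refine continuous_sigma fun k => ?_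
    exact Continuous.prodMk (continuous_const (y := ρ k.2 k.1))
      (Continuous.subtype_mk continuous_subtype_val fun x => (mem_chamberCell_iff.1 x.2).1)
  refine Topology.IsQuotientMap.of_comp hflatten hcont ?_
  have heq : glueMap x₀ δ ρ ∘ flatten = Quot.mk _ := by
    funext z
    refine (glueMap_eq hρ _ _ z.2.2).trans ?_
    exact point_congr (signAction_inv_apply _ _) rfl _ _
  rw [heq]
  exact isQuotientMap_quot_mk

/-- The twisted Tomei manifold is glued from copies of the polytope. -/
def realization (hx₀ : StrictlyDominant b x₀) :
    (coloring hρ hx₀).Realization (TwistedTomeiManifold δ x₀) H where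
  polytope := polytope P x₀
  convex_polytope := convex_convexHull ℝ _
  form a :=
    have : FiniteDimensional ℝ H := b.toCoweightBasis.finiteDimensional_of_finite
    LinearMap.toContinuousLinearMap (facetForm a)
  bound a := weight b a.1 x₀
  form_le a q hq := by
    obtain ⟨i, w⟩ := a
    induction w using QuotientGroup.induction_on with
    | H w => exact weight_le_of_mem_polytope hx₀ (weylAct_mem_polytope hq w⁻¹) i
  isFace q hq := by
    obtain ⟨w, hw⟩ := exists_dominant b q
    refine ⟨w, fun a ha => ?_⟩
    obtain ⟨i, rfl, -⟩ := (facetForm_eq_iff hx₀ (mem_chamberCell_iff.2 ⟨hq, hw⟩)).1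
      (Finset.mem_filter.1 ha).2
    exact ⟨i, rfl⟩
  exists_point S hS := by
    obtain ⟨w, hw⟩ := hS
    -- The face spans the directions whose facets are not in `S`.
    obtain ⟨p, hp, hdom, hiff⟩ := exists_face_point hx₀ {i | facetAt b w i ∉ S}
    have hq : weylAct P w p ∈ chamberCell b x₀ w := ⟨p, ⟨hp, hdom⟩, rfl⟩
    refine ⟨weylAct P w p, weylAct_mem_polytope hp w, ?_⟩
    ext a
    rw [Finset.mem_filter]
    refine ⟨fun ha => ?_, fun ha => ⟨Finset.mem_univ _, ?_⟩⟩
    · obtain ⟨i, rfl, hi⟩ := (facetForm_eq_iff hx₀ hq).1 ha.2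
      rw [weylAct_inv_weylAct, hiff] at hi
      exact not_not.1 hi
    · obtain ⟨i, rfl⟩ := hw a ha
      refine (facetForm_eq_iff hx₀ hq).2 ⟨i, rfl, ?_⟩
      rw [weylAct_inv_weylAct, hiff]
      exact not_not.2 ha
  proj := glueMap x₀ δ ρ
  isQuotientMap_proj := isQuotientMap_glueMap hρ
  proj_eq_iff η q η' q' := glueMap_eq_iff hρ hx₀ η q η' q'

end Realization

end TwistedTomei

end


theorem theorem4p1 {ι V H : Type u} [Finite ι]
    [AddCommGroup V] [Module ℝ V] [AddCommGroup H] [Module ℝ H]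
    [TopologicalSpace H] [IsTopologicalAddGroup H] [ContinuousSMul ℝ H] [T2Space H]
    (P : RootPairing ι ℝ V H) [P.IsRootSystem] [P.IsCrystallographic] [P.IsReduced]
    (b : P.Base) (x₀ : H) (hx₀ : TwistedTomei.StrictlyDominant b x₀)
    (δ : TwistedTomei.MarkedDynkinDiagram b) (hδ : δ.GivesTwistedSignAction)
    (k : ℕ) (hk : k ≤ b.support.card) :
    Module.rank (ZMod 2)
        (TwistedTomei.HomologyModTwo k (TwistedTomei.TwistedTomeiManifold δ x₀)) =
      (TwistedTomei.numIndex b k : Cardinal) := by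
  obtain ⟨ρ, hρ⟩ := hδ
  have := Fintype.ofFinite P.weylGroup
  obtain ⟨c, hdeg, hc, hspan, hind⟩ :=
    (TwistedTomei.realization hρ hx₀).exists_singular_cycles
  rw [SingularModTwo.rank_homologyModTwo hdeg hc hspan hind k, TwistedTomei.numIndex]
  congr 1
  -- Ascending edges at `w` concern right multiplication and the unstable roots concern left
  -- multiplication, so the two counts are matched by inversion.
  refine Nat.card_congr (Equiv.subtypeEquiv (Equiv.inv P.weylGroup) fun w => ?_)
  have : TwistedTomei.unstableRoots b w⁻¹ = (TwistedTomei.coloring hρ hx₀).ascending w := by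
    ext i
    rw [TwistedTomei.mem_unstableRoots_iff, inv_inv]
    rfl
  rw [Equiv.inv_apply, this]
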